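/- Let $\mathbb F_q$ be a finite field of characteristic different from $2$ and $3$, $\mathbb E=\{\pm1\}$, $\mathbb E_+=\{\pm2\}$, $Q=\log_2 q$, $Z=\log_2 2=1$. Put $$h(x)=-x\log_2x-(1-x)\log_2(1-x),\qquad g(x,y)=-x\log_2x-y\log_2y-(1-x-y)\log_2(1-x-y),$$ $\binom{n}{k_1,k_2}=\binom{n}{k_1+k_2}\binom{k_1+k_2}{k_1}$, with $0\log_2 0=0$ and $X\cdot h(\cdot/X)=X\cdot g(\cdot/X,\cdot/X)=0$ for $X=0$. *Smaller instance.* Given $A\in\mathbb F_q^{(k+\ell)\times\ell}$ and $s\in\mathbb F_q^\ell$, enumerate vectors $x\in(\mathbb E\cup\{0\})^{k+\ell}$ of weight $v$ with $xA=s$. *Levels.* Let $\varepsilon_i,b_i,c_i$ ($i=1,2$) be non-negative integers, $v_0=v$, $m_0=0$ and, for $i=1,2$, $v_i=v_{i-1}/2+\varepsilon_i+c_i$, $m_i=(m_{i-1}-c_i)/2+b_i$. The parameters are admissible if $k+\ell,v_0,v_1,v_2,m_2,m_{i-1}-c_i$ are even, $v\le k+\ell$, $b_i\le v_{i-1}/2$,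 $c_i\le m_{i-1}$ and $v_{i-1}+m_{i-1}+\varepsilon_i\le k+\ell$. The search space $\mathcal S_i$ of level $i\in\{0,1,2\}$ consists of all vectors of length $k+\ell$ with exactly $v_i$ entries in $\mathbb E$, $m_i$ entries in $\mathbb E_+$ and zeros elsewhere. For $i\in\{0,1\}$, a representation of $e\in\mathcal S_i$ is a pair $(x,y)$ with $x+y=e$ such that: of the $v_i$ positions where $e$ is in $\mathbb E$, $(x,y)$ lies in $\mathbb E\times\{0\}$ on $v_i/2-b_{i+1}$, in $\{0\}\times\mathbb E$ on $v_i/2-b_{i+1}$, in $\mathbb E\times\mathbb E_+$ on $b_{i+1}$, and in $\mathbb E_+\times\mathbb E$ on $b_{i+1}$; of the $m_i$ positions where $e$ is in $\mathbb E_+$, it lies in $\mathbb E\times\mathbb E$ on $c_{i+1}$, and in $\mathbb E_+\times\{0\}$ and $\{0\}\times\mathbb E_+$ on $(m_i-c_{i+1})/2$ each; of the zero positions of $e$, it lies in $\mathbb E\times\mathbb E$ on $\varepsilon_{i+1}$ and is $(0,0)$ on the others. Let $r_i$ be the maximal number of representations of an $e\in\mathcal S_i$, and $u_i=\lfloor\log_q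 r_i\rfloor$. *The algorithm $\mathrm{BJMM}(2)_+$.* A collision search of two lists on $u$ positions with target $t$ stores one list in a dictionary, looks up the elements of the other, and writes out all sums $x+y$ with $(x+y)A=t$ on the first $u$ positions. A concatenation merge is a collision search on $u_1$ positions of the list of all vectors supported on the first half of the coordinates, with $v_2/2$ entries in $\mathbb E$, $m_2/2$ in $\mathbb E_+$ and zeros elsewhere, and the corresponding list for the second half. A representation merge is a collision search followed by a filter that keeps the vectors in $\mathcal S_i$, each once. Four concatenation merges with targets $0,0,0,s$ give $L_1,\dots,L_4$; representation merges on $u_0$ positions, filtering by $\mathcal S_1$, of $L_1,L_2$ with target $0$ and of $L_3,L_4$ with target $s$ give $K_1,K_2$; a representation merge of $K_1,K_2$ on all $\ell$ positions with target $s$, filtering by $\mathcal S_0$, gives the output. One step is one operation on a vector and its syndrome, or one dictionary access: listing, storing, looking up, writing out or filtering one element costs one step. **Theorem.** (a) For admissible parameters, $|\mathcal S_i|=\binom{k+\ell}{v_i,m_i}2^{v_i+m_i}$ for $i\le2$. For $i\in\{0,1\}$, every $e\in\mathcal S_i$ has exactly $$r_i=\binom{v_i}{v_i/2}\binom{v_i/2}{b_{i+1}}^{2}\binom{m_i}{(m_i-c_{i+1})/2,\;c_{i+1}}\binom{k+\ell-v_i-m_i}{\varepsilon_{i+1}}2^{\varepsilon_{i+1}}$$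 representations, and in each of them both summands are in $\mathcal S_{i+1}$. Every vector $x$ that the algorithm returns satisfies $x\in\mathcal S_0$ and $xA=s$. (b) Let $q$ be fixed, and let the parameters depend on $n$, be admissible and satisfy $u_1\le u_0\le\ell$ for all large $n$, with $k/n\to R$, $\ell/n\to L$, $v/n\to V_0$, $\varepsilon_i/n\to E_i$, $b_i/n\to B_i$, $c_i/n\to C_i$. Let $M_0=0$ and $$V_i=\frac{V_{i-1}}2+E_i+C_i,\qquad M_i=\frac{M_{i-1}-C_i}2+B_i\qquad(i=1,2).$$ Then $v_i/n\to V_i$ and $m_i/n\to M_i$ for $i\le2$, and $$\tfrac1n\log_2|\mathcal S_i|\to\Sigma_i:=(R+L)\,g\!\left(\tfrac{V_i}{R+L},\tfrac{M_i}{R+L}\right)+Z(V_i+M_i)\qquad(i\le2).$$ For $i\in\{0,1\}$, both $\tfrac1n\log_2r_i$ and $Q\,u_i/n$ converge to $$U_i:=V_i\left(1+h\!\left(\tfrac{2B_{i+1}}{V_i}\right)\right)+M_i\,g\!\left(\tfrac{C_{i+1}}{M_i},\tfrac{M_i-C_{i+1}}{2M_i}\right)+(R+L-V_i-M_i)\,h\!\left(\tfrac{E_{i+1}}{R+L-V_i-M_i}\right)+ZE_{i+1}.$$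 For all $e=e(n)\in\mathbb F_q^{k+\ell}$ and $t=t(n)\in\mathbb F_q^{\ell}$, the expected number $T_n$ of steps of the algorithm on input $(A,s)$, with $A$ uniformly random and $s=eA+t$ (so $e=0$ gives a fixed syndrome, $t=0$ the syndrome of a given error vector), satisfies $$\lim_{n\to\infty}\tfrac1n\log_2T_n=\max\left\{\tfrac{\Sigma_2}2,\ \Sigma_2-U_1,\ 2\Sigma_2-U_1-U_0,\ 2\Sigma_1-U_0-QL\right\}.$$ -/

import Mathlib

open Filter Topology

namespace RSDP

section Vectors

variable {F : Type*} [Field F] [Fintype F] [DecidableEq F]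

/-- The error set `𝔼 = {1, -1}` (the case `z = 2`). -/
def errSet (F : Type*) [Field F] [DecidableEq F] : Finset F := {1, -1}

/-- The additional elements `𝔼₊ = {2, -2}` allowed in intermediate lists. -/
def errSetPlus (F : Type*) [Field F] [DecidableEq F] : Finset F := {2, -2}

/-- Vectors supported on the coordinate set `S` that have exactly `v` entries `±1`,
exactly `m` entries `±2`, and zeros everywhere else. -/
def wellFormedOn {N : ℕ} (S : Finset (Fin N)) (v m : ℕ) : Finset (Fin N → F) :=
  Finset.univ.filter fun x =>
    (∀ j, x j ∈ errSet F ∨ x j ∈ errSetPlus F ∨ x j = 0) ∧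
    (∀ j, j ∉ S → x j = 0) ∧
    (Finset.univ.filter fun j => x j ∈ errSet F).card = v ∧
    (Finset.univ.filter fun j => x j ∈ errSetPlus F).card = m

/-- The number of coordinates `j` with `e j ∈ S`, `x j ∈ T` and `y j ∈ T'`. -/
def countPos {N : ℕ} (e x y : Fin N → F) (S T T' : Finset F) : ℕ :=
  (Finset.univ.filter fun j => e j ∈ S ∧ x j ∈ T ∧ y j ∈ T').card

/-- `e = x + y` is a representation of type `(b, c, ε)` of a vector `e` with `v` entries `±1` and
`m` entries `±2`.
* The `v` entries `±1` are split evenly between `x` and `y`; on `b` of the positions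
  given to `x`, the other summand `y` is `±2`, and vice versa.
* `c` of the entries `±2` are built as `±(1 + 1)`, the remaining ones are split evenly.
* On `ε` of the zero positions of `e`, a `±1` in `x` cancels against a `∓1` in `y`. -/
def IsRepr {N : ℕ} (v m b c ε : ℕ) (e x y : Fin N → F) : Prop :=
  x + y = e ∧
  countPos e x y (errSet F) (errSet F) {0} = v / 2 - b ∧
  countPos e x y (errSet F) {0} (errSet F) = v / 2 - b ∧
  countPos e x y (errSet F) (errSet F) (errSetPlus F) = b ∧
  countPos e x y (errSet F) (errSetPlus F) (errSet F) = b ∧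
  countPos e x y (errSetPlus F) (errSet F) (errSet F) = c ∧
  countPos e x y (errSetPlus F) (errSetPlus F) {0} = (m - c) / 2 ∧
  countPos e x y (errSetPlus F) {0} (errSetPlus F) = (m - c) / 2 ∧
  countPos e x y {0} (errSet F) (errSet F) = ε ∧
  countPos e x y {0} {0} {0} = N - v - m - ε

instance {N : ℕ} (v m b c ε : ℕ) (e x y : Fin N → F) : Decidable (IsRepr v m b c ε e x y) := by
  unfold IsRepr; infer_instance

/-- The first summands of the representations of `e` (the second one is `e - x`). -/
def reprs {N : ℕ} (v m b c ε : ℕ) (e : Fin N → F) : Finset (Fin N → F) :=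
  Finset.univ.filter fun x => IsRepr v m b c ε e x (e - x)

end Vectors

section Parameters

/-- The parameters of one run: the smaller instance has length `k + ℓ`, syndromes of length `ℓ`,
and asks for solutions of weight `v`; `eps i`, `b i`, `c i` (`i = 1, 2`) are the internal
parameters of level `i`. -/
structure Params where
  k : ℕ
  ℓ : ℕ
  v : ℕ
  eps : ℕ → ℕ
  b : ℕ → ℕ
  c : ℕ → ℕ

namespace Params

/-- Length of the vectors of the smaller instance. -/
def len (p : Params) : ℕ := p.k + p.ℓ

/-- `(v_i, m_i)`: the numbers of entries `±1` and `±2` of the vectors on level `i`. -/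
def weights (p : Params) : ℕ → ℕ × ℕ
  | 0 => (p.v, 0)
  | i + 1 => ((p.weights i).1 / 2 + p.eps (i + 1) + p.c (i + 1),
      ((p.weights i).2 - p.c (i + 1)) / 2 + p.b (i + 1))

/-- `v_i`, the number of entries `±1` on level `i`. -/
def vAt (p : Params) (i : ℕ) : ℕ := (p.weights i).1

/-- `m_i`, the number of entries `±2` on level `i`. -/
def mAt (p : Params) (i : ℕ) : ℕ := (p.weights i).2

/-- The parameters describe a run: everything that is halved is even, and no more positions are
chosen than there are. -/
structure Admissible (p : Params) : Prop where
  even_len : Even p.len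
  even_v : ∀ i ≤ 2, Even (p.vAt i)
  even_m : Even (p.mAt 2)
  weight_le : p.v ≤ p.len
  b_le : ∀ i < 2, p.b (i + 1) ≤ p.vAt i / 2
  c_le : ∀ i < 2, p.c (i + 1) ≤ p.mAt i
  even_sub : ∀ i < 2, Even (p.mAt i - p.c (i + 1))
  eps_le : ∀ i < 2, p.vAt i + p.mAt i + p.eps (i + 1) ≤ p.len

/-- The search space of level `i`. -/
def level (p : Params) (F : Type*) [Field F] [Fintype F] [DecidableEq F] (i : ℕ) :
    Finset (Fin p.len → F) :=
  wellFormedOn Finset.univ (p.vAt i) (p.mAt i)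

/-- The representations `x + (e - x)` of a level-`i` vector `e` by two level-`(i + 1)` vectors. -/
def levelReprs (p : Params) {F : Type*} [Field F] [Fintype F] [DecidableEq F] (i : ℕ)
    (e : Fin p.len → F) : Finset (Fin p.len → F) :=
  reprs (p.vAt i) (p.mAt i) (p.b (i + 1)) (p.c (i + 1)) (p.eps (i + 1)) e

/-- `r_i`, the number of representations of a level-`i` vector. -/
def reprCount (p : Params) (F : Type*) [Field F] [Fintype F] [DecidableEq F] (i : ℕ) : ℕ :=
  (p.level F i).sup fun e => (p.levelReprs i e).card

/-- `u_i = log_q r_i` (rounded down), the number of positions checked on level `i`. -/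
def mergePos (p : Params) (F : Type*) [Field F] [Fintype F] [DecidableEq F] (i : ℕ) : ℕ :=
  Nat.log (Fintype.card F) (p.reprCount F i)

end Params

end Parameters

section StepCount

universe u

/-- A computation together with the number of elementary steps it takes. -/
structure Timed (α : Type u) where
  val : α
  steps : ℕ

instance : Monad Timed where
  pure a := ⟨a, 0⟩
  bind x f := ⟨(f x.val).val, x.steps + (f x.val).steps⟩

/-- One elementary step: one operation on vectors of the smaller instance and their syndromes
(computing, copying, comparing), or one dictionary access. -/
def tick : Timed PUnit.{u + 1} := ⟨⟨⟩, 1⟩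

/-- Listing all elements of an explicitly described set, one step for each element. -/
noncomputable def enumerate {α : Type u} (S : Finset α) : Timed (List α) := ⟨S.toList, S.card⟩

/-- Storing all elements of a list in a dictionary, under their keys. -/
def store {α κ : Type u} [DecidableEq κ] (key : α → κ) : List α → Timed (κ → List α)
  | [] => pure fun _ => []
  | a :: as => do
    let D ← store key as
    tick
    pure (Function.update D (key a) (a :: D (key a)))

/-- Writing out `f a` for every `a` in a list. -/
def emit {α γ : Type u} (f : α → γ) : List α → Timed (List γ)
  | [] => pure []
  | a :: as => do
    tick
    let out ← emit f as
    pure (f a :: out)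

/-- For every `b` in a list, look up its key and combine `b` with all entries found there. -/
def probe {α β γ κ : Type u} (D : κ → List α) (key : β → κ) (f : α → β → γ) :
    List β → Timed (List γ)
  | [] => pure []
  | b :: bs => do
    tick
    let out ← emit (fun a => f a b) (D (key b))
    let rest ← probe D key f bs
    pure (out ++ rest)

/-- Collision search: all `f a b` with `key₁ a = key₂ b`. -/
def collide {α β γ κ : Type u} [DecidableEq κ] (L₁ : List α) (L₂ : List β)
    (key₁ : α → κ) (key₂ : β → κ) (f : α → β → γ) : Timed (List γ) := do
  let D ← store key₁ L₁
  probe D key₂ f L₂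

/-- Keep the elements that satisfy `P`, each of them once. -/
def sieve {α : Type u} [DecidableEq α] (P : α → Prop) [DecidablePred P] :
    List α → Timed (List α)
  | [] => pure []
  | a :: as => do
    let out ← sieve P as
    tick
    pure (if P a ∧ a ∉ out then a :: out else out)

end StepCount

section Algorithm

variable {F : Type*} [Field F] [Fintype F] [DecidableEq F]

/-- The first `u` positions of a syndrome (the others are blanked). -/
def firstPos {ℓ : ℕ} (u : ℕ) (t : Fin ℓ → F) : Fin ℓ → F := fun j => if j.val < u then t j else 0

/-- Concatenation merge: all vectors `x = (x₁, x₂)`, each half with `v₂/2` entries `±1` and `m₂/2`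
entries `±2`, such that `x A = t` on the first `u` positions. A half is stored as a
vector of full length that vanishes on the other half. -/
noncomputable def concatMerge (p : Params) (A : Matrix (Fin p.len) (Fin p.ℓ) F)
    (u : ℕ) (t : Fin p.ℓ → F) : Timed (List (Fin p.len → F)) := do
  let L₁ ← enumerate (wellFormedOn (F := F) (Finset.univ.filter fun j => j.val < p.len / 2)
    (p.vAt 2 / 2) (p.mAt 2 / 2))
  let L₂ ← enumerate (wellFormedOn (F := F) (Finset.univ.filter fun j => ¬ j.val < p.len / 2)
    (p.vAt 2 / 2) (p.mAt 2 / 2))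
  collide L₁ L₂ (fun x => firstPos u (Matrix.vecMul x A))
    (fun y => firstPos u (t - Matrix.vecMul y A)) (fun x y => x + y)

/-- Representation merge of two lists: all sums `x + y` with `(x + y) A = t` on the first `u`
positions, followed by the filtering step that keeps only the well-formed vectors of level `i`. -/
def reprMerge (p : Params) (A : Matrix (Fin p.len) (Fin p.ℓ) F) (i u : ℕ) (t : Fin p.ℓ → F)
    (L₁ L₂ : List (Fin p.len → F)) : Timed (List (Fin p.len → F)) := do
  let L ← collide L₁ L₂ (fun x => firstPos u (Matrix.vecMul x A))
    (fun y => firstPos u (t - Matrix.vecMul y A)) (fun x y => x + y)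
  sieve (fun x => x ∈ p.level F i) L

/-- The algorithm `BJMM(2)₊` on the smaller instance `x A = s`: a concatenation merge
followed by two levels of representation merges. -/
noncomputable def bjmmPlus (p : Params) (A : Matrix (Fin p.len) (Fin p.ℓ) F)
    (s : Fin p.ℓ → F) : Timed (List (Fin p.len → F)) := do
  let L₁ ← concatMerge p A (p.mergePos F 1) 0
  let L₂ ← concatMerge p A (p.mergePos F 1) 0
  let L₃ ← concatMerge p A (p.mergePos F 1) 0
  let L₄ ← concatMerge p A (p.mergePos F 1) s
  let K₁ ← reprMerge p A 1 (p.mergePos F 0) 0 L₁ L₂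
  let K₂ ← reprMerge p A 1 (p.mergePos F 0) s L₃ L₄
  reprMerge p A 0 p.ℓ s K₁ K₂

/-- The expected number of steps over a uniformly random matrix `A`, with syndrome
`s = e A + t`. For `e = 0` the syndrome is a fixed vector; for `t = 0` it is that of a
given error vector. -/
noncomputable def expectedCost (p : Params) (e : Fin p.len → F) (t : Fin p.ℓ → F) : ℝ :=
  (∑ A : Matrix (Fin p.len) (Fin p.ℓ) F,
    ((bjmmPlus p A (Matrix.vecMul e A + t)).steps : ℝ)) /
      Fintype.card (Matrix (Fin p.len) (Fin p.ℓ) F)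

end Algorithm

section Exponents

/-- The trinomial coefficient. -/
def trinomial (n k₁ k₂ : ℕ) : ℕ := n.choose (k₁ + k₂) * (k₁ + k₂).choose k₁

/-- The binary entropy function, in bits. -/
noncomputable def hBin (x : ℝ) : ℝ := -x * Real.logb 2 x - (1 - x) * Real.logb 2 (1 - x)

/-- The trinomial entropy function, in bits. -/
noncomputable def gTri (x y : ℝ) : ℝ :=
  -x * Real.logb 2 x - y * Real.logb 2 y - (1 - x - y) * Real.logb 2 (1 - x - y)

/-- `Z = log₂ z` for `z = 2`. -/
noncomputable def Z : ℝ := Real.logb 2 2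

/-- The exponent `Σ_i` of the size of the search space. -/
noncomputable def searchExp (R L V M : ℝ) : ℝ :=
  (R + L) * gTri (V / (R + L)) (M / (R + L)) + Z * (V + M)

/-- The exponent `U_i` of the number of representations; `V`, `M` belong to level `i`,
and `E`, `B`, `C` to level `i + 1`. -/
noncomputable def reprExp (R L V M E B C : ℝ) : ℝ :=
  V * (1 + hBin (2 * B / V)) + M * gTri (C / M) ((M - C) / (2 * M))
    + (R + L - V - M) * hBin (E / (R + L - V - M)) + Z * E

/-- The exponent of the enumeration cost. -/
noncomputable def enumCost (Q L S₁ S₂ U₀ U₁ : ℝ) : ℝ :=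
  max (max (S₂ / 2) (S₂ - U₁)) (max (2 * S₂ - U₁ - U₀) (2 * S₁ - U₀ - Q * L))

end Exponents

end RSDP

open RSDP

/-!
The counts on the levels are bijections with tuples of position sets. A well-formed vector is its
support, the positions of its entries `±1`, and the positions of its negative entries. A
representation `e = x + y` is determined by where `x` is nonzero and by where it deviates from its
default value there (`card_reprs`). Every position of a representation follows one of nine patterns
of `(e j, x j, y j)`, and these exhaust all coordinates, so the weights of the summands can be read
off.

For the expected cost, everything rests on one independence property: for a uniformly random matrix
`A`, the product `x A` is uniform and independent of all `w A` with `w` in a subspace `W` that does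
not contain `x` (`freq_and_of_notMem`). Hence the expected number of vectors or colliding pairs with
prescribed partial syndromes is the number of candidates divided by a power of `q`, up to the few
candidates that are linearly dependent (`sum_freq_single_le`, `sum_freq_pair_le`). As all lists are
free of repetitions, the number of steps is a sum of such numbers, which gives the upper bound
(`expectedCost_le`).

The first three terms of the maximum are lower bounds because the first two lists and their
collisions are described by homogeneous conditions, and those hold with at least the probability of
independent ones, for dependent vectors too (`le_freq_and_of_sub`). The last term counts collisions
of filtered lists, whose members are known to occur only if one of their representations survives
the first merges. This calls for the second moment method (`sq_genericCount_le`,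
`final_le_expectedCost`): the number of representations of `z` is at most `q ^ (u₁ + 1)`, so each
condition imposed on a representation costs a bounded factor only
(`DependsOn.sum_freq_and_le`). Two obstacles remain.

* The concatenation merges produce only vectors with evenly distributed weights. By a permutation of
  the coordinates it is enough to find many halves of the coordinate set that split both summands
  evenly, and rounding the halves of the nine pattern classes provides a polynomial
  fraction of all subsets (`card_level_mul_reprFormula_le`).
* Some quadruples of vectors are linearly dependent. They are negligible when `Σ₁ + U₁ > Σ₂`
  (`le_genericCount`), and this inequality holds whenever the last term of the maximum
  exceeds the others; otherwise the last term is not needed.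

Finally, Stirling's formula on the logarithmic scale (`tendsto_log_factorial`) turns all counts into
exponents, for which `HasRate` is a small calculus.
-/

set_option linter.unusedSectionVars false

namespace RSDP

/-! ### Costs and values of the list operations -/

section TimedLemmas

universe u

variable {α β γ κ : Type u}

theorem Timed.steps_bind (x : Timed α) (f : α → Timed β) :
    (x >>= f).steps = x.steps + (f x.val).steps := rfl

theorem Timed.val_bind (x : Timed α) (f : α → Timed β) :
    (x >>= f).val = (f x.val).val := rfl

theorem Timed.steps_pure (a : α) : (pure a : Timed α).steps = 0 := rfl

theorem Timed.val_pure (a : α) : (pure a : Timed α).val = a := rfl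

theorem steps_store [DecidableEq κ] (key : α → κ) (l : List α) :
    (store key l).steps = l.length := by
  induction l with
  | nil => rfl
  | cons a as ih =>
    simp only [store, Timed.steps_bind, Timed.steps_pure, ih, tick, List.length_cons]

/-- The dictionary lists under each key the elements with that key, in their original order. -/
theorem val_store [DecidableEq κ] (key : α → κ) (l : List α) (k : κ) :
    (store key l).val k = l.filter fun a => key a = k := by
  induction l with
  | nil => rfl
  | cons a as ih =>
    simp only [store, Timed.val_bind, Timed.val_pure, List.filter_cons, Function.update_apply]
    by_cases h : k = key a
    · subst h
      simp [ih]
    · rw [if_neg h, ih, if_neg]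
      simpa using fun h' => h h'.symm

theorem steps_emit (f : α → γ) (l : List α) : (emit f l).steps = l.length := by
  induction l with
  | nil => rfl
  | cons a as ih =>
    simp only [emit, Timed.steps_bind, Timed.steps_pure, ih, tick, List.length_cons]
    omega

theorem val_emit (f : α → γ) (l : List α) : (emit f l).val = l.map f := by
  induction l with
  | nil => rfl
  | cons a as ih =>
    simp only [emit, Timed.val_bind, Timed.val_pure, ih, List.map_cons]

theorem steps_probe (D : κ → List α) (key : β → κ) (f : α → β → γ) (l : List β) :
    (probe D key f l).steps = l.length + (probe D key f l).val.length := by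
  induction l with
  | nil => rfl
  | cons b bs ih =>
    simp only [probe, Timed.steps_bind, Timed.val_bind, Timed.steps_pure, Timed.val_pure, ih, tick,
      List.length_cons, List.length_append, steps_emit, val_emit, List.length_map]
    omega

theorem val_probe (D : κ → List α) (key : β → κ) (f : α → β → γ) (l : List β) :
    (probe D key f l).val = l.flatMap fun b => (D (key b)).map fun a => f a b := by
  induction l with
  | nil => rfl
  | cons b bs ih =>
    simp only [probe, Timed.val_bind, Timed.val_pure, ih, val_emit, List.flatMap_cons]

variable [DecidableEq κ] (L₁ : List α) (L₂ : List β) (key₁ : α → κ) (key₂ : β → κ)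
  (f : α → β → γ)

theorem steps_collide :
    (collide L₁ L₂ key₁ key₂ f).steps =
      L₁.length + L₂.length + (collide L₁ L₂ key₁ key₂ f).val.length := by
  simp only [collide, Timed.steps_bind, Timed.val_bind, steps_store, steps_probe]
  omega

theorem mem_collide {z : γ} :
    z ∈ (collide L₁ L₂ key₁ key₂ f).val ↔
      ∃ a ∈ L₁, ∃ b ∈ L₂, key₁ a = key₂ b ∧ f a b = z := by
  simp only [collide, Timed.val_bind, val_probe, val_store, List.mem_flatMap, List.mem_map,
    List.mem_filter, decide_eq_true_eq]
  constructor
  · rintro ⟨b, hb, a, ⟨ha, hk⟩, rfl⟩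
    exact ⟨a, ha, b, hb, hk, rfl⟩
  · rintro ⟨a, ha, b, hb, hk, rfl⟩
    exact ⟨b, hb, a, ⟨ha, hk⟩, rfl⟩

/-- For lists without repetitions, a collision search writes out one element for each colliding
pair. -/
theorem length_collide [DecidableEq α] [DecidableEq β] (h₁ : L₁.Nodup) (h₂ : L₂.Nodup) :
    (collide L₁ L₂ key₁ key₂ f).val.length =
      ((L₁.toFinset ×ˢ L₂.toFinset).filter fun q => key₁ q.1 = key₂ q.2).card := by
  have hs : (L₁.toFinset ×ˢ L₂.toFinset).filter (fun q => key₁ q.1 = key₂ q.2) =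
      (L₂.toFinset.sigma fun b => (L₁.filter fun a => key₁ a = key₂ b).toFinset).map
        ⟨fun s => (s.2, s.1), fun s t h => by
          rcases s with ⟨s, s'⟩
          rcases t with ⟨t, t'⟩
          simp only [Prod.mk.injEq] at h
          obtain ⟨rfl, rfl⟩ := h
          rfl⟩ := by
    ext ⟨a, b⟩
    simp only [Finset.mem_filter, Finset.mem_product, List.mem_toFinset, Finset.mem_map,
      Finset.mem_sigma, List.mem_filter, decide_eq_true_eq]
    constructor
    · rintro ⟨⟨ha, hb⟩, hk⟩
      exact ⟨⟨b, a⟩, ⟨hb, ha, hk⟩, rfl⟩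
    · rintro ⟨⟨b', a'⟩, ⟨hb, ha, hk⟩, h⟩
      have h' : (a', b') = (a, b) := h
      cases h'
      exact ⟨⟨ha, hb⟩, hk⟩
  rw [hs, Finset.card_map, Finset.card_sigma, List.sum_toFinset _ h₂]
  simp only [collide, Timed.val_bind, val_probe, val_store, List.length_flatMap, List.length_map]
  congr 1
  refine List.map_congr_left fun b _ => ?_
  rw [List.toFinset_card_of_nodup (h₁.filter _)]

theorem steps_sieve [DecidableEq α] (P : α → Prop) [DecidablePred P] (l : List α) :
    (sieve P l).steps = l.length := by
  induction l with
  | nil => rfl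
  | cons a as ih =>
    simp only [sieve, Timed.steps_bind, Timed.steps_pure, ih, tick, List.length_cons]

theorem mem_sieve [DecidableEq α] (P : α → Prop) [DecidablePred P] (l : List α) {x : α} :
    x ∈ (sieve P l).val ↔ x ∈ l ∧ P x := by
  induction l with
  | nil => simp [sieve, Timed.val_pure]
  | cons a as ih =>
    simp only [sieve, Timed.val_bind, Timed.val_pure]
    split_ifs with h
    · rw [List.mem_cons, ih, List.mem_cons]
      grind
    · rw [ih, List.mem_cons]
      grind

theorem nodup_sieve [DecidableEq α] (P : α → Prop) [DecidablePred P] (l : List α) :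
    (sieve P l).val.Nodup := by
  induction l with
  | nil => exact List.nodup_nil
  | cons a as ih =>
    simp only [sieve, Timed.val_bind, Timed.val_pure]
    split_ifs with h
    · exact List.nodup_cons.2 ⟨h.2, ih⟩
    · exact ih

theorem length_sieve_le [DecidableEq α] (P : α → Prop) [DecidablePred P] (l : List α) :
    (sieve P l).val.length ≤ l.length := by
  induction l with
  | nil => exact le_rfl
  | cons a as ih =>
    simp only [sieve, Timed.val_bind, Timed.val_pure]
    split_ifs with h
    · simpa using ih
    · exact ih.trans (Nat.le_succ _)

end TimedLemmas

/-! ### Counting vectors with prescribed weights -/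

section Counting

variable {F : Type*} [Field F] [DecidableEq F]

theorem mem_errSet {a : F} : a ∈ errSet F ↔ a = 1 ∨ a = -1 := by simp [errSet]

theorem mem_errSetPlus {a : F} : a ∈ errSetPlus F ↔ a = 2 ∨ a = -2 := by simp [errSetPlus]

/-- The five values `0, ±1, ±2` are distinct when the characteristic is neither `2` nor `3`. -/
theorem distinct_values {F : Type*} [Field F] (h2 : (2 : F) ≠ 0) (h3 : (3 : F) ≠ 0) :
    (1 : F) ≠ 0 ∧ (4 : F) ≠ 0 ∧ (1 : F) ≠ -1 ∧ (1 : F) ≠ 2 ∧ (1 : F) ≠ -2 ∧ (-1 : F) ≠ 2 ∧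
      (-1 : F) ≠ -2 ∧ (2 : F) ≠ -2 := by
  have h4 : (4 : F) ≠ 0 := by
    have : (4 : F) = 2 * 2 := by norm_num
    rw [this]; exact mul_ne_zero h2 h2
  refine ⟨one_ne_zero, h4, ?_, ?_, ?_, ?_, ?_, ?_⟩ <;> grind

theorem card_sigma_wellFormed {ι : Type*} [DecidableEq ι] (S : Finset ι) (v m : ℕ) :
    ((S.powersetCard (v + m)).sigma fun G => G.powersetCard v ×ˢ G.powerset).card =
      trinomial S.card v m * 2 ^ (v + m) := by
  rw [Finset.card_sigma, Finset.sum_congr rfl (g := fun _ => (v + m).choose v * 2 ^ (v + m))]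
  · rw [Finset.sum_const, Finset.card_powersetCard, trinomial, smul_eq_mul, mul_assoc]
  · intro G hG
    rw [Finset.card_product, Finset.card_powersetCard, Finset.card_powerset,
      (Finset.mem_powersetCard.1 hG).2]

variable [Fintype F]

/-- A vector is determined by its support, the positions of the entries `±1`, and the positions
of the entries `-1`, `-2`. -/
theorem card_wellFormedOn (h2 : (2 : F) ≠ 0) (h3 : (3 : F) ≠ 0) {N : ℕ} (S : Finset (Fin N))
    (v m : ℕ) :
    (wellFormedOn (F := F) S v m).card = trinomial S.card v m * 2 ^ (v + m) := by
  obtain ⟨h1, h4, d1, d2, d3, d4, d5, d6⟩ := distinct_values h2 h3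
  rw [← card_sigma_wellFormed]
  refine Finset.card_bij'
    (fun x _ => ⟨Finset.univ.filter fun j => x j ≠ 0, Finset.univ.filter fun j => x j ∈ errSet F,
      Finset.univ.filter fun j => x j = -1 ∨ x j = -2⟩)
    (fun D _ j => if j ∈ D.1 then (if j ∈ D.2.1 then 1 else 2) * (if j ∈ D.2.2 then -1 else 1)
      else 0) ?_ ?_ ?_ ?_
  · intro x hx
    obtain ⟨ha, hS, hv, hm⟩ := (Finset.mem_filter.1 hx).2
    simp only [Finset.mem_sigma, Finset.mem_product, Finset.mem_powersetCard,
      Finset.mem_powerset]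
    refine ⟨⟨?_, ?_⟩, ⟨?_, hv⟩, ?_⟩
    · intro j hj
      by_contra hjS
      exact (Finset.mem_filter.1 hj).2 (hS j hjS)
    · rw [← hv, ← hm, ← Finset.card_union_of_disjoint]
      · congr 1
        ext j
        have := ha j
        simp only [mem_errSet, mem_errSetPlus, Finset.mem_filter, Finset.mem_univ, true_and,
          Finset.mem_union] at this ⊢
        grind
      · rw [Finset.disjoint_filter]
        intro j _
        simp only [mem_errSet, mem_errSetPlus]
        grind
    · intro j
      simp only [mem_errSet, Finset.mem_filter, Finset.mem_univ, true_and]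
      grind
    · intro j
      simp only [Finset.mem_filter, Finset.mem_univ, true_and]
      grind
  · rintro ⟨G, P, D⟩ hD
    simp only [Finset.mem_sigma, Finset.mem_product, Finset.mem_powersetCard,
      Finset.mem_powerset] at hD
    obtain ⟨⟨hGS, hG⟩, ⟨hPG, hP⟩, hDG⟩ := hD
    simp only [wellFormedOn, Finset.mem_filter, Finset.mem_univ, true_and, mem_errSet,
      mem_errSetPlus]
    refine ⟨fun j => ?_, fun j hj => if_neg fun h => hj (hGS h), ?_, ?_⟩
    · split_ifs <;> grind
    · rw [← hP]
      congr 1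
      ext j
      have := @hPG j
      simp only [Finset.mem_filter, Finset.mem_univ, true_and]
      split_ifs <;> grind
    · have : m = (G \ P).card := by rw [Finset.card_sdiff_of_subset hPG]; omega
      rw [this]
      congr 1
      ext j
      simp only [Finset.mem_filter, Finset.mem_univ, true_and, Finset.mem_sdiff]
      split_ifs <;> grind
  · intro x hx
    obtain ⟨ha, hS, hv, hm⟩ := (Finset.mem_filter.1 hx).2
    funext j
    have := ha j
    simp only [mem_errSet, mem_errSetPlus, Finset.mem_filter, Finset.mem_univ,
      true_and] at this ⊢
    split_ifs <;> grind
  · rintro ⟨G, P, D⟩ hD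
    simp only [Finset.mem_sigma, Finset.mem_product, Finset.mem_powersetCard,
      Finset.mem_powerset] at hD
    obtain ⟨⟨hGS, hG⟩, ⟨hPG, hP⟩, hDG⟩ := hD
    have e1 : (Finset.univ.filter fun j => (if j ∈ G then (if j ∈ P then (1 : F) else 2) *
        (if j ∈ D then -1 else 1) else 0) ≠ 0) = G := by
      ext j
      simp only [Finset.mem_filter, Finset.mem_univ, true_and]
      split_ifs <;> grind
    have e2 : (Finset.univ.filter fun j => (if j ∈ G then (if j ∈ P then (1 : F) else 2) *
        (if j ∈ D then -1 else 1) else 0) ∈ errSet F) = P := by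
      ext j
      have := @hPG j
      simp only [Finset.mem_filter, Finset.mem_univ, true_and, mem_errSet]
      split_ifs <;> grind
    have e3 : (Finset.univ.filter fun j => (if j ∈ G then (if j ∈ P then (1 : F) else 2) *
        (if j ∈ D then -1 else 1) else 0) = -1 ∨ (if j ∈ G then (if j ∈ P then (1 : F) else 2) *
        (if j ∈ D then -1 else 1) else 0) = -2) = D := by
      ext j
      have := @hDG j
      simp only [Finset.mem_filter, Finset.mem_univ, true_and]
      split_ifs <;> grind
    simp only [e1, e2, e3]

end Counting

/-! ### Patterns of representations -/

section Patterns

variable {F : Type*} [Field F] [DecidableEq F]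

/-- The type of a field element: `1` for `±1`, `2` for `±2`, `0` for zero and `3` for everything
else. -/
def typ (a : F) : Fin 4 :=
  if a = 0 then 0 else if a ∈ errSet F then 1 else if a ∈ errSetPlus F then 2 else 3

/-- The types of `(e j, x j, y j)` that may occur in a representation `e = x + y`. -/
def patterns : Finset (Fin 4 × Fin 4 × Fin 4) :=
  {(1, 1, 0), (1, 0, 1), (1, 1, 2), (1, 2, 1), (2, 1, 1), (2, 2, 0), (2, 0, 2), (0, 1, 1),
    (0, 0, 0)}

/-- The patterns in which a given summand is `±1`, respectively `±2`. -/
theorem filter_patterns :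
    patterns.filter (fun q => q.2.1 = 1) = {(1, 1, 0), (1, 1, 2), (2, 1, 1), (0, 1, 1)} ∧
      patterns.filter (fun q => q.2.1 = 2) = {(1, 2, 1), (2, 2, 0)} ∧
      patterns.filter (fun q => q.2.2 = 1) = {(1, 0, 1), (1, 2, 1), (2, 1, 1), (0, 1, 1)} ∧
      patterns.filter (fun q => q.2.2 = 2) = {(1, 1, 2), (2, 0, 2)} := by
  decide

/-- The number of positions of each pattern in a representation of type `(b, c, ε)`. -/
def patternCount (N v m b c ε : ℕ) (q : Fin 4 × Fin 4 × Fin 4) : ℕ :=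
  if q = (1, 1, 0) then v / 2 - b else if q = (1, 0, 1) then v / 2 - b
  else if q = (1, 1, 2) then b else if q = (1, 2, 1) then b
  else if q = (2, 1, 1) then c else if q = (2, 2, 0) then (m - c) / 2
  else if q = (2, 0, 2) then (m - c) / 2 else if q = (0, 1, 1) then ε
  else if q = (0, 0, 0) then N - v - m - ε else 0

/-- The pattern of the position `j` in `e = x + y`. -/
def pattern {N : ℕ} (e x y : Fin N → F) (j : Fin N) : Fin 4 × Fin 4 × Fin 4 :=
  (typ (e j), typ (x j), typ (y j))

theorem typ_eq_zero {a : F} : typ a = 0 ↔ a = 0 := by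
  unfold typ; split_ifs <;> simp_all

theorem typ_eq_one {a : F} : typ a = 1 ↔ a ∈ errSet F := by
  unfold typ; split_ifs <;> simp_all [errSet]

theorem typ_eq_two (h2 : (2 : F) ≠ 0) (h3 : (3 : F) ≠ 0) {a : F} :
    typ a = 2 ↔ a ∈ errSetPlus F := by
  obtain ⟨h1, h4, d1, d2, d3, d4, d5, d6⟩ := distinct_values h2 h3
  unfold typ
  simp only [mem_errSet, mem_errSetPlus]
  split_ifs <;> grind

theorem countPos_eq {N : ℕ} (e x y : Fin N → F) {S T T' : Finset F} {s t t' : Fin 4}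
    (hS : ∀ a, typ a = s ↔ a ∈ S) (hT : ∀ a, typ a = t ↔ a ∈ T) (hT' : ∀ a, typ a = t' ↔ a ∈ T') :
    countPos e x y S T T' = (Finset.univ.filter fun j => pattern e x y j = (s, t, t')).card := by
  unfold countPos pattern
  congr 1
  ext j
  simp [hS, hT, hT']

/-- The nine counts in the definition of a representation, indexed by patterns. -/
theorem isRepr_iff (h2 : (2 : F) ≠ 0) (h3 : (3 : F) ≠ 0) {N : ℕ} (v m b c ε : ℕ)
    (e x y : Fin N → F) :
    IsRepr v m b c ε e x y ↔ x + y = e ∧ ∀ q ∈ patterns,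
      (Finset.univ.filter fun j => pattern e x y j = q).card = patternCount N v m b c ε q := by
  have t0 : ∀ a : F, typ a = 0 ↔ a ∈ ({0} : Finset F) := by simp [typ_eq_zero]
  have t1 : ∀ a : F, typ a = 1 ↔ a ∈ errSet F := fun a => typ_eq_one
  have t2 : ∀ a : F, typ a = 2 ↔ a ∈ errSetPlus F := fun a => typ_eq_two h2 h3
  unfold IsRepr
  rw [countPos_eq e x y t1 t1 t0, countPos_eq e x y t1 t0 t1, countPos_eq e x y t1 t1 t2,
    countPos_eq e x y t1 t2 t1, countPos_eq e x y t2 t1 t1, countPos_eq e x y t2 t2 t0,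
    countPos_eq e x y t2 t0 t2, countPos_eq e x y t0 t1 t1, countPos_eq e x y t0 t0 t0]
  simp [patterns, patternCount]

theorem sum_patternCount {N v m b c ε : ℕ} (hv : Even v) (hb : b ≤ v / 2) (hc : c ≤ m)
    (hmc : Even (m - c)) (hN : v + m + ε ≤ N) :
    ∑ q ∈ patterns, patternCount N v m b c ε q = N := by
  obtain ⟨a, rfl⟩ := hv
  obtain ⟨g, hg⟩ := hmc
  simp [patterns, patternCount]
  omega

/-- Every position of a representation follows one of the nine patterns, as the prescribed numbers
of positions add up to the number of all coordinates. -/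
theorem pattern_mem (h2 : (2 : F) ≠ 0) (h3 : (3 : F) ≠ 0) {N v m b c ε : ℕ} (hv : Even v)
    (hb : b ≤ v / 2) (hc : c ≤ m) (hmc : Even (m - c)) (hN : v + m + ε ≤ N)
    {e x y : Fin N → F} (h : IsRepr v m b c ε e x y) (j : Fin N) :
    pattern e x y j ∈ patterns := by
  have h1 := ((isRepr_iff h2 h3 v m b c ε e x y).1 h).2
  have h4 : (Finset.univ.filter fun j => pattern e x y j ∈ patterns).card = N := by
    rw [Finset.card_eq_sum_card_fiberwise (f := pattern e x y) (t := patterns)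
      (fun j hj => by simpa using hj)]
    conv_rhs => rw [← sum_patternCount hv hb hc hmc hN]
    refine Finset.sum_congr rfl fun q hq => ?_
    rw [← h1 q hq]
    congr 1
    ext j
    simp only [Finset.mem_filter, Finset.mem_univ, true_and]
    exact ⟨fun h => h.2, fun h => ⟨h ▸ hq, h⟩⟩
  have h5 := Finset.eq_univ_of_card _ (h4.trans (Fintype.card_fin N).symm)
  have := Finset.mem_univ j
  rw [← h5] at this
  exact (Finset.mem_filter.1 this).2

/-- Counting the positions in `H` with a given property of the pattern, pattern by pattern. -/
theorem card_filter_pattern {N : ℕ} {e x y : Fin N → F} (hp : ∀ j, pattern e x y j ∈ patterns)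
    (H : Finset (Fin N)) (P : Fin 4 × Fin 4 × Fin 4 → Prop) [DecidablePred P] :
    (H.filter fun j => P (pattern e x y j)).card =
      ∑ q ∈ patterns.filter P, (H.filter fun j => pattern e x y j = q).card := by
  rw [Finset.card_eq_sum_card_fiberwise (f := pattern e x y) (t := patterns.filter P)
    (fun j hj => by
      have := (Finset.mem_filter.1 hj).2
      simpa [hp j] using this)]
  refine Finset.sum_congr rfl fun q hq => ?_
  congr 1
  ext j
  simp only [Finset.mem_filter] at hq ⊢
  constructor
  · rintro ⟨⟨h, -⟩, h'⟩; exact ⟨h, h'⟩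
  · rintro ⟨h, h'⟩; exact ⟨⟨h, h' ▸ hq.2⟩, h'⟩

variable [Fintype F]

/-- Well-formedness in terms of types; the weights may be counted inside the support set. -/
theorem mem_wellFormedOn_iff (h2 : (2 : F) ≠ 0) (h3 : (3 : F) ≠ 0) {N : ℕ} (S : Finset (Fin N))
    (v m : ℕ) (x : Fin N → F) :
    x ∈ wellFormedOn S v m ↔ (∀ j, typ (x j) ≠ 3) ∧ (∀ j, j ∉ S → x j = 0) ∧
      (S.filter fun j => typ (x j) = 1).card = v ∧ (S.filter fun j => typ (x j) = 2).card = m := by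
  have t3 : ∀ a : F, (a ∈ errSet F ∨ a ∈ errSetPlus F ∨ a = 0) ↔ typ a ≠ 3 := by
    intro a
    rw [← typ_eq_one, ← typ_eq_two h2 h3, ← typ_eq_zero]
    generalize typ a = t
    revert t; decide
  simp only [wellFormedOn, Finset.mem_filter, Finset.mem_univ, true_and, t3]
  refine and_congr_right fun _ => and_congr_right fun hS => ?_
  have e : ∀ s : Fin 4, s ≠ 0 → (Finset.univ.filter fun j => typ (x j) = s) =
      S.filter fun j => typ (x j) = s := by
    intro s hs
    ext j
    simp only [Finset.mem_filter, Finset.mem_univ, true_and, iff_and_self]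
    rintro rfl
    by_contra hj
    exact hs (typ_eq_zero.2 (hS j hj))
  rw [← e 1 (by decide), ← e 2 (by decide)]
  simp only [typ_eq_one, typ_eq_two h2 h3]

/-- Both summands of a representation are well-formed for the weights of the next level. -/
theorem IsRepr.mem_wellFormedOn (h2 : (2 : F) ≠ 0) (h3 : (3 : F) ≠ 0) {N v m b c ε : ℕ}
    (hv : Even v) (hb : b ≤ v / 2) (hc : c ≤ m) (hmc : Even (m - c)) (hN : v + m + ε ≤ N)
    {e x y : Fin N → F} (h : IsRepr v m b c ε e x y) :
    x ∈ wellFormedOn Finset.univ (v / 2 + ε + c) ((m - c) / 2 + b) ∧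
      y ∈ wellFormedOn Finset.univ (v / 2 + ε + c) ((m - c) / 2 + b) := by
  have hp := pattern_mem h2 h3 hv hb hc hmc hN h
  have h1 := ((isRepr_iff h2 h3 v m b c ε e x y).1 h).2
  have key : ∀ (P : Fin 4 × Fin 4 × Fin 4 → Prop) [DecidablePred P],
      (Finset.univ.filter fun j => P (pattern e x y j)).card =
        ∑ q ∈ patterns.filter P, patternCount N v m b c ε q := by
    intro P _
    rw [card_filter_pattern hp]
    exact Finset.sum_congr rfl fun q hq => h1 q (Finset.mem_filter.1 hq).1
  have k1 := key fun q => q.2.1 = 1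
  have k2 := key fun q => q.2.1 = 2
  have k3 := key fun q => q.2.2 = 1
  have k4 := key fun q => q.2.2 = 2
  obtain ⟨e1, e2, e3, e4⟩ := filter_patterns
  rw [e1] at k1; rw [e2] at k2; rw [e3] at k3; rw [e4] at k4
  simp [patternCount, pattern] at k1 k2 k3 k4
  have n3 : ∀ j, (pattern e x y j).2.1 ≠ 3 ∧ (pattern e x y j).2.2 ≠ 3 := by
    intro j
    have := hp j
    revert this
    generalize pattern e x y j = t
    revert t
    decide
  rw [mem_wellFormedOn_iff h2 h3, mem_wellFormedOn_iff h2 h3]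
  refine ⟨⟨fun j => (n3 j).1, by simp, k1.trans ?_, k2.trans ?_⟩,
    ⟨fun j => (n3 j).2, by simp, k3.trans ?_, k4.trans ?_⟩⟩ <;> omega

end Patterns

/-! ### Counting representations -/

section CountReprs

variable {F : Type*} [Field F] [DecidableEq F]

/-- The representations of `e`, expressed by the values of the first summand only. -/
theorem isRepr_sub_iff (h2 : (2 : F) ≠ 0) (h3 : (3 : F) ≠ 0) {N : ℕ} (v m b c ε : ℕ)
    (e x : Fin N → F) :
    IsRepr v m b c ε e x (e - x) ↔
      (Finset.univ.filter fun j => (e j = 1 ∨ e j = -1) ∧ x j = e j).card = v / 2 - b ∧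
      (Finset.univ.filter fun j => (e j = 1 ∨ e j = -1) ∧ x j = 0).card = v / 2 - b ∧
      (Finset.univ.filter fun j => (e j = 1 ∨ e j = -1) ∧ x j = -e j).card = b ∧
      (Finset.univ.filter fun j => (e j = 1 ∨ e j = -1) ∧ x j = 2 * e j).card = b ∧
      (Finset.univ.filter fun j => (e j = 2 ∨ e j = -2) ∧ 2 * x j = e j).card = c ∧
      (Finset.univ.filter fun j => (e j = 2 ∨ e j = -2) ∧ x j = e j).card = (m - c) / 2 ∧
      (Finset.univ.filter fun j => (e j = 2 ∨ e j = -2) ∧ x j = 0).card = (m - c) / 2 ∧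
      (Finset.univ.filter fun j => e j = 0 ∧ (x j = 1 ∨ x j = -1)).card = ε ∧
      (Finset.univ.filter fun j => e j = 0 ∧ x j = 0).card = N - v - m - ε := by
  obtain ⟨h1, h4, d1, d2, d3, d4, d5, d6⟩ := distinct_values h2 h3
  have hs : ∀ S T T' : Finset F, ∀ P : F → F → Prop, ∀ _ : ∀ a b, Decidable (P a b),
      (∀ a b, (a ∈ S ∧ b ∈ T ∧ a - b ∈ T') ↔ P a b) →
      countPos e x (e - x) S T T' = (Finset.univ.filter fun j => P (e j) (x j)).card := by
    intro S T T' P _ h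
    unfold countPos
    congr 1
    ext j
    simp [← h]
  unfold IsRepr
  rw [hs (errSet F) (errSet F) {0} (fun a b => (a = 1 ∨ a = -1) ∧ b = a) inferInstance,
    hs (errSet F) {0} (errSet F) (fun a b => (a = 1 ∨ a = -1) ∧ b = 0) inferInstance,
    hs (errSet F) (errSet F) (errSetPlus F) (fun a b => (a = 1 ∨ a = -1) ∧ b = -a) inferInstance,
    hs (errSet F) (errSetPlus F) (errSet F) (fun a b => (a = 1 ∨ a = -1) ∧ b = 2 * a)
      inferInstance,
    hs (errSetPlus F) (errSet F) (errSet F) (fun a b => (a = 2 ∨ a = -2) ∧ 2 * b = a)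
      inferInstance,
    hs (errSetPlus F) (errSetPlus F) {0} (fun a b => (a = 2 ∨ a = -2) ∧ b = a) inferInstance,
    hs (errSetPlus F) {0} (errSetPlus F) (fun a b => (a = 2 ∨ a = -2) ∧ b = 0) inferInstance,
    hs {0} (errSet F) (errSet F) (fun a b => a = 0 ∧ (b = 1 ∨ b = -1)) inferInstance,
    hs {0} {0} {0} (fun a b => a = 0 ∧ b = 0) inferInstance]
  · simp
  all_goals
    intro a b
    simp only [mem_errSet, mem_errSetPlus, Finset.mem_singleton]
    grind

/-- The positions that determine a representation: on the entries `±1` of `e`, the half `H` given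
to `x` and the positions in and outside `H` where the other summand is `±2`; on the entries `±2`,
the positions where `x` is nonzero and those where `x` is the whole entry; on the zeros,
the positions where a `±1` cancels and those where `x` is `-1`. -/
theorem card_sigma_reprs {ι : Type*} [DecidableEq ι] (S S' S'' : Finset ι) (v b g c ε : ℕ)
    (hv : Even v) (hS : S.card = v) :
    ((((S.powersetCard (v / 2)).sigma fun H => H.powersetCard b ×ˢ (S \ H).powersetCard b)) ×ˢ
      (((S'.powersetCard (g + c)).sigma fun G => G.powersetCard g) ×ˢ
        ((S''.powersetCard ε).sigma fun D => D.powerset))).card =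
      v.choose (v / 2) * ((v / 2).choose b) ^ 2 * trinomial S'.card g c *
        (S''.card.choose ε * 2 ^ ε) := by
  have hv2 : v - v / 2 = v / 2 := by obtain ⟨a, rfl⟩ := hv; omega
  have e1 : ((S.powersetCard (v / 2)).sigma fun H =>
      H.powersetCard b ×ˢ (S \ H).powersetCard b).card =
      v.choose (v / 2) * ((v / 2).choose b) ^ 2 := by
    rw [Finset.card_sigma, Finset.sum_congr rfl (g := fun _ => ((v / 2).choose b) ^ 2)]
    · rw [Finset.sum_const, Finset.card_powersetCard, smul_eq_mul, hS]
    · intro H hH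
      rw [Finset.card_product, Finset.card_powersetCard, Finset.card_powersetCard,
        Finset.card_sdiff_of_subset (Finset.mem_powersetCard.1 hH).1,
        (Finset.mem_powersetCard.1 hH).2, hS, hv2, sq]
  have e2 : ((S'.powersetCard (g + c)).sigma fun G => G.powersetCard g).card =
      trinomial S'.card g c := by
    rw [Finset.card_sigma, Finset.sum_congr rfl (g := fun _ => (g + c).choose g)]
    · rw [Finset.sum_const, Finset.card_powersetCard, smul_eq_mul, trinomial]
    · intro G hG
      rw [Finset.card_powersetCard, (Finset.mem_powersetCard.1 hG).2]
  have e3 : ((S''.powersetCard ε).sigma fun D => D.powerset).card = S''.card.choose ε * 2 ^ ε := by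
    rw [Finset.card_sigma, Finset.sum_congr rfl (g := fun _ => 2 ^ ε)]
    · rw [Finset.sum_const, Finset.card_powersetCard, smul_eq_mul]
    · intro D hD
      rw [Finset.card_powerset, (Finset.mem_powersetCard.1 hD).2]
  rw [Finset.card_product, Finset.card_product, e1, e2, e3, mul_assoc (_ * _)]

/-- The first summand of the representation described by the position sets of
`card_sigma_reprs`. -/
def assemble {N : ℕ} (e : Fin N → F) (H B₁ B₂ G G₁ D D₁ : Finset (Fin N)) (j : Fin N) : F :=
  if e j = 1 ∨ e j = -1 then
    (if j ∈ H then (if j ∈ B₁ then -e j else e j) else if j ∈ B₂ then 2 * e j else 0)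
  else if e j = 2 ∨ e j = -2 then (if j ∈ G then (if j ∈ G₁ then e j else e j / 2) else 0)
  else if j ∈ D then (if j ∈ D₁ then -1 else 1) else 0

/-- On an entry `±1` of `e`, the value of the assembled vector recovers the position sets. -/
theorem assemble_of_errSet (h2 : (2 : F) ≠ 0) (h3 : (3 : F) ≠ 0) {N : ℕ} {e : Fin N → F}
    {H B₁ B₂ G G₁ D D₁ : Finset (Fin N)} {j : Fin N} (hj : e j = 1 ∨ e j = -1)
    (hB₁ : j ∈ B₁ → j ∈ H) (hB₂ : j ∈ B₂ → j ∉ H) :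
    (assemble e H B₁ B₂ G G₁ D D₁ j = e j ↔ j ∈ H ∧ j ∉ B₁) ∧
      (assemble e H B₁ B₂ G G₁ D D₁ j = 0 ↔ j ∉ H ∧ j ∉ B₂) ∧
      (assemble e H B₁ B₂ G G₁ D D₁ j = -e j ↔ j ∈ B₁) ∧
      (assemble e H B₁ B₂ G G₁ D D₁ j = 2 * e j ↔ j ∈ B₂) := by
  obtain ⟨h1, h4, d1, d2, d3, d4, d5, d6⟩ := distinct_values h2 h3
  rw [assemble, if_pos hj]
  generalize e j = a at *
  split_ifs <;> grind

/-- On an entry `±2` of `e`, the value of the assembled vector recovers the position sets. -/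
theorem assemble_of_errSetPlus (h2 : (2 : F) ≠ 0) (h3 : (3 : F) ≠ 0) {N : ℕ} {e : Fin N → F}
    {H B₁ B₂ G G₁ D D₁ : Finset (Fin N)} {j : Fin N} (hj : e j = 2 ∨ e j = -2)
    (hG₁ : j ∈ G₁ → j ∈ G) :
    (2 * assemble e H B₁ B₂ G G₁ D D₁ j = e j ↔ j ∈ G ∧ j ∉ G₁) ∧
      (assemble e H B₁ B₂ G G₁ D D₁ j = e j ↔ j ∈ G₁) ∧
      (assemble e H B₁ B₂ G G₁ D D₁ j = 0 ↔ j ∉ G) := by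
  obtain ⟨h1, h4, d1, d2, d3, d4, d5, d6⟩ := distinct_values h2 h3
  have hj' : ¬ (e j = 1 ∨ e j = -1) := by grind
  rw [assemble, if_neg hj', if_pos hj]
  generalize e j = a at *
  split_ifs <;> grind

/-- On a zero of `e`, the value of the assembled vector recovers the position sets. -/
theorem assemble_of_zero (h2 : (2 : F) ≠ 0) {N : ℕ} {e : Fin N → F}
    {H B₁ B₂ G G₁ D D₁ : Finset (Fin N)} {j : Fin N} (hj : e j = 0) (hD₁ : j ∈ D₁ → j ∈ D) :
    (assemble e H B₁ B₂ G G₁ D D₁ j = 1 ∨ assemble e H B₁ B₂ G G₁ D D₁ j = -1 ↔ j ∈ D) ∧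
      (assemble e H B₁ B₂ G G₁ D D₁ j = 0 ↔ j ∉ D) ∧
      (assemble e H B₁ B₂ G G₁ D D₁ j = -1 ↔ j ∈ D₁) := by
  have hj1 : ¬ (e j = 1 ∨ e j = -1) := by grind
  have hj2 : ¬ (e j = 2 ∨ e j = -2) := by grind
  rw [assemble, if_neg hj1, if_neg hj2]
  split_ifs <;> grind

/-- The values that the first summand may take, given the entry of `e`. -/
theorem values_of_pattern_mem (h2 : (2 : F) ≠ 0) (h3 : (3 : F) ≠ 0) {N : ℕ} {e x : Fin N → F}
    {j : Fin N} (h : pattern e x (e - x) j ∈ patterns) :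
    ((e j = 1 ∨ e j = -1) → x j = e j ∨ x j = 0 ∨ x j = -e j ∨ x j = 2 * e j) ∧
      ((e j = 2 ∨ e j = -2) → 2 * x j = e j ∨ x j = e j ∨ x j = 0) ∧
      (e j = 0 → x j = 1 ∨ x j = -1 ∨ x j = 0) := by
  obtain ⟨h1, h4, d1, d2, d3, d4, d5, d6⟩ := distinct_values h2 h3
  simp only [pattern, patterns, Finset.mem_insert, Finset.mem_singleton, Prod.mk.injEq,
    typ_eq_zero, typ_eq_one, typ_eq_two h2 h3, mem_errSet, mem_errSetPlus, Pi.sub_apply] at h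
  generalize e j = a at *
  generalize x j = b at *
  refine ⟨fun h => ?_, fun h => ?_, fun h => ?_⟩ <;> grind

variable [Fintype F]

set_option maxHeartbeats 1000000 in
/-- The number of representations of a well-formed vector: first summands correspond to the
position sets counted in `card_sigma_reprs`, with inverse `assemble`. -/
theorem card_reprs (h2 : (2 : F) ≠ 0) (h3 : (3 : F) ≠ 0) {N v m b c ε : ℕ} (hv : Even v)
    (hb : b ≤ v / 2) (hc : c ≤ m) (hmc : Even (m - c)) (hN : v + m + ε ≤ N)
    {e : Fin N → F} (he : e ∈ wellFormedOn Finset.univ v m) :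
    (reprs v m b c ε e).card =
      v.choose (v / 2) * ((v / 2).choose b) ^ 2 * trinomial m ((m - c) / 2) c *
        ((N - v - m).choose ε * 2 ^ ε) := by
  obtain ⟨h1, h4, d1, d2, d3, d4, d5, d6⟩ := distinct_values h2 h3
  obtain ⟨hval, -, hev, hem⟩ := (Finset.mem_filter.1 he).2
  simp only [mem_errSet, mem_errSetPlus] at hval hev hem
  set S : Finset (Fin N) := Finset.univ.filter fun j => e j = 1 ∨ e j = -1 with hSdef
  set S' : Finset (Fin N) := Finset.univ.filter fun j => e j = 2 ∨ e j = -2 with hSdef'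
  set S'' : Finset (Fin N) := Finset.univ.filter fun j => e j = 0 with hSdef''
  have mS : ∀ j, j ∈ S ↔ e j = 1 ∨ e j = -1 := fun j => by simp [hSdef]
  have mS' : ∀ j, j ∈ S' ↔ e j = 2 ∨ e j = -2 := fun j => by simp [hSdef']
  have mS'' : ∀ j, j ∈ S'' ↔ e j = 0 := fun j => by simp [hSdef'']
  have hS0 : S''.card = N - v - m := by
    have hd : (S ∪ S')ᶜ = S'' := by
      ext j
      have := hval j
      rw [Finset.mem_compl, Finset.mem_union, mS, mS', mS'']
      grind
    have hdis : Disjoint S S' := by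
      rw [Finset.disjoint_left]
      intro j
      rw [mS, mS']
      grind
    rw [← hd, Finset.card_compl, Finset.card_union_of_disjoint hdis, hev, hem, Fintype.card_fin]
    omega
  have hvv : v / 2 - b + b = v / 2 := by omega
  have hv2 : v - v / 2 = v / 2 := by obtain ⟨a, rfl⟩ := hv; omega
  have hmm : (m - c) / 2 + c + (m - c) / 2 = m := by obtain ⟨a, ha⟩ := hmc; omega
  have hcard := card_sigma_reprs S S' S'' v b ((m - c) / 2) c ε hv hev
  rw [hem, hS0] at hcard
  rw [← hcard]
  have hiff : ∀ x : Fin N → F, IsRepr v m b c ε e x (e - x) ↔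
      (S.filter fun j => x j = e j).card = v / 2 - b ∧
      (S.filter fun j => x j = 0).card = v / 2 - b ∧
      (S.filter fun j => x j = -e j).card = b ∧ (S.filter fun j => x j = 2 * e j).card = b ∧
      (S'.filter fun j => 2 * x j = e j).card = c ∧
      (S'.filter fun j => x j = e j).card = (m - c) / 2 ∧
      (S'.filter fun j => x j = 0).card = (m - c) / 2 ∧
      (S''.filter fun j => x j = 1 ∨ x j = -1).card = ε ∧
      (S''.filter fun j => x j = 0).card = N - v - m - ε := by
    intro x
    rw [isRepr_sub_iff h2 h3]
    simp only [hSdef, hSdef', hSdef'', Finset.filter_filter]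
  refine Finset.card_bij'
    (fun x _ => (⟨S.filter fun j => x j = e j ∨ x j = -e j, S.filter fun j => x j = -e j,
        S.filter fun j => x j = 2 * e j⟩,
      ⟨S'.filter fun j => x j ≠ 0, S'.filter fun j => x j = e j⟩,
      ⟨S''.filter fun j => x j ≠ 0, S''.filter fun j => x j = -1⟩))
    (fun d _ => assemble e d.1.1 d.1.2.1 d.1.2.2 d.2.1.1 d.2.1.2 d.2.2.1 d.2.2.2) ?_ ?_ ?_ ?_
  · intro x hx
    have hr := (Finset.mem_filter.1 hx).2
    have hp := pattern_mem h2 h3 hv hb hc hmc hN hr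
    obtain ⟨c1, c2, c3, c4, c5, c6, c7, c8, c9⟩ := (hiff x).1 hr
    have hval' := fun j => values_of_pattern_mem h2 h3 (hp j)
    simp only [Finset.mem_sigma, Finset.mem_product, Finset.mem_powersetCard,
      Finset.mem_powerset]
    refine ⟨⟨⟨Finset.filter_subset _ _, ?_⟩, ⟨?_, c3⟩, ⟨?_, c4⟩⟩,
      ⟨⟨Finset.filter_subset _ _, ?_⟩, ⟨?_, c6⟩⟩, ⟨Finset.filter_subset _ _, ?_⟩, ?_⟩
    · rw [Finset.filter_or, Finset.card_union_of_disjoint, c1, c3, hvv]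
      rw [Finset.disjoint_filter]
      intro j hj
      rw [mS] at hj
      grind
    · exact Finset.monotone_filter_right _ fun j _ h => Or.inr h
    · intro j
      simp only [Finset.mem_filter, Finset.mem_sdiff, mS]
      grind
    · refine Eq.trans ?_ (congrArg₂ (· + ·) c6 c5)
      rw [← Finset.card_union_of_disjoint]
      · congr 1
        ext j
        have := hval' j
        simp only [Finset.mem_filter, Finset.mem_union, mS']
        grind
      · rw [Finset.disjoint_filter]
        intro j hj
        rw [mS'] at hj
        grind
    · intro j
      simp only [Finset.mem_filter, mS']
      grind
    · rw [← c8]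
      congr 1
      ext j
      have := hval' j
      simp only [Finset.mem_filter, mS'']
      grind
    · intro j
      simp only [Finset.mem_filter, mS'']
      grind
  · rintro ⟨⟨H, B₁, B₂⟩, ⟨G, G₁⟩, ⟨D, D₁⟩⟩ hd
    simp only [Finset.mem_sigma, Finset.mem_product, Finset.mem_powersetCard,
      Finset.mem_powerset] at hd
    obtain ⟨⟨⟨hH, kH⟩, ⟨hB₁, kB₁⟩, hB₂, kB₂⟩, ⟨⟨hG, kG⟩, hG₁, kG₁⟩, ⟨hD, kD⟩, hD₁⟩ := hd
    refine Finset.mem_filter.2 ⟨Finset.mem_univ _, (hiff _).2 ?_⟩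
    have q1 : v / 2 - b = (H \ B₁).card := by rw [Finset.card_sdiff_of_subset hB₁, kH, kB₁]
    have q2 : v / 2 - b = ((S \ H) \ B₂).card := by
      rw [Finset.card_sdiff_of_subset hB₂, Finset.card_sdiff_of_subset hH, kH, kB₂, hev, hv2]
    have q3 : c = (G \ G₁).card := by rw [Finset.card_sdiff_of_subset hG₁, kG, kG₁]; omega
    have q4 : (m - c) / 2 = (S' \ G).card := by
      rw [Finset.card_sdiff_of_subset hG, kG, hem]; omega
    have q5 : N - v - m - ε = (S'' \ D).card := by
      rw [Finset.card_sdiff_of_subset hD, kD, hS0]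
    have v1 := fun j hj => assemble_of_errSet (G := G) (G₁ := G₁) (D := D) (D₁ := D₁) h2 h3
      ((mS j).1 hj) (@hB₁ j) fun h => (Finset.mem_sdiff.1 (hB₂ h)).2
    have v2 := fun j hj => assemble_of_errSetPlus (H := H) (B₁ := B₁) (B₂ := B₂) (D := D)
      (D₁ := D₁) h2 h3 ((mS' j).1 hj) (@hG₁ j)
    have v3 := fun j hj => assemble_of_zero (H := H) (B₁ := B₁) (B₂ := B₂) (G := G)
      (G₁ := G₁) h2 ((mS'' j).1 hj) (@hD₁ j)
    rw [q1, q4, q5, ← q1]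
    refine ⟨Eq.trans ?_ q1.symm, Eq.trans ?_ q2.symm, Eq.trans ?_ kB₁, Eq.trans ?_ kB₂,
      Eq.trans ?_ q3.symm, Eq.trans ?_ (kG₁.trans q4), ?_, Eq.trans ?_ kD, ?_⟩
    all_goals
      congr 1
      ext j
      simp only [Finset.mem_filter, Finset.mem_sdiff]
      grind
  · intro x hx
    have hr := (Finset.mem_filter.1 hx).2
    have hp := pattern_mem h2 h3 hv hb hc hmc hN hr
    funext j
    have hval' := values_of_pattern_mem h2 h3 (hp j)
    have := hval j
    rcases hval j with hj | hj | hj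
    · have hjS : j ∈ S := (mS j).2 hj
      have hnn : e j ≠ -e j := by grind
      have hv := assemble_of_errSet (G := {j ∈ S' | x j ≠ 0}) (G₁ := {j ∈ S' | x j = e j})
        (D := {j ∈ S'' | x j ≠ 0}) (D₁ := {j ∈ S'' | x j = -1})
        (H := {j ∈ S | x j = e j ∨ x j = -e j}) (B₁ := {j ∈ S | x j = -e j})
        (B₂ := {j ∈ S | x j = 2 * e j}) h2 h3 hj (by simp +contextual)
        (by simp only [Finset.mem_filter, hjS, true_and]; grind)
      simp only [Finset.mem_filter, hjS, true_and] at hv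
      rcases hval'.1 hj with h | h | h | h <;> rw [h]
      · exact hv.1.2 ⟨Or.inl h, h ▸ hnn⟩
      · refine hv.2.1.2 ⟨?_, ?_⟩ <;> rw [h] <;> grind
      · exact hv.2.2.1.2 h
      · exact hv.2.2.2.2 h
    · have hjS : j ∈ S' := (mS' j).2 hj
      have hv := assemble_of_errSetPlus (G := {j ∈ S' | x j ≠ 0}) (G₁ := {j ∈ S' | x j = e j})
        (D := {j ∈ S'' | x j ≠ 0}) (D₁ := {j ∈ S'' | x j = -1})
        (H := {j ∈ S | x j = e j ∨ x j = -e j}) (B₁ := {j ∈ S | x j = -e j})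
        (B₂ := {j ∈ S | x j = 2 * e j}) h2 h3 hj
        (by simp only [Finset.mem_filter, hjS, true_and]; grind)
      simp only [Finset.mem_filter, hjS, true_and] at hv
      rcases hval'.2.1 hj with h | h | h
      · have hx0 : x j ≠ 0 := by grind
        have hx1 : x j ≠ e j := by grind
        exact mul_left_cancel₀ h2 ((hv.1.2 ⟨hx0, hx1⟩).trans h.symm)
      · rw [h]; exact hv.2.1.2 h
      · rw [h]; exact hv.2.2.2 (by simp [h])
    · have hjS : j ∈ S'' := (mS'' j).2 hj
      have hv := assemble_of_zero (G := {j ∈ S' | x j ≠ 0}) (G₁ := {j ∈ S' | x j = e j})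
        (D := {j ∈ S'' | x j ≠ 0}) (D₁ := {j ∈ S'' | x j = -1})
        (H := {j ∈ S | x j = e j ∨ x j = -e j}) (B₁ := {j ∈ S | x j = -e j})
        (B₂ := {j ∈ S | x j = 2 * e j}) h2 hj
        (by simp only [Finset.mem_filter, hjS, true_and]; grind)
      simp only [Finset.mem_filter, hjS, true_and] at hv
      rcases hval'.2.2 hj with h | h | h
      · rw [h]
        exact (hv.1.2 (by rw [h]; exact h1)).resolve_right fun h' => d1 (h.symm.trans (hv.2.2.1 h'))
      · rw [h]; exact hv.2.2.2 h
      · rw [h]; exact hv.2.1.2 (by simp [h])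
  · rintro ⟨⟨H, B₁, B₂⟩, ⟨G, G₁⟩, ⟨D, D₁⟩⟩ hd
    simp only [Finset.mem_sigma, Finset.mem_product, Finset.mem_powersetCard,
      Finset.mem_powerset] at hd
    obtain ⟨⟨⟨hH, kH⟩, ⟨hB₁, kB₁⟩, hB₂, kB₂⟩, ⟨⟨hG, kG⟩, hG₁, kG₁⟩, ⟨hD, kD⟩, hD₁⟩ := hd
    have v1 := fun j hj => assemble_of_errSet (G := G) (G₁ := G₁) (D := D) (D₁ := D₁) h2 h3
      ((mS j).1 hj) (@hB₁ j) fun h => (Finset.mem_sdiff.1 (hB₂ h)).2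
    have v2 := fun j hj => assemble_of_errSetPlus (H := H) (B₁ := B₁) (B₂ := B₂) (D := D)
      (D₁ := D₁) h2 h3 ((mS' j).1 hj) (@hG₁ j)
    have v3 := fun j hj => assemble_of_zero (H := H) (B₁ := B₁) (B₂ := B₂) (G := G)
      (G₁ := G₁) h2 ((mS'' j).1 hj) (@hD₁ j)
    simp only [Prod.mk.injEq, Sigma.mk.injEq, heq_eq_eq]
    refine ⟨⟨?_, ?_, ?_⟩, ⟨?_, ?_⟩, ?_, ?_⟩
    all_goals
      ext j
      simp only [Finset.mem_filter]
      grind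

end CountReprs

/-! ### Exact counts on the levels, and correctness of the algorithm -/

section FirstPositions

variable {F : Type*} [Field F]

theorem firstPos_apply {ℓ : ℕ} (u : ℕ) (t : Fin ℓ → F) (j : Fin ℓ) :
    firstPos u t j = if j.val < u then t j else 0 := rfl

theorem firstPos_self {ℓ : ℕ} (t : Fin ℓ → F) : firstPos ℓ t = t := by
  funext j
  rw [firstPos_apply, if_pos j.2]

theorem firstPos_add {ℓ : ℕ} (u : ℕ) (s t : Fin ℓ → F) :
    firstPos u (s + t) = firstPos u s + firstPos u t := by
  funext j
  simp only [firstPos_apply, Pi.add_apply]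
  split_ifs <;> simp

theorem firstPos_sub {ℓ : ℕ} (u : ℕ) (s t : Fin ℓ → F) :
    firstPos u (s - t) = firstPos u s - firstPos u t := by
  funext j
  simp only [firstPos_apply, Pi.sub_apply]
  split_ifs <;> simp

theorem firstPos_zero {ℓ : ℕ} (u : ℕ) : firstPos u (0 : Fin ℓ → F) = 0 := by
  funext j
  simp [firstPos_apply]

/-- Agreement on the first `u` positions implies agreement on fewer positions. -/
theorem firstPos_mono {ℓ u u' : ℕ} (h : u ≤ u') {s t : Fin ℓ → F}
    (hst : firstPos u' s = firstPos u' t) : firstPos u s = firstPos u t := by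
  funext j
  have := congrFun hst j
  simp only [firstPos_apply] at this ⊢
  split_ifs with hj
  · rwa [if_pos (hj.trans_le h), if_pos (hj.trans_le h)] at this
  · rfl

theorem firstPos_idem {ℓ : ℕ} (u : ℕ) (t : Fin ℓ → F) :
    firstPos u (firstPos u t) = firstPos u t := by
  funext j
  simp only [firstPos_apply]
  split_ifs <;> rfl

/-- The two keys of a merge agree exactly if the sum has the prescribed partial syndrome. -/
theorem firstPos_key {N ℓ u : ℕ} (A : Matrix (Fin N) (Fin ℓ) F) (x y : Fin N → F)
    (t : Fin ℓ → F) :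
    firstPos u (Matrix.vecMul x A) = firstPos u (t - Matrix.vecMul y A) ↔
      firstPos u (Matrix.vecMul (x + y) A) = firstPos u t := by
  rw [Matrix.add_vecMul, firstPos_sub, firstPos_add, eq_sub_iff_add_eq]

end FirstPositions

section Levels

variable {F : Type*} [Field F] [Fintype F] [DecidableEq F]

namespace Params

theorem vAt_succ (p : Params) (i : ℕ) :
    p.vAt (i + 1) = p.vAt i / 2 + p.eps (i + 1) + p.c (i + 1) := rfl

theorem mAt_succ (p : Params) (i : ℕ) :
    p.mAt (i + 1) = (p.mAt i - p.c (i + 1)) / 2 + p.b (i + 1) := rfl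

theorem Admissible.weights_le {p : Params} (hp : p.Admissible) {i : ℕ} (hi : i ≤ 2) :
    p.vAt i + p.mAt i ≤ p.len := by
  rcases Nat.lt_or_ge i 2 with h | h
  · exact (Nat.le_add_right _ _).trans (hp.eps_le i h)
  · obtain rfl : i = 2 := le_antisymm hi h
    have h1 := hp.eps_le 1 (by norm_num)
    have h2 : p.b 2 ≤ p.vAt 1 / 2 := hp.b_le 1 (by norm_num)
    have h3 : p.c 2 ≤ p.mAt 1 := hp.c_le 1 (by norm_num)
    have h4 : p.vAt 2 = p.vAt 1 / 2 + p.eps 2 + p.c 2 := p.vAt_succ 1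
    have h5 : p.mAt 2 = (p.mAt 1 - p.c 2) / 2 + p.b 2 := p.mAt_succ 1
    have h1 : p.vAt 1 + p.mAt 1 + p.eps 2 ≤ p.len := h1
    omega

theorem card_level (h2 : (2 : F) ≠ 0) (h3 : (3 : F) ≠ 0) (p : Params) (i : ℕ) :
    (p.level F i).card = trinomial p.len (p.vAt i) (p.mAt i) * 2 ^ (p.vAt i + p.mAt i) := by
  rw [level, card_wellFormedOn h2 h3, Finset.card_fin]

theorem trinomial_pos {n k₁ k₂ : ℕ} (h : k₁ + k₂ ≤ n) : 0 < trinomial n k₁ k₂ :=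
  Nat.mul_pos (Nat.choose_pos h) (Nat.choose_pos (Nat.le_add_right _ _))

theorem Admissible.card_level_pos (h2 : (2 : F) ≠ 0) (h3 : (3 : F) ≠ 0) {p : Params}
    (hp : p.Admissible) {i : ℕ} (hi : i ≤ 2) : 0 < (p.level F i).card := by
  rw [card_level h2 h3]
  exact Nat.mul_pos (trinomial_pos (hp.weights_le hi)) (by positivity)

/-- The closed formula for the number of representations of a level-`i` vector. -/
def reprFormula (p : Params) (i : ℕ) : ℕ :=
  (p.vAt i).choose (p.vAt i / 2) * ((p.vAt i / 2).choose (p.b (i + 1))) ^ 2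
    * trinomial (p.mAt i) ((p.mAt i - p.c (i + 1)) / 2) (p.c (i + 1))
    * ((p.len - p.vAt i - p.mAt i).choose (p.eps (i + 1)) * 2 ^ p.eps (i + 1))

theorem Admissible.card_levelReprs (h2 : (2 : F) ≠ 0) (h3 : (3 : F) ≠ 0) {p : Params}
    (hp : p.Admissible) {i : ℕ} (hi : i < 2) {e : Fin p.len → F} (he : e ∈ p.level F i) :
    (p.levelReprs i e).card = p.reprFormula i :=
  card_reprs h2 h3 (hp.even_v i hi.le) (hp.b_le i hi) (hp.c_le i hi) (hp.even_sub i hi)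
    (hp.eps_le i hi) he

theorem Admissible.reprCount_eq (h2 : (2 : F) ≠ 0) (h3 : (3 : F) ≠ 0) {p : Params}
    (hp : p.Admissible) {i : ℕ} (hi : i < 2) : p.reprCount F i = p.reprFormula i := by
  rw [reprCount, Finset.sup_congr rfl fun e he => hp.card_levelReprs h2 h3 hi he]
  exact Finset.sup_const (Finset.card_pos.1 (hp.card_level_pos h2 h3 hi.le)) _

theorem Admissible.summands_mem_level (h2 : (2 : F) ≠ 0) (h3 : (3 : F) ≠ 0) {p : Params}
    (hp : p.Admissible) {i : ℕ} (hi : i < 2) {e x : Fin p.len → F}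
    (hx : x ∈ p.levelReprs i e) : x ∈ p.level F (i + 1) ∧ e - x ∈ p.level F (i + 1) :=
  ((Finset.mem_filter.1 hx).2).mem_wellFormedOn h2 h3 (hp.even_v i hi.le) (hp.b_le i hi)
    (hp.c_le i hi) (hp.even_sub i hi) (hp.eps_le i hi)

/-- Distinct representations are distinct pairs of vectors of the next level. -/
theorem Admissible.card_level_mul_le (h2 : (2 : F) ≠ 0) (h3 : (3 : F) ≠ 0) {p : Params}
    (hp : p.Admissible) {i : ℕ} (hi : i < 2) :
    (p.level F i).card * p.reprFormula i ≤ (p.level F (i + 1)).card ^ 2 := by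
  have h : ((p.level F i).sigma fun e => p.levelReprs i e).card =
      (p.level F i).card * p.reprFormula i := by
    rw [Finset.card_sigma, Finset.sum_congr rfl fun e he => hp.card_levelReprs h2 h3 hi he,
      Finset.sum_const, smul_eq_mul]
  rw [← h, sq, ← Finset.card_product]
  refine Finset.card_le_card_of_injOn (fun t => (t.2, t.1 - t.2)) ?_ ?_
  · rintro ⟨e, x⟩ ht
    obtain ⟨-, hx⟩ := Finset.mem_sigma.1 ht
    exact Finset.mem_product.2 (hp.summands_mem_level h2 h3 hi hx)
  · rintro ⟨e, x⟩ - ⟨e', x'⟩ - h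
    simp only [Prod.mk.injEq] at h
    obtain ⟨rfl, h⟩ := h
    rw [sub_left_inj] at h
    rw [h]

end Params

theorem mem_reprMerge (p : Params) (A : Matrix (Fin p.len) (Fin p.ℓ) F) (i u : ℕ)
    (t : Fin p.ℓ → F) (L₁ L₂ : List (Fin p.len → F)) (z : Fin p.len → F) :
    z ∈ (reprMerge p A i u t L₁ L₂).val ↔ z ∈ p.level F i ∧ ∃ x ∈ L₁, ∃ y ∈ L₂,
      firstPos u (Matrix.vecMul (x + y) A) = firstPos u t ∧ x + y = z := by
  simp only [reprMerge, Timed.val_bind, mem_sieve, mem_collide, firstPos_key]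
  exact and_comm

/-- Every vector that the algorithm returns passed the last filter and the last collision. -/
theorem of_mem_bjmmPlus (p : Params) (A : Matrix (Fin p.len) (Fin p.ℓ) F) (s : Fin p.ℓ → F)
    {x : Fin p.len → F} (hx : x ∈ (bjmmPlus p A s).val) :
    x ∈ p.level F 0 ∧ Matrix.vecMul x A = s := by
  simp only [bjmmPlus, Timed.val_bind, mem_reprMerge] at hx
  obtain ⟨hx, y, -, z, -, h, rfl⟩ := hx
  rw [firstPos_self, firstPos_self] at h
  exact ⟨hx, h⟩

end Levels

/-! ### Uniformly random matrices -/

section Random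

variable {F : Type*} [Field F]

/-- A vector outside a subspace is separated from it by a dot product. -/
theorem exists_dotProduct_separating {N : ℕ} (W : Submodule F (Fin N → F)) {x : Fin N → F}
    (hx : x ∉ W) : ∃ d : Fin N → F, (∀ w ∈ W, w ⬝ᵥ d = 0) ∧ x ⬝ᵥ d = 1 := by
  obtain ⟨f, hf, hW⟩ := Submodule.exists_le_ker_of_notMem hx
  have hrep : ∀ w, f w = w ⬝ᵥ fun i => f (Pi.single i 1) := by
    intro w
    rw [LinearMap.pi_apply_eq_sum_univ f w]
    refine Finset.sum_congr rfl fun i _ => ?_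
    rw [smul_eq_mul]
    congr 2
    ext j
    simp [Pi.single_apply, eq_comm]
  refine ⟨fun i => (f x)⁻¹ * f (Pi.single i 1), fun w hw => ?_, ?_⟩
  · have h : w ⬝ᵥ (fun i => (f x)⁻¹ * f (Pi.single i 1)) = (f x)⁻¹ * f w := by
      rw [hrep w, dotProduct, dotProduct, Finset.mul_sum]
      exact Finset.sum_congr rfl fun i _ => by ring
    rw [h, LinearMap.mem_ker.1 (hW hw), mul_zero]
  · have h : x ⬝ᵥ (fun i => (f x)⁻¹ * f (Pi.single i 1)) = (f x)⁻¹ * f x := by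
      rw [hrep x, dotProduct, dotProduct, Finset.mul_sum]
      exact Finset.sum_congr rfl fun i _ => by ring
    rw [h, inv_mul_cancel₀ hf]

theorem vecMul_add_vecMulVec {N ℓ : ℕ} (A : Matrix (Fin N) (Fin ℓ) F) (x d : Fin N → F)
    (a : Fin ℓ → F) :
    Matrix.vecMul x (A + Matrix.vecMulVec d a) = Matrix.vecMul x A + (x ⬝ᵥ d) • a := by
  rw [Matrix.vecMul_add, Matrix.vecMul_vecMulVec]

variable [Fintype F] [DecidableEq F]

/-- The number of partial syndromes. -/
theorem card_firstPos_range {ℓ u : ℕ} (hu : u ≤ ℓ) :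
    (Finset.univ.filter fun a : Fin ℓ → F => firstPos u a = a).card = Fintype.card F ^ u := by
  have h : (Finset.univ.filter fun a : Fin ℓ → F => firstPos u a = a) =
      Fintype.piFinset fun j : Fin ℓ => if j.val < u then Finset.univ else {0} := by
    ext a
    simp only [Finset.mem_filter, Finset.mem_univ, true_and, Fintype.mem_piFinset, funext_iff,
      firstPos_apply]
    refine forall_congr' fun j => ?_
    split_ifs <;> simp [eq_comm]
  rw [h, Fintype.card_piFinset]
  have h' : ∀ j : Fin ℓ, (if j.val < u then (Finset.univ : Finset F) else {0}).card =
      if j.val < u then Fintype.card F else 1 := by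
    intro j
    split_ifs <;> simp
  rw [Finset.prod_congr rfl fun j _ => h' j, Finset.prod_ite, Finset.prod_const,
    Finset.prod_const_one, mul_one]
  congr 1
  rw [Fin.card_filter_val_lt, min_eq_right hu]

/-- A set `E` of matrices whose membership is not affected by adding `d aᵀ` is independent of
the product with a vector `x` such that `x ⬝ d = 1`. -/
theorem card_filter_vecMul_mul {N ℓ u : ℕ} (hu : u ≤ ℓ) (E : Finset (Matrix (Fin N) (Fin ℓ) F))
    {x d : Fin N → F} (hx : x ⬝ᵥ d = 1)
    (hE : ∀ A ∈ E, ∀ a, A + Matrix.vecMulVec d a ∈ E) (t : Fin ℓ → F) :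
    (E.filter fun A => firstPos u (Matrix.vecMul x A) = firstPos u t).card * Fintype.card F ^ u =
      E.card := by
  have key : ∀ s s' : Fin ℓ → F,
      (E.filter fun A => firstPos u (Matrix.vecMul x A) = firstPos u s).card ≤
        (E.filter fun A => firstPos u (Matrix.vecMul x A) = firstPos u s').card := by
    intro s s'
    refine Finset.card_le_card_of_injOn (fun A => A + Matrix.vecMulVec d (s' - s)) ?_ ?_
    · intro A hA
      obtain ⟨h1, h2⟩ := Finset.mem_filter.1 hA
      refine Finset.mem_filter.2 ⟨hE A h1 _, ?_⟩
      rw [vecMul_add_vecMulVec, hx, one_smul, firstPos_add, h2, firstPos_sub]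
      abel
    · intro A _ B _ h
      exact add_right_cancel h
  rw [Finset.card_eq_sum_card_fiberwise (s := E) (f := fun A => firstPos u (Matrix.vecMul x A))
    (t := Finset.univ.filter fun a : Fin ℓ → F => firstPos u a = a)
    (fun A _ => by simp [firstPos_idem])]
  rw [Finset.sum_congr rfl (g := fun _ =>
    (E.filter fun A => firstPos u (Matrix.vecMul x A) = firstPos u t).card), Finset.sum_const,
    card_firstPos_range hu, smul_eq_mul, mul_comm]
  intro a ha
  have ha' := (Finset.mem_filter.1 ha).2
  have := le_antisymm (key a t) (key t a)
  rwa [ha'] at this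

/-- A homogeneous condition on `u` positions keeps at least the fraction `q⁻ᵘ` of a set of
matrices that is closed under subtraction. -/
theorem card_le_card_filter_vecMul_mul {N ℓ u : ℕ} (hu : u ≤ ℓ)
    (E : Finset (Matrix (Fin N) (Fin ℓ) F)) (hE : ∀ A ∈ E, ∀ B ∈ E, A - B ∈ E) (x : Fin N → F) :
    E.card ≤
      (E.filter fun A => firstPos u (Matrix.vecMul x A) = 0).card * Fintype.card F ^ u := by
  rw [Finset.card_eq_sum_card_fiberwise (s := E) (f := fun A => firstPos u (Matrix.vecMul x A))
    (t := Finset.univ.filter fun a : Fin ℓ → F => firstPos u a = a)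
    (fun A _ => by simp [firstPos_idem]), ← card_firstPos_range (F := F) hu, mul_comm,
    ← smul_eq_mul, ← Finset.sum_const]
  refine Finset.sum_le_sum fun a _ => ?_
  rcases (E.filter fun A => firstPos u (Matrix.vecMul x A) = a).eq_empty_or_nonempty
    with h | ⟨B, hB⟩
  · rw [h]; exact Nat.zero_le _
  · refine Finset.card_le_card_of_injOn (fun A => A - B) ?_ ?_
    · intro A hA
      obtain ⟨h1, h2⟩ := Finset.mem_filter.1 hA
      obtain ⟨h3, h4⟩ := Finset.mem_filter.1 hB
      refine Finset.mem_filter.2 ⟨hE A h1 B h3, ?_⟩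
      rw [Matrix.vecMul_sub, firstPos_sub, h2, h4, sub_self]
    · intro A _ A' _ h
      exact sub_left_injective h

end Random

/-! ### Expected numbers of solutions -/

section Frequencies

variable {F : Type*} [Field F] [Fintype F] [DecidableEq F]

/-- The probability that a uniformly random matrix has the property `P`. -/
noncomputable def freq {N ℓ : ℕ} (P : Matrix (Fin N) (Fin ℓ) F → Prop) [DecidablePred P] : ℝ :=
  ((Finset.univ.filter P).card : ℝ) / Fintype.card (Matrix (Fin N) (Fin ℓ) F)

variable {N ℓ : ℕ}

theorem card_matrix_pos : (0 : ℝ) < Fintype.card (Matrix (Fin N) (Fin ℓ) F) := by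
  exact_mod_cast Fintype.card_pos

theorem freq_nonneg (P : Matrix (Fin N) (Fin ℓ) F → Prop) [DecidablePred P] : 0 ≤ freq P := by
  unfold freq; positivity

theorem freq_mono {P P' : Matrix (Fin N) (Fin ℓ) F → Prop} [DecidablePred P] [DecidablePred P']
    (h : ∀ A, P A → P' A) : freq P ≤ freq P' := by
  unfold freq
  gcongr
  exact h _

theorem freq_congr {P P' : Matrix (Fin N) (Fin ℓ) F → Prop} [DecidablePred P] [DecidablePred P']
    (h : ∀ A, P A ↔ P' A) : freq P = freq P' :=
  le_antisymm (freq_mono fun A => (h A).1) (freq_mono fun A => (h A).2)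

theorem freq_true : freq (fun _ : Matrix (Fin N) (Fin ℓ) F => True) = 1 := by
  unfold freq
  rw [Finset.filter_true, Finset.card_univ, div_self card_matrix_pos.ne']

theorem freq_le_one (P : Matrix (Fin N) (Fin ℓ) F → Prop) [DecidablePred P] : freq P ≤ 1 :=
  (freq_mono fun _ _ => trivial).trans_eq freq_true

theorem card_field_pos : (0 : ℝ) < Fintype.card F := by exact_mod_cast Fintype.card_pos

/-- The expected number of elements of `X` with a random property. -/
theorem average_card_filter {α : Type*} (X : Finset α)
    (P : Matrix (Fin N) (Fin ℓ) F → α → Prop) [∀ A x, Decidable (P A x)] :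
    (∑ A, ((X.filter (P A)).card : ℝ)) / Fintype.card (Matrix (Fin N) (Fin ℓ) F) =
      ∑ x ∈ X, freq fun A => P A x := by
  unfold freq
  rw [← Finset.sum_div]
  congr 1
  simp only [Finset.card_filter, Nat.cast_sum]
  exact Finset.sum_comm

/-- An event that depends on the products of `A` with the vectors of a subspace `W` only is
independent of the product with a vector outside `W`. -/
theorem freq_and_of_notMem {u : ℕ} (hu : u ≤ ℓ) (W : Submodule F (Fin N → F)) {x : Fin N → F}
    (hx : x ∉ W) (P : Matrix (Fin N) (Fin ℓ) F → Prop) [DecidablePred P]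
    (hP : ∀ A B, (∀ w ∈ W, Matrix.vecMul w A = Matrix.vecMul w B) → P A → P B) (t : Fin ℓ → F) :
    freq (fun A => P A ∧ firstPos u (Matrix.vecMul x A) = firstPos u t) =
      freq P / (Fintype.card F : ℝ) ^ u := by
  obtain ⟨d, hd, hxd⟩ := exists_dotProduct_separating W hx
  have h := card_filter_vecMul_mul hu (Finset.univ.filter P) hxd (fun A hA a => by
    refine Finset.mem_filter.2 ⟨Finset.mem_univ _, hP A _ (fun w hw => ?_)
      (Finset.mem_filter.1 hA).2⟩
    rw [vecMul_add_vecMulVec, hd w hw, zero_smul, add_zero]) t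
  rw [Finset.filter_filter] at h
  have h' : ((Finset.univ.filter fun A : Matrix (Fin N) (Fin ℓ) F =>
      P A ∧ firstPos u (Matrix.vecMul x A) = firstPos u t).card : ℝ) * (Fintype.card F : ℝ) ^ u =
      (Finset.univ.filter P).card := by exact_mod_cast h
  unfold freq
  rw [← h']
  have := (pow_pos (card_field_pos (F := F)) u).ne'
  field_simp

theorem freq_vecMul_eq {u : ℕ} (hu : u ≤ ℓ) {x : Fin N → F} (hx : x ≠ 0) (t : Fin ℓ → F) :
    freq (fun A => firstPos u (Matrix.vecMul x A) = firstPos u t) =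
      1 / (Fintype.card F : ℝ) ^ u := by
  rw [← freq_true (F := F) (N := N) (ℓ := ℓ), ← freq_and_of_notMem hu ⊥ (by simpa using hx)
    (fun _ => True) (fun _ _ _ h => h) t]
  exact freq_congr fun A => by simp

theorem vecMul_eq_of_eq_on_span {W : Set (Fin N → F)} {A B : Matrix (Fin N) (Fin ℓ) F}
    (h : ∀ w ∈ Submodule.span F W, Matrix.vecMul w A = Matrix.vecMul w B) {w : Fin N → F}
    (hw : w ∈ W) : Matrix.vecMul w A = Matrix.vecMul w B :=
  h w (Submodule.subset_span hw)

/-- The expected number of vectors of a list with a prescribed partial syndrome. -/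
theorem sum_freq_single_le {u : ℕ} (hu : u ≤ ℓ) (C : Finset (Fin N → F)) (e : Fin N → F)
    (t : Fin ℓ → F) :
    ∑ x ∈ C, freq (fun A => firstPos u (Matrix.vecMul (x - e) A) = firstPos u t) ≤
      C.card / (Fintype.card F : ℝ) ^ u + 1 := by
  have hq := pow_pos (card_field_pos (F := F)) u
  calc _ ≤ ∑ x ∈ C, (1 / (Fintype.card F : ℝ) ^ u + if x = e then 1 else 0) := by
        refine Finset.sum_le_sum fun x _ => ?_
        split_ifs with h
        · exact (freq_le_one _).trans (by simp [hq.le])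
        · rw [freq_vecMul_eq hu (sub_ne_zero.2 h), add_zero]
    _ ≤ _ := by
        rw [Finset.sum_add_distrib, Finset.sum_const, nsmul_eq_mul, mul_one_div]
        gcongr
        rw [Finset.sum_ite_eq']
        split_ifs <;> norm_num

theorem card_filter_mem_span_singleton_le (C : Finset (Fin N → F)) (x a : Fin N → F)
    [DecidablePred fun y => y + a ∈ Submodule.span F {x}] :
    (C.filter fun y => y + a ∈ Submodule.span F {x}).card ≤ Fintype.card F := by
  rw [← Finset.card_univ]
  refine Finset.card_le_card_of_surjOn (fun c : F => c • x - a) ?_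
  intro y hy
  obtain ⟨c, hc⟩ := Submodule.mem_span_singleton.1 (Finset.mem_filter.1 hy).2
  exact ⟨c, by simp, by simp [hc]⟩

/-- The expected number of colliding pairs of vectors, the first of which has a vanishing partial
syndrome. Pairs such that the two conditions concern linearly dependent vectors are few. -/
theorem sum_freq_pair_le {u u' : ℕ} (huu : u ≤ u') (hu' : u' ≤ ℓ) (C : Finset (Fin N → F))
    (e : Fin N → F) (t : Fin ℓ → F) :
    ∑ x ∈ C, ∑ y ∈ C, freq (fun A => firstPos u (Matrix.vecMul x A) = 0 ∧
        firstPos u' (Matrix.vecMul (x + y - e) A) = firstPos u' t) ≤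
      (C.card : ℝ) ^ 2 / (Fintype.card F : ℝ) ^ (u + u') +
        (Fintype.card F + 1) * (C.card / (Fintype.card F : ℝ) ^ u) + 1 := by
  classical
  set q : ℝ := (Fintype.card F : ℝ) with hqdef
  have hq1 : 1 ≤ q := by rw [hqdef]; exact_mod_cast Fintype.card_pos
  have hu := huu.trans hu'
  have main : ∀ x ∈ C, ∑ y ∈ C, freq (fun A => firstPos u (Matrix.vecMul x A) = 0 ∧
        firstPos u' (Matrix.vecMul (x + y - e) A) = firstPos u' t) ≤
      (C.card / q ^ (u + u') + q / q ^ u) + if x = 0 then C.card / q ^ u + 1 else 0 := by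
    intro x _
    split_ifs with h
    · subst h
      refine le_add_of_nonneg_of_le (by positivity) (le_trans ?_
        ((sum_freq_single_le hu' C e t).trans ?_))
      · refine Finset.sum_le_sum fun y _ => freq_mono fun A hA => ?_
        have := hA.2
        rwa [zero_add] at this
      · gcongr
    · rw [add_zero]
      calc _ ≤ ∑ y ∈ C, (1 / q ^ (u + u') +
            if y + (x - e) ∈ Submodule.span F {x} then 1 / q ^ u else 0) := by
            refine Finset.sum_le_sum fun y _ => ?_
            have e1 : freq (fun A : Matrix (Fin N) (Fin ℓ) F =>
                firstPos u (Matrix.vecMul x A) = 0) = 1 / q ^ u := by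
              rw [← freq_vecMul_eq hu h 0]
              exact freq_congr fun A => by rw [firstPos_zero]
            split_ifs with hy
            · refine (freq_mono fun A hA => hA.1).trans (e1.le.trans ?_)
              exact le_add_of_nonneg_left (by positivity)
            · have e2 : x + y - e = y + (x - e) := by abel
              rw [add_zero, e2, freq_and_of_notMem hu' _ hy (fun A =>
                firstPos u (Matrix.vecMul x A) = 0), e1, pow_add, div_div]
              intro A B hAB hA
              rwa [← vecMul_eq_of_eq_on_span hAB rfl]
        _ ≤ _ := by
            rw [Finset.sum_add_distrib, Finset.sum_const, nsmul_eq_mul, mul_one_div,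
              ← Finset.sum_filter, Finset.sum_const, nsmul_eq_mul, mul_one_div]
            gcongr
            rw [hqdef]
            exact_mod_cast card_filter_mem_span_singleton_le C x (x - e)
  refine (Finset.sum_le_sum main).trans ?_
  rw [Finset.sum_add_distrib, Finset.sum_const, nsmul_eq_mul, Finset.sum_ite_eq']
  have h0 : (if (0 : Fin N → F) ∈ C then (C.card : ℝ) / q ^ u + 1 else 0) ≤ C.card / q ^ u + 1 := by
    split_ifs
    · exact le_rfl
    · positivity
  refine (add_le_add le_rfl h0).trans (le_of_eq ?_)
  ring

end Frequencies

/-! ### Homogeneous conditions -/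

section FreqLower

variable {F : Type*} [Field F] [Fintype F] [DecidableEq F] {N ℓ : ℕ}

/-- A further homogeneous condition keeps at least the fraction `q⁻ᵘ`, even if it is dependent on
the earlier ones, as long as those are homogeneous. -/
theorem le_freq_and_of_sub {u : ℕ} (hu : u ≤ ℓ) (P : Matrix (Fin N) (Fin ℓ) F → Prop)
    [DecidablePred P] (hP : ∀ A B, P A → P B → P (A - B)) (x : Fin N → F) :
    freq P / (Fintype.card F : ℝ) ^ u ≤
      freq (fun A => P A ∧ firstPos u (Matrix.vecMul x A) = 0) := by
  have h := card_le_card_filter_vecMul_mul hu (Finset.univ.filter P) (fun A hA B hB =>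
    Finset.mem_filter.2 ⟨Finset.mem_univ _, hP A B (Finset.mem_filter.1 hA).2
      (Finset.mem_filter.1 hB).2⟩) x
  rw [Finset.filter_filter] at h
  have h' : ((Finset.univ.filter P).card : ℝ) ≤ ((Finset.univ.filter
      fun A : Matrix (Fin N) (Fin ℓ) F => P A ∧ firstPos u (Matrix.vecMul x A) = 0).card : ℝ) *
        (Fintype.card F : ℝ) ^ u := by exact_mod_cast h
  have hq := pow_pos (card_field_pos (F := F)) u
  unfold freq
  rw [div_right_comm]
  gcongr
  rwa [div_le_iff₀ hq]

theorem firstPos_vecMul_sub_eq_zero {u : ℕ} {x : Fin N → F} {A B : Matrix (Fin N) (Fin ℓ) F}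
    (hA : firstPos u (Matrix.vecMul x A) = 0) (hB : firstPos u (Matrix.vecMul x B) = 0) :
    firstPos u (Matrix.vecMul x (A - B)) = 0 := by
  rw [Matrix.vecMul_sub, firstPos_sub, hA, hB, sub_zero]

theorem le_freq_vecMul_eq_zero {u : ℕ} (hu : u ≤ ℓ) (x : Fin N → F) :
    1 / (Fintype.card F : ℝ) ^ u ≤
      freq (fun A : Matrix (Fin N) (Fin ℓ) F => firstPos u (Matrix.vecMul x A) = 0) := by
  have := le_freq_and_of_sub (N := N) hu (fun _ => True) (fun _ _ _ _ => trivial) x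
  rw [freq_true] at this
  exact this.trans (freq_mono fun A => And.right)

theorem le_freq_vecMul_eq_zero_and {u u' : ℕ} (hu : u ≤ ℓ) (hu' : u' ≤ ℓ) (x y : Fin N → F) :
    1 / (Fintype.card F : ℝ) ^ (u + u') ≤
      freq (fun A : Matrix (Fin N) (Fin ℓ) F => firstPos u (Matrix.vecMul x A) = 0 ∧
        firstPos u' (Matrix.vecMul y A) = 0) := by
  refine le_trans ?_ (le_freq_and_of_sub hu' _
    (fun A B hA hB => firstPos_vecMul_sub_eq_zero hA hB) y)
  rw [pow_add, ← div_div]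
  gcongr
  exact le_freq_vecMul_eq_zero hu x

end FreqLower

/-! ### Costs of the merges -/

section Merges

variable {F : Type*} [Field F] [Fintype F] [DecidableEq F]

/-- The coordinates of the first half. -/
def firstHalf (N : ℕ) : Finset (Fin N) := Finset.univ.filter fun j => j.val < N / 2

/-- The sums of two well-formed halves: the vectors that occur in the concatenation merges. -/
def concatSet (p : Params) (F : Type*) [Field F] [Fintype F] [DecidableEq F] :
    Finset (Fin p.len → F) :=
  (wellFormedOn (F := F) (firstHalf p.len) (p.vAt 2 / 2) (p.mAt 2 / 2) ×ˢ
    wellFormedOn (F := F) (firstHalf p.len)ᶜ (p.vAt 2 / 2) (p.mAt 2 / 2)).image fun q => q.1 + q.2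

/-- The number of well-formed halves. -/
def halfCount (p : Params) : ℕ :=
  trinomial (p.len / 2) (p.vAt 2 / 2) (p.mAt 2 / 2) * 2 ^ (p.vAt 2 / 2 + p.mAt 2 / 2)

theorem card_firstHalf (N : ℕ) : (firstHalf N).card = N / 2 := by
  rw [firstHalf, Fin.card_filter_val_lt, min_eq_right (Nat.div_le_self _ _)]

theorem card_compl_firstHalf {N : ℕ} (hN : Even N) : (firstHalf N)ᶜ.card = N / 2 := by
  rw [Finset.card_compl, card_firstHalf, Fintype.card_fin]
  obtain ⟨a, rfl⟩ := hN
  omega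

theorem eq_zero_of_mem_wellFormedOn {N : ℕ} {S : Finset (Fin N)} {v m : ℕ} {x : Fin N → F}
    (hx : x ∈ wellFormedOn S v m) {j : Fin N} (hj : j ∉ S) : x j = 0 :=
  (Finset.mem_filter.1 hx).2.2.1 j hj

theorem injOn_add_wellFormedOn {N : ℕ} (S : Finset (Fin N)) (v m v' m' : ℕ) :
    Set.InjOn (fun q : (Fin N → F) × (Fin N → F) => q.1 + q.2)
      (wellFormedOn (F := F) S v m ×ˢ wellFormedOn (F := F) Sᶜ v' m' :
        Finset ((Fin N → F) × (Fin N → F))) := by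
  rintro ⟨x, y⟩ h ⟨x', y'⟩ h' hs
  obtain ⟨hx, hy⟩ := Finset.mem_product.1 h
  obtain ⟨hx', hy'⟩ := Finset.mem_product.1 h'
  have hj : ∀ j, x j = x' j ∧ y j = y' j := by
    intro j
    have hs' : x j + y j = x' j + y' j := congrFun hs j
    by_cases hj : j ∈ S
    · have h1 := eq_zero_of_mem_wellFormedOn hy (j := j) (by simpa using hj)
      have h2 := eq_zero_of_mem_wellFormedOn hy' (j := j) (by simpa using hj)
      simp only at h1 h2
      rw [h1, h2] at hs' ⊢
      simpa using hs'
    · have h1 := eq_zero_of_mem_wellFormedOn hx hj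
      have h2 := eq_zero_of_mem_wellFormedOn hx' hj
      simp only at h1 h2
      rw [h1, h2] at hs' ⊢
      simpa using hs'
  exact Prod.ext (funext fun j => (hj j).1) (funext fun j => (hj j).2)

variable (p : Params)

theorem card_wellFormed_firstHalf (h2 : (2 : F) ≠ 0) (h3 : (3 : F) ≠ 0) :
    (wellFormedOn (F := F) (firstHalf p.len) (p.vAt 2 / 2) (p.mAt 2 / 2)).card = halfCount p := by
  rw [card_wellFormedOn h2 h3, card_firstHalf, halfCount]

theorem card_wellFormed_compl_firstHalf (h2 : (2 : F) ≠ 0) (h3 : (3 : F) ≠ 0)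
    (hp : p.Admissible) :
    (wellFormedOn (F := F) (firstHalf p.len)ᶜ (p.vAt 2 / 2) (p.mAt 2 / 2)).card =
      halfCount p := by
  rw [card_wellFormedOn h2 h3, card_compl_firstHalf hp.even_len, halfCount]

theorem card_concatSet (h2 : (2 : F) ≠ 0) (h3 : (3 : F) ≠ 0) (hp : p.Admissible) :
    (concatSet p F).card = halfCount p ^ 2 := by
  rw [concatSet, Finset.card_image_of_injOn (injOn_add_wellFormedOn _ _ _ _ _),
    Finset.card_product, card_wellFormed_firstHalf p h2 h3,
    card_wellFormed_compl_firstHalf p h2 h3 hp, sq]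

/-- A level-2 vector lies in the concatenation set as soon as its weights are
distributed evenly over the two halves. -/
theorem mem_concatSet (h2 : (2 : F) ≠ 0) (h3 : (3 : F) ≠ 0) (hp : p.Admissible)
    {x : Fin p.len → F} (hx : x ∈ p.level F 2)
    (hv : ((firstHalf p.len).filter fun j => typ (x j) = 1).card = p.vAt 2 / 2)
    (hm : ((firstHalf p.len).filter fun j => typ (x j) = 2).card = p.mAt 2 / 2) :
    x ∈ concatSet p F := by
  rw [Params.level, mem_wellFormedOn_iff h2 h3] at hx
  obtain ⟨hx3, -, hxv, hxm⟩ := hx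
  have hsplit : ∀ s : Fin 4, (Finset.univ.filter fun j => typ (x j) = s).card =
      ((firstHalf p.len).filter fun j => typ (x j) = s).card +
        ((firstHalf p.len)ᶜ.filter fun j => typ (x j) = s).card := by
    intro s
    rw [← Finset.card_union_of_disjoint (Finset.disjoint_filter_filter disjoint_compl_right),
      ← Finset.filter_union, Finset.union_compl]
  have hv' : ((firstHalf p.len)ᶜ.filter fun j => typ (x j) = 1).card = p.vAt 2 / 2 := by
    have := hsplit 1
    obtain ⟨a, ha⟩ := hp.even_v 2 le_rfl
    omega
  have hm' : ((firstHalf p.len)ᶜ.filter fun j => typ (x j) = 2).card = p.mAt 2 / 2 := by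
    have := hsplit 2
    obtain ⟨a, ha⟩ := hp.even_m
    omega
  have h03 : typ (0 : F) ≠ 3 := by rw [typ_eq_zero.2 rfl]; decide
  have hrestr : ∀ S : Finset (Fin p.len),
      (S.filter fun j => typ (x j) = 1).card = p.vAt 2 / 2 →
      (S.filter fun j => typ (x j) = 2).card = p.mAt 2 / 2 →
      (fun j => if j ∈ S then x j else 0) ∈ wellFormedOn S (p.vAt 2 / 2) (p.mAt 2 / 2) := by
    intro S h1 h2'
    rw [mem_wellFormedOn_iff h2 h3]
    refine ⟨fun j => ?_, fun j hj => if_neg hj, ?_, ?_⟩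
    · split_ifs
      · exact hx3 j
      · exact h03
    · rw [← h1]
      congr 1
      exact Finset.filter_congr fun j hj => by rw [if_pos hj]
    · rw [← h2']
      congr 1
      exact Finset.filter_congr fun j hj => by rw [if_pos hj]
  refine Finset.mem_image.2 ⟨(_, _), Finset.mem_product.2 ⟨hrestr _ hv hm, hrestr _ hv' hm'⟩, ?_⟩
  funext j
  change (if j ∈ firstHalf p.len then x j else 0) +
    (if j ∈ (firstHalf p.len)ᶜ then x j else 0) = x j
  by_cases hj : j ∈ firstHalf p.len <;> simp [hj]

theorem firstHalf_compl_eq (N : ℕ) :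
    (firstHalf N)ᶜ = Finset.univ.filter fun j : Fin N => ¬ j.val < N / 2 := by
  ext j; simp [firstHalf]

variable (A : Matrix (Fin p.len) (Fin p.ℓ) F) (u : ℕ) (t : Fin p.ℓ → F)

/-- The concatenation merge finds all vectors of `concatSet` with the prescribed partial
syndrome. -/
theorem mem_concatMerge (z : Fin p.len → F) :
    z ∈ (concatMerge p A u t).val ↔ z ∈ concatSet p F ∧
      firstPos u (Matrix.vecMul z A) = firstPos u t := by
  simp only [concatMerge, Timed.val_bind, mem_collide, enumerate, Finset.mem_toList,
    firstPos_key, concatSet, Finset.mem_image, Finset.mem_product, Prod.exists,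
    firstHalf_compl_eq]
  constructor
  · rintro ⟨a, ha, b, hb, hk, rfl⟩
    exact ⟨⟨a, b, ⟨ha, hb⟩, rfl⟩, hk⟩
  · rintro ⟨⟨a, b, ⟨ha, hb⟩, rfl⟩, hk⟩
    exact ⟨a, ha, b, hb, hk, rfl⟩

theorem toFinset_concatMerge :
    (concatMerge p A u t).val.toFinset = (concatSet p F).filter fun z =>
      firstPos u (Matrix.vecMul z A) = firstPos u t := by
  ext z
  rw [List.mem_toFinset, mem_concatMerge, Finset.mem_filter]

theorem length_concatMerge :
    (concatMerge p A u t).val.length = ((concatSet p F).filter fun z =>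
      firstPos u (Matrix.vecMul z A) = firstPos u t).card := by
  simp only [concatMerge, Timed.val_bind, enumerate]
  rw [length_collide _ _ _ _ _ (Finset.nodup_toList _) (Finset.nodup_toList _), concatSet,
    Finset.filter_image, Finset.card_image_of_injOn]
  · simp only [Finset.toList_toFinset, firstPos_key, firstHalf_compl_eq]
    rfl
  · exact (injOn_add_wellFormedOn _ _ _ _ _).mono
      (Finset.coe_subset.2 (Finset.filter_subset _ _))

/-- A vector determines its two halves, so the concatenation merge repeats nothing. -/
theorem nodup_concatMerge : (concatMerge p A u t).val.Nodup := by
  rw [← Multiset.coe_nodup, ← Multiset.toFinset_card_eq_card_iff_nodup]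
  change (concatMerge p A u t).val.toFinset.card = (concatMerge p A u t).val.length
  rw [toFinset_concatMerge, length_concatMerge]

/-- Each half vector costs one step to list and one to store or look up. -/
theorem steps_concatMerge (h2 : (2 : F) ≠ 0) (h3 : (3 : F) ≠ 0) (hp : p.Admissible) :
    (concatMerge p A u t).steps = 4 * halfCount p + (concatMerge p A u t).val.length := by
  have e1 := card_wellFormed_firstHalf p h2 h3
  have e2 := card_wellFormed_compl_firstHalf p h2 h3 hp
  rw [firstHalf_compl_eq] at e2
  rw [firstHalf] at e1
  simp only [concatMerge, Timed.val_bind, Timed.steps_bind, enumerate, steps_collide,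
    Finset.length_toList, e1, e2]
  omega

variable (i : ℕ) (L₁ L₂ : List (Fin p.len → F))

theorem nodup_reprMerge : (reprMerge p A i u t L₁ L₂).val.Nodup := nodup_sieve _ _

/-- The pairs written out by a collision search of two sets of vectors. -/
def collisions (X Y : Finset (Fin p.len → F)) : Finset ((Fin p.len → F) × (Fin p.len → F)) :=
  (X ×ˢ Y).filter fun r => firstPos u (Matrix.vecMul (r.1 + r.2) A) = firstPos u t

/-- Each colliding pair costs one step to write out and one to filter. -/
theorem steps_reprMerge (h₁ : L₁.Nodup) (h₂ : L₂.Nodup) :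
    (reprMerge p A i u t L₁ L₂).steps = L₁.length + L₂.length +
      2 * (collisions p A u t L₁.toFinset L₂.toFinset).card := by
  simp only [reprMerge, Timed.steps_bind, steps_collide, steps_sieve,
    length_collide _ _ _ _ _ h₁ h₂, firstPos_key, collisions]
  omega

theorem length_reprMerge_le (h₁ : L₁.Nodup) (h₂ : L₂.Nodup) :
    (reprMerge p A i u t L₁ L₂).val.length ≤
      (collisions p A u t L₁.toFinset L₂.toFinset).card := by
  simp only [reprMerge, Timed.val_bind]
  refine (length_sieve_le _ _).trans ?_
  rw [length_collide _ _ _ _ _ h₁ h₂]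
  simp only [firstPos_key, collisions, le_refl]

end Merges

/-! ### Expected number of steps -/

section Expected

variable {F : Type*} [Field F] [Fintype F] [DecidableEq F]

/-- With the syndrome `s = e A + t`, the condition on `x` is a condition on `x - e`. -/
theorem firstPos_shift {N ℓ u : ℕ} (A : Matrix (Fin N) (Fin ℓ) F) (x e : Fin N → F)
    (t : Fin ℓ → F) :
    firstPos u (Matrix.vecMul x A) = firstPos u (Matrix.vecMul e A + t) ↔
      firstPos u (Matrix.vecMul (x - e) A) = firstPos u t := by
  rw [Matrix.sub_vecMul, firstPos_sub, firstPos_add, sub_eq_iff_eq_add']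

variable (p : Params) (A : Matrix (Fin p.len) (Fin p.ℓ) F) (e : Fin p.len → F) (t : Fin p.ℓ → F)

/-- The vectors of `C` with a prescribed syndrome on the first `u` positions. -/
def partialSolutions (u : ℕ) (C : Finset (Fin p.len → F)) : Finset (Fin p.len → F) :=
  C.filter fun x => firstPos u (Matrix.vecMul (x - e) A) = firstPos u t

/-- The colliding pairs on `u'` positions, the first member of which has a vanishing syndrome on
the first `u` positions. -/
def pairSolutions (u u' : ℕ) (C : Finset (Fin p.len → F)) :
    Finset ((Fin p.len → F) × (Fin p.len → F)) :=
  (C ×ˢ C).filter fun r => firstPos u (Matrix.vecMul r.1 A) = 0 ∧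
    firstPos u' (Matrix.vecMul (r.1 + r.2 - e) A) = firstPos u' t

theorem toFinset_concatMerge_zero (u : ℕ) :
    (concatMerge p A u 0).val.toFinset = partialSolutions p A 0 0 u (concatSet p F) := by
  rw [toFinset_concatMerge, partialSolutions]
  simp only [sub_zero]

theorem toFinset_concatMerge_shift (u : ℕ) :
    (concatMerge p A u (Matrix.vecMul e A + t)).val.toFinset =
      partialSolutions p A e t u (concatSet p F) := by
  rw [toFinset_concatMerge, partialSolutions]
  simp only [firstPos_shift]

theorem collisions_shift_subset {u u' : ℕ} {C X Y : Finset (Fin p.len → F)}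
    (hX : ∀ x ∈ X, x ∈ C ∧ firstPos u (Matrix.vecMul x A) = 0) (hY : Y ⊆ C) :
    collisions p A u' (Matrix.vecMul e A + t) X Y ⊆ pairSolutions p A e t u u' C := by
  intro r hr
  obtain ⟨hr, hk⟩ := Finset.mem_filter.1 hr
  obtain ⟨h1, h2⟩ := Finset.mem_product.1 hr
  exact Finset.mem_filter.2 ⟨Finset.mem_product.2 ⟨(hX _ h1).1, hY h2⟩, (hX _ h1).2,
    (firstPos_shift _ _ _ _).1 hk⟩

theorem collisions_zero_subset {u u' : ℕ} {C X Y : Finset (Fin p.len → F)}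
    (hX : ∀ x ∈ X, x ∈ C ∧ firstPos u (Matrix.vecMul x A) = 0) (hY : Y ⊆ C) :
    collisions p A u' 0 X Y ⊆ pairSolutions p A 0 0 u u' C := by
  have := collisions_shift_subset p A 0 0 (u := u) (u' := u') hX hY
  rwa [Matrix.zero_vecMul, add_zero] at this

theorem mem_partialSolutions_zero {u : ℕ} {C : Finset (Fin p.len → F)} {x : Fin p.len → F} :
    x ∈ partialSolutions p A 0 0 u C ↔ x ∈ C ∧ firstPos u (Matrix.vecMul x A) = 0 := by
  rw [partialSolutions, Finset.mem_filter, sub_zero, firstPos_zero]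

/-- The members of `K₁`, whose target is zero, have a vanishing syndrome on the merged positions. -/
theorem of_mem_reprMerge_zero {i u : ℕ} {L₁ L₂ : List (Fin p.len → F)} {z : Fin p.len → F}
    (hz : z ∈ (reprMerge p A i u 0 L₁ L₂).val.toFinset) :
    z ∈ p.level F i ∧ firstPos u (Matrix.vecMul z A) = 0 := by
  rw [List.mem_toFinset, mem_reprMerge] at hz
  obtain ⟨hz, x, -, y, -, h, rfl⟩ := hz
  rw [firstPos_zero] at h
  exact ⟨hz, h⟩

theorem reprMerge_toFinset_subset {i u : ℕ} {L₁ L₂ : List (Fin p.len → F)} (s : Fin p.ℓ → F) :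
    (reprMerge p A i u s L₁ L₂).val.toFinset ⊆ p.level F i := by
  intro z hz
  rw [List.mem_toFinset, mem_reprMerge] at hz
  exact hz.1

/-- The number of steps of a run is governed by the numbers of listed half vectors, of partial
solutions, and of colliding pairs in the three representation merges. -/
theorem steps_bjmmPlus_le (h2 : (2 : F) ≠ 0) (h3 : (3 : F) ≠ 0) (hp : p.Admissible) :
    (bjmmPlus p A (Matrix.vecMul e A + t)).steps ≤ 16 * halfCount p +
      6 * (partialSolutions p A 0 0 (p.mergePos F 1) (concatSet p F)).card +
      2 * (partialSolutions p A e t (p.mergePos F 1) (concatSet p F)).card +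
      3 * (pairSolutions p A 0 0 (p.mergePos F 1) (p.mergePos F 0) (concatSet p F)).card +
      3 * (pairSolutions p A e t (p.mergePos F 1) (p.mergePos F 0) (concatSet p F)).card +
      2 * (pairSolutions p A e t (p.mergePos F 0) p.ℓ (p.level F 1)).card := by
  simp only [bjmmPlus, Timed.steps_bind]
  set s := Matrix.vecMul e A + t with hs
  set u₁ := p.mergePos F 1
  set u₀ := p.mergePos F 0
  set L := (concatMerge p A u₁ 0).val with hL
  set L' := (concatMerge p A u₁ s).val with hL'
  have nL : L.Nodup := nodup_concatMerge ..
  have nL' : L'.Nodup := nodup_concatMerge ..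
  have tL : L.toFinset = partialSolutions p A 0 0 u₁ (concatSet p F) :=
    toFinset_concatMerge_zero ..
  have tL' : L'.toFinset = partialSolutions p A e t u₁ (concatSet p F) :=
    toFinset_concatMerge_shift ..
  have cL : L.length = (partialSolutions p A 0 0 u₁ (concatSet p F)).card := by
    rw [← tL, List.toFinset_card_of_nodup nL]
  have cL' : L'.length = (partialSolutions p A e t u₁ (concatSet p F)).card := by
    rw [← tL', List.toFinset_card_of_nodup nL']
  have sL : L.toFinset ⊆ concatSet p F := tL ▸ Finset.filter_subset _ _
  have sL' : L'.toFinset ⊆ concatSet p F := tL' ▸ Finset.filter_subset _ _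
  have zL : ∀ x ∈ L.toFinset, x ∈ concatSet p F ∧ firstPos u₁ (Matrix.vecMul x A) = 0 := by
    intro x hx
    rw [tL] at hx
    exact (mem_partialSolutions_zero p A).1 hx
  have b1 := Finset.card_le_card (collisions_zero_subset p A (u' := u₀) zL sL)
  have b2 := Finset.card_le_card (collisions_shift_subset p A e t (u' := u₀) zL sL')
  rw [← hs] at b2
  have k1 := length_reprMerge_le p A u₀ 0 1 L L nL nL
  have k2 := length_reprMerge_le p A u₀ s 1 L L' nL nL'
  have b3 := Finset.card_le_card (collisions_shift_subset p A e t (u' := p.ℓ)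
    (fun z => of_mem_reprMerge_zero p A (i := 1) (u := u₀) (L₁ := L) (L₂ := L))
    (reprMerge_toFinset_subset p A (i := 1) (u := u₀) (L₁ := L) (L₂ := L') s))
  rw [← hs] at b3
  rw [steps_concatMerge p A u₁ 0 h2 h3 hp, steps_concatMerge p A u₁ s h2 h3 hp,
    steps_reprMerge p A u₀ 0 1 L L nL nL, steps_reprMerge p A u₀ s 1 L L' nL nL',
    steps_reprMerge p A p.ℓ s 0 _ _ (nodup_reprMerge ..) (nodup_reprMerge ..), ← hL, ← hL']
  omega

theorem average_pairSolutions (u u' : ℕ) (C : Finset (Fin p.len → F)) :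
    (∑ A, ((pairSolutions p A e t u u' C).card : ℝ)) /
        Fintype.card (Matrix (Fin p.len) (Fin p.ℓ) F) =
      ∑ x ∈ C, ∑ y ∈ C, freq (fun A => firstPos u (Matrix.vecMul x A) = 0 ∧
        firstPos u' (Matrix.vecMul (x + y - e) A) = firstPos u' t) := by
  unfold pairSolutions
  rw [average_card_filter, Finset.sum_product]

theorem average_partialSolutions (u : ℕ) (C : Finset (Fin p.len → F)) :
    (∑ A, ((partialSolutions p A e t u C).card : ℝ)) /
        Fintype.card (Matrix (Fin p.len) (Fin p.ℓ) F) =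
      ∑ x ∈ C, freq (fun A => firstPos u (Matrix.vecMul (x - e) A) = firstPos u t) := by
  unfold partialSolutions
  rw [average_card_filter]

theorem average_mono {f g : Matrix (Fin p.len) (Fin p.ℓ) F → ℝ} (h : ∀ A, f A ≤ g A) :
    (∑ A, f A) / Fintype.card (Matrix (Fin p.len) (Fin p.ℓ) F) ≤
      (∑ A, g A) / Fintype.card (Matrix (Fin p.len) (Fin p.ℓ) F) := by
  gcongr
  exact h _

/-- The upper bound: each list contributes its number of candidates divided by the number of partial
syndromes, and the dependent pairs contribute terms that are already present. -/
theorem expectedCost_le (h2 : (2 : F) ≠ 0) (h3 : (3 : F) ≠ 0) (hp : p.Admissible)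
    (hu : p.mergePos F 1 ≤ p.mergePos F 0) (hu' : p.mergePos F 0 ≤ p.ℓ) :
    expectedCost p e t ≤ 16 * halfCount p +
      8 * ((concatSet p F).card / (Fintype.card F : ℝ) ^ p.mergePos F 1 + 1) +
      6 * (((concatSet p F).card : ℝ) ^ 2 /
          (Fintype.card F : ℝ) ^ (p.mergePos F 1 + p.mergePos F 0) +
        (Fintype.card F + 1) * ((concatSet p F).card / (Fintype.card F : ℝ) ^ p.mergePos F 1) + 1) +
      2 * (((p.level F 1).card : ℝ) ^ 2 / (Fintype.card F : ℝ) ^ (p.mergePos F 0 + p.ℓ) +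
        (Fintype.card F + 1) * ((p.level F 1).card / (Fintype.card F : ℝ) ^ p.mergePos F 0) +
        1) := by
  have hstep := average_mono p fun A =>
    (Nat.cast_le (α := ℝ)).2 (steps_bjmmPlus_le p A e t h2 h3 hp)
  refine hstep.trans ?_
  have b0 := sum_freq_single_le (hu.trans hu') (concatSet p F) 0 0
  have b1 := sum_freq_single_le (hu.trans hu') (concatSet p F) e t
  have b2 := sum_freq_pair_le hu hu' (concatSet p F) 0 0
  have b3 := sum_freq_pair_le hu hu' (concatSet p F) e t
  have b4 := sum_freq_pair_le hu' le_rfl (p.level F 1) e t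
  rw [← average_partialSolutions] at b0 b1
  rw [← average_pairSolutions] at b2 b3 b4
  have hM := card_matrix_pos (F := F) (N := p.len) (ℓ := p.ℓ)
  push_cast
  simp only [Finset.sum_add_distrib, ← Finset.mul_sum, add_div, mul_div_assoc, Finset.sum_const,
    Finset.card_univ, nsmul_eq_mul]
  rw [mul_div_cancel₀ _ hM.ne']
  linarith

/-- The half vectors are listed in every run. -/
theorem halfCount_le_expectedCost (h2 : (2 : F) ≠ 0) (h3 : (3 : F) ≠ 0) (hp : p.Admissible) :
    (halfCount p : ℝ) ≤ expectedCost p e t := by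
  have h : ∀ A : Matrix (Fin p.len) (Fin p.ℓ) F, (halfCount p : ℝ) ≤
      ((bjmmPlus p A (Matrix.vecMul e A + t)).steps : ℝ) := by
    intro A
    rw [Nat.cast_le]
    simp only [bjmmPlus, Timed.steps_bind, steps_concatMerge p _ _ _ h2 h3 hp]
    omega
  refine le_trans ?_ (average_mono p h)
  have hM := card_matrix_pos (F := F) (N := p.len) (ℓ := p.ℓ)
  rw [Finset.sum_const, Finset.card_univ, nsmul_eq_mul, mul_div_cancel_left₀ _ hM.ne']

/-- The vectors of the first list are written out. -/
theorem concatSet_le_expectedCost (h2 : (2 : F) ≠ 0) (h3 : (3 : F) ≠ 0) (hp : p.Admissible)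
    (hu : p.mergePos F 1 ≤ p.ℓ) :
    ((concatSet p F).card : ℝ) / (Fintype.card F : ℝ) ^ p.mergePos F 1 ≤ expectedCost p e t := by
  have h : ∀ A : Matrix (Fin p.len) (Fin p.ℓ) F,
      ((partialSolutions p A 0 0 (p.mergePos F 1) (concatSet p F)).card : ℝ) ≤
      ((bjmmPlus p A (Matrix.vecMul e A + t)).steps : ℝ) := by
    intro A
    rw [Nat.cast_le, ← toFinset_concatMerge_zero]
    refine (List.toFinset_card_le _).trans ?_
    simp only [bjmmPlus, Timed.steps_bind, steps_concatMerge p _ _ _ h2 h3 hp]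
    omega
  refine le_trans ?_ (average_mono p h)
  rw [average_partialSolutions, div_eq_mul_one_div, ← nsmul_eq_mul]
  refine Finset.card_nsmul_le_sum _ _ _ fun x _ => ?_
  refine (le_freq_vecMul_eq_zero hu x).trans (freq_mono fun A hA => ?_)
  rwa [sub_zero, firstPos_zero]

/-- The colliding pairs of the first two lists are written out. -/
theorem pairs_le_expectedCost (hu : p.mergePos F 1 ≤ p.mergePos F 0)
    (hu' : p.mergePos F 0 ≤ p.ℓ) :
    ((concatSet p F).card : ℝ) ^ 2 / (Fintype.card F : ℝ) ^ (p.mergePos F 1 + p.mergePos F 0) ≤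
      expectedCost p e t := by
  have h : ∀ A : Matrix (Fin p.len) (Fin p.ℓ) F,
      ((pairSolutions p A 0 0 (p.mergePos F 1) (p.mergePos F 0) (concatSet p F)).card : ℝ) ≤
      ((bjmmPlus p A (Matrix.vecMul e A + t)).steps : ℝ) := by
    intro A
    rw [Nat.cast_le]
    have hsub : pairSolutions p A 0 0 (p.mergePos F 1) (p.mergePos F 0) (concatSet p F) ⊆
        collisions p A (p.mergePos F 0) 0 (concatMerge p A (p.mergePos F 1) 0).val.toFinset
          (concatMerge p A (p.mergePos F 1) 0).val.toFinset := by
      intro r hr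
      obtain ⟨hr, h1, h2'⟩ := Finset.mem_filter.1 hr
      obtain ⟨hr1, hr2⟩ := Finset.mem_product.1 hr
      rw [sub_zero] at h2'
      have h4 := firstPos_mono hu h2'
      rw [Matrix.add_vecMul, firstPos_add, h1, zero_add] at h4
      simp only [toFinset_concatMerge_zero]
      refine Finset.mem_filter.2 ⟨Finset.mem_product.2 ⟨?_, ?_⟩, h2'⟩
      · exact (mem_partialSolutions_zero p A).2 ⟨hr1, h1⟩
      · exact (mem_partialSolutions_zero p A).2 ⟨hr2, h4.trans (firstPos_zero _)⟩
    refine (Finset.card_le_card hsub).trans ?_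
    have h5 := steps_reprMerge p A (p.mergePos F 0) 0 1 _ _
      (nodup_concatMerge p A (p.mergePos F 1) 0) (nodup_concatMerge p A (p.mergePos F 1) 0)
    simp only [bjmmPlus, Timed.steps_bind]
    omega
  refine le_trans ?_ (average_mono p h)
  rw [average_pairSolutions, div_eq_mul_one_div, sq, mul_assoc, ← nsmul_eq_mul]
  refine Finset.card_nsmul_le_sum _ _ _ fun x _ => ?_
  rw [← nsmul_eq_mul]
  refine Finset.card_nsmul_le_sum _ _ _ fun y _ => ?_
  refine (le_freq_vecMul_eq_zero_and (hu.trans hu') hu' x (x + y)).trans (freq_mono fun A hA => ?_)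
  rwa [sub_zero, firstPos_zero]

end Expected

/-! ### Second moment of the number of representations found -/

section SecondMoment

variable {F : Type*} [Field F] [Fintype F] [DecidableEq F] {N ℓ : ℕ}

/-- The span of `k` vectors has at most `q ^ k` elements. -/
theorem card_filter_mem_span_range_le {k : ℕ} (v : Fin k → Fin N → F) (R : Finset (Fin N → F))
    [DecidablePred fun x => x ∈ Submodule.span F (Set.range v)] :
    (R.filter fun x => x ∈ Submodule.span F (Set.range v)).card ≤ Fintype.card F ^ k := by
  have : Fintype.card (Fin k → F) = Fintype.card F ^ k := by simp
  rw [← this, ← Finset.card_univ]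
  refine Finset.card_le_card_of_surjOn (fun c : Fin k → F => ∑ i, c i • v i) ?_
  intro x hx
  obtain ⟨c, hc⟩ := (Submodule.mem_span_range_iff_exists_fun F).1 (Finset.mem_filter.1 hx).2
  exact ⟨c, by simp, hc⟩

/-- The event `P` depends on the products of the matrix with the vectors `v i` only. -/
def DependsOn {k : ℕ} (v : Fin k → Fin N → F) (P : Matrix (Fin N) (Fin ℓ) F → Prop) : Prop :=
  ∀ A B, (∀ i, Matrix.vecMul (v i) A = Matrix.vecMul (v i) B) → P A → P B

theorem DependsOn.freq_and {k u : ℕ} {v : Fin k → Fin N → F}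
    {P : Matrix (Fin N) (Fin ℓ) F → Prop} [DecidablePred P] (hP : DependsOn v P) (hu : u ≤ ℓ)
    {x : Fin N → F} (hx : x ∉ Submodule.span F (Set.range v)) (t : Fin ℓ → F) :
    freq (fun A => P A ∧ firstPos u (Matrix.vecMul x A) = firstPos u t) =
      freq P / (Fintype.card F : ℝ) ^ u :=
  freq_and_of_notMem hu _ hx P (fun A B h => hP A B fun i =>
    h _ (Submodule.subset_span ⟨i, rfl⟩)) t

/-- If there are at most `q ^ (u + 1)` candidates, a further homogeneous condition on `u` positions
multiplies the expected number of solutions by at most a constant. -/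
theorem DependsOn.sum_freq_and_le {k u : ℕ} {v : Fin k → Fin N → F}
    {P : Matrix (Fin N) (Fin ℓ) F → Prop} [DecidablePred P] (hP : DependsOn v P) (hu : u ≤ ℓ)
    {R : Finset (Fin N → F)} (hR : R.card ≤ Fintype.card F ^ (u + 1)) :
    ∑ x ∈ R, freq (fun A => P A ∧ firstPos u (Matrix.vecMul x A) = 0) ≤
      ((Fintype.card F : ℝ) ^ k + Fintype.card F) * freq P := by
  classical
  have hq := card_field_pos (F := F)
  set q : ℝ := (Fintype.card F : ℝ) with hqdef
  have hf := freq_nonneg P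
  calc _ ≤ ∑ x ∈ R, ((if x ∈ Submodule.span F (Set.range v) then freq P else 0) +
        freq P / q ^ u) := by
        refine Finset.sum_le_sum fun x _ => ?_
        split_ifs with h
        · exact (freq_mono fun A => And.left).trans (le_add_of_nonneg_right (by positivity))
        · rw [zero_add, ← hP.freq_and hu h 0, firstPos_zero]
    _ = ((R.filter fun x => x ∈ Submodule.span F (Set.range v)).card : ℝ) * freq P +
        R.card * (freq P / q ^ u) := by
        rw [Finset.sum_add_distrib, ← Finset.sum_filter, Finset.sum_const, Finset.sum_const,
          nsmul_eq_mul, nsmul_eq_mul]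
    _ ≤ q ^ k * freq P + q ^ (u + 1) * (freq P / q ^ u) := by
        gcongr
        · rw [hqdef]
          exact_mod_cast card_filter_mem_span_range_le v R
        · rw [hqdef]
          exact_mod_cast hR
    _ = _ := by
        rw [pow_succ]
        field_simp

theorem DependsOn.and_zero {k u : ℕ} {v : Fin k → Fin N → F}
    {P : Matrix (Fin N) (Fin ℓ) F → Prop} (hP : DependsOn v P) (x : Fin N → F) :
    DependsOn (Fin.cons x v : Fin (k + 1) → Fin N → F)
      (fun A => P A ∧ firstPos u (Matrix.vecMul x A) = 0) := by
  intro A B h hA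
  have h0 : Matrix.vecMul x A = Matrix.vecMul x B := h 0
  exact ⟨hP A B (fun i => h i.succ) hA.1, h0 ▸ hA.2⟩

variable {u₀ u₁ : ℕ} (e : Fin N → F) (t : Fin ℓ → F)

/-- The conditions on a pair of vectors to collide in the last merge. -/
def BaseEvent (u₀ : ℕ) (e : Fin N → F) (t : Fin ℓ → F) (z₁ z₂ : Fin N → F)
    (A : Matrix (Fin N) (Fin ℓ) F) : Prop :=
  firstPos u₀ (Matrix.vecMul z₁ A) = 0 ∧ firstPos ℓ (Matrix.vecMul (z₁ + z₂ - e) A) = firstPos ℓ t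

instance (z₁ z₂ : Fin N → F) : DecidablePred (BaseEvent u₀ e t z₁ z₂) := by
  unfold BaseEvent; infer_instance

theorem dependsOn_baseEvent (z₁ z₂ : Fin N → F) :
    DependsOn (![z₁, z₁ + z₂ - e]) (BaseEvent u₀ e t z₁ z₂) := by
  intro A B h hA
  have h0 : Matrix.vecMul z₁ A = Matrix.vecMul z₁ B := h 0
  have h1 : Matrix.vecMul (z₁ + z₂ - e) A = Matrix.vecMul (z₁ + z₂ - e) B := h 1
  unfold BaseEvent at hA ⊢
  rwa [← h0, ← h1]

theorem freq_baseEvent (hu₀ : u₀ ≤ ℓ) {z₁ z₂ : Fin N → F} (hz : z₁ ≠ 0)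
    (hw : z₁ + z₂ - e ∉ Submodule.span F {z₁}) :
    freq (BaseEvent u₀ e t z₁ z₂) = 1 / (Fintype.card F : ℝ) ^ (u₀ + ℓ) := by
  have h := freq_and_of_notMem le_rfl _ hw (fun A => firstPos u₀ (Matrix.vecMul z₁ A) = 0)
    (fun A B h hA => by rwa [← vecMul_eq_of_eq_on_span h rfl]) t
  have h0 := freq_vecMul_eq (ℓ := ℓ) hu₀ hz 0
  rw [firstPos_zero] at h0
  rw [h0, div_div, ← pow_add] at h
  exact h

/-- The bounded factor in the second moment: the four conditions are added to events that depend
on two, three, four and five vectors. -/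
def momentConst (q : ℝ) : ℝ := (q ^ 2 + q) * ((q ^ 3 + q) * ((q ^ 4 + q) * (q ^ 5 + q)))

/-- The second moment for one pair `(z₁, z₂)`: imposing the conditions on two pairs of
representations one after the other loses a bounded factor each time. -/
theorem sum_freq_four_le (hu₀ : u₀ ≤ ℓ) (hu₁ : u₁ ≤ ℓ) {z₁ z₂ : Fin N → F} (hz : z₁ ≠ 0)
    (hw : z₁ + z₂ - e ∉ Submodule.span F {z₁}) {R₁ R₂ : Finset (Fin N → F)}
    (hR₁ : R₁.card ≤ Fintype.card F ^ (u₁ + 1)) (hR₂ : R₂.card ≤ Fintype.card F ^ (u₁ + 1)) :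
    ∑ x₁ ∈ R₁, ∑ x₂ ∈ R₂, ∑ x₁' ∈ R₁, ∑ x₂' ∈ R₂,
      freq (fun A => (((BaseEvent u₀ e t z₁ z₂ A ∧ firstPos u₁ (Matrix.vecMul x₁ A) = 0) ∧
        firstPos u₁ (Matrix.vecMul x₂ A) = 0) ∧ firstPos u₁ (Matrix.vecMul x₁' A) = 0) ∧
        firstPos u₁ (Matrix.vecMul x₂' A) = 0) ≤
      momentConst (Fintype.card F) * (1 / (Fintype.card F : ℝ) ^ (u₀ + ℓ)) := by
  have d0 := dependsOn_baseEvent (u₀ := u₀) e t z₁ z₂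
  rw [← freq_baseEvent e t hu₀ hz hw]
  set q : ℝ := (Fintype.card F : ℝ) with hqdef
  calc _ ≤ ∑ x₁ ∈ R₁, ∑ x₂ ∈ R₂, ∑ x₁' ∈ R₁, (q ^ 5 + q) *
        freq (fun A => ((BaseEvent u₀ e t z₁ z₂ A ∧ firstPos u₁ (Matrix.vecMul x₁ A) = 0) ∧
        firstPos u₁ (Matrix.vecMul x₂ A) = 0) ∧ firstPos u₁ (Matrix.vecMul x₁' A) = 0) :=
        Finset.sum_le_sum fun x₁ _ => Finset.sum_le_sum fun x₂ _ => Finset.sum_le_sum fun x₁' _ =>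
          (((d0.and_zero x₁).and_zero x₂).and_zero x₁').sum_freq_and_le hu₁ hR₂
    _ ≤ ∑ x₁ ∈ R₁, ∑ x₂ ∈ R₂, (q ^ 5 + q) * ((q ^ 4 + q) *
        freq (fun A => (BaseEvent u₀ e t z₁ z₂ A ∧ firstPos u₁ (Matrix.vecMul x₁ A) = 0) ∧
        firstPos u₁ (Matrix.vecMul x₂ A) = 0)) := by
        refine Finset.sum_le_sum fun x₁ _ => Finset.sum_le_sum fun x₂ _ => ?_
        rw [← Finset.mul_sum]
        gcongr
        exact ((d0.and_zero x₁).and_zero x₂).sum_freq_and_le hu₁ hR₁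
    _ ≤ ∑ x₁ ∈ R₁, (q ^ 5 + q) * ((q ^ 4 + q) * ((q ^ 3 + q) *
        freq (fun A => BaseEvent u₀ e t z₁ z₂ A ∧ firstPos u₁ (Matrix.vecMul x₁ A) = 0))) := by
        refine Finset.sum_le_sum fun x₁ _ => ?_
        rw [← Finset.mul_sum, ← Finset.mul_sum]
        gcongr
        exact (d0.and_zero x₁).sum_freq_and_le hu₁ hR₂
    _ ≤ (q ^ 5 + q) * ((q ^ 4 + q) * ((q ^ 3 + q) * ((q ^ 2 + q) *
        freq (BaseEvent u₀ e t z₁ z₂)))) := by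
        rw [← Finset.mul_sum, ← Finset.mul_sum, ← Finset.mul_sum]
        gcongr
        exact d0.sum_freq_and_le hu₁ hR₁
    _ = _ := by unfold momentConst; ring

/-- The condition on `z₁ + z₂ - e` is independent of the homogeneous conditions on `z₁` and on the
representations `x₁`, `x₂`. The vectors `z₁`, `x₁`, `x₂` may be dependent. -/
def Generic (e z₁ z₂ x₁ x₂ : Fin N → F) : Prop :=
  z₁ ≠ 0 ∧ z₁ + z₂ - e ∉ Submodule.span F (Set.range ![z₁, x₁, x₂])

/-- For a generic quadruple the expected conditions are at least as likely as independent ones. -/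
theorem Generic.le_freq (hu₀ : u₀ ≤ ℓ) (hu₁ : u₁ ≤ ℓ) {z₁ z₂ x₁ x₂ : Fin N → F}
    (h : Generic e z₁ z₂ x₁ x₂) :
    1 / (Fintype.card F : ℝ) ^ (u₀ + ℓ + 2 * u₁) ≤
      freq (fun A => (BaseEvent u₀ e t z₁ z₂ A ∧ firstPos u₁ (Matrix.vecMul x₁ A) = 0) ∧
        firstPos u₁ (Matrix.vecMul x₂ A) = 0) := by
  have hd : DependsOn (![z₁, x₁, x₂]) (fun A : Matrix (Fin N) (Fin ℓ) F =>
      (firstPos u₀ (Matrix.vecMul z₁ A) = 0 ∧ firstPos u₁ (Matrix.vecMul x₁ A) = 0) ∧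
        firstPos u₁ (Matrix.vecMul x₂ A) = 0) := by
    intro A B h hA
    have h0 : Matrix.vecMul z₁ A = Matrix.vecMul z₁ B := h 0
    have h1 : Matrix.vecMul x₁ A = Matrix.vecMul x₁ B := h 1
    have h2 : Matrix.vecMul x₂ A = Matrix.vecMul x₂ B := h 2
    rwa [← h0, ← h1, ← h2]
  have h1 := hd.freq_and le_rfl h.2 t
  have h2 := le_freq_and_of_sub hu₁ (fun A : Matrix (Fin N) (Fin ℓ) F =>
      firstPos u₀ (Matrix.vecMul z₁ A) = 0 ∧ firstPos u₁ (Matrix.vecMul x₁ A) = 0)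
      (fun A B hA hB => ⟨firstPos_vecMul_sub_eq_zero hA.1 hB.1,
        firstPos_vecMul_sub_eq_zero hA.2 hB.2⟩) x₂
  have h3 := le_freq_vecMul_eq_zero_and (F := F) hu₀ hu₁ z₁ x₁
  calc _ = 1 / (Fintype.card F : ℝ) ^ (u₀ + u₁) / (Fintype.card F : ℝ) ^ u₁ /
        (Fintype.card F : ℝ) ^ ℓ := by
        rw [div_div, div_div]
        congr 1
        ring
    _ ≤ _ := by
        refine le_trans ?_ (h1.ge.trans (freq_mono fun A hA => ?_))
        · gcongr
          refine le_trans ?_ h2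
          gcongr
        · exact ⟨⟨⟨hA.1.1.1, hA.2⟩, hA.1.1.2⟩, hA.1.2⟩

end SecondMoment

/-! ### The second moment method -/

section Combine

variable {F : Type*} [Field F] [Fintype F] [DecidableEq F] {N ℓ : ℕ}

open Classical in
/-- The representations of a pair `(z₁, z₂)` that satisfy all conditions, restricted to the generic
ones. -/
noncomputable def foundReprs (u₀ u₁ : ℕ) (e : Fin N → F) (t : Fin ℓ → F)
    (R : (Fin N → F) → Finset (Fin N → F)) (A : Matrix (Fin N) (Fin ℓ) F)
    (z : (Fin N → F) × (Fin N → F)) : Finset ((Fin N → F) × (Fin N → F)) :=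
  ((R z.1 ×ˢ R z.2).filter fun x => Generic e z.1 z.2 x.1 x.2).filter fun x =>
    (BaseEvent u₀ e t z.1 z.2 A ∧ firstPos u₁ (Matrix.vecMul x.1 A) = 0) ∧
      firstPos u₁ (Matrix.vecMul x.2 A) = 0

open Classical in
/-- The number of generic quadruples. -/
noncomputable def genericCount (e : Fin N → F) (R : (Fin N → F) → Finset (Fin N → F))
    (S : Finset (Fin N → F)) : ℕ :=
  ∑ z ∈ S ×ˢ S, ((R z.1 ×ˢ R z.2).filter fun x => Generic e z.1 z.2 x.1 x.2).card

/-- The pair `(z₁, z₂)` collides in the last merge, and both members have a representation that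
survives the first merges. -/
def FinalEvent (u₀ u₁ : ℕ) (e : Fin N → F) (t : Fin ℓ → F)
    (R : (Fin N → F) → Finset (Fin N → F)) (z : (Fin N → F) × (Fin N → F))
    (A : Matrix (Fin N) (Fin ℓ) F) : Prop :=
  BaseEvent u₀ e t z.1 z.2 A ∧ (∃ x ∈ R z.1, firstPos u₁ (Matrix.vecMul x A) = 0) ∧
    ∃ x ∈ R z.2, firstPos u₁ (Matrix.vecMul x A) = 0

instance (u₀ u₁ : ℕ) (e : Fin N → F) (t : Fin ℓ → F) (R : (Fin N → F) → Finset (Fin N → F))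
    (z : (Fin N → F) × (Fin N → F)) : DecidablePred (FinalEvent u₀ u₁ e t R z) := by
  unfold FinalEvent; infer_instance

variable {u₀ u₁ : ℕ} (e : Fin N → F) (t : Fin ℓ → F) (R : (Fin N → F) → Finset (Fin N → F))

/-- The first moment. -/
theorem le_average_card_foundReprs (hu₀ : u₀ ≤ ℓ) (hu₁ : u₁ ≤ ℓ) (S : Finset (Fin N → F)) :
    genericCount e R S / (Fintype.card F : ℝ) ^ (u₀ + ℓ + 2 * u₁) ≤
      ∑ z ∈ S ×ˢ S, (∑ A, ((foundReprs u₀ u₁ e t R A z).card : ℝ)) /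
        Fintype.card (Matrix (Fin N) (Fin ℓ) F) := by
  classical
  rw [genericCount, Nat.cast_sum, Finset.sum_div]
  refine Finset.sum_le_sum fun z _ => ?_
  unfold foundReprs
  rw [average_card_filter, div_eq_mul_one_div, ← nsmul_eq_mul]
  exact Finset.card_nsmul_le_sum _ _ _ fun x hx =>
    (Finset.mem_filter.1 hx).2.le_freq e t hu₀ hu₁

/-- The second moment for one pair. -/
theorem average_card_foundReprs_sq_le (hu₀ : u₀ ≤ ℓ) (hu₁ : u₁ ≤ ℓ)
    (z : (Fin N → F) × (Fin N → F)) (hR₁ : (R z.1).card ≤ Fintype.card F ^ (u₁ + 1))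
    (hR₂ : (R z.2).card ≤ Fintype.card F ^ (u₁ + 1)) :
    (∑ A, ((foundReprs u₀ u₁ e t R A z).card : ℝ) ^ 2) /
        Fintype.card (Matrix (Fin N) (Fin ℓ) F) ≤
      momentConst (Fintype.card F) * (1 / (Fintype.card F : ℝ) ^ (u₀ + ℓ)) := by
  classical
  by_cases hz : z.1 ≠ 0 ∧ z.1 + z.2 - e ∉ Submodule.span F {z.1}
  · refine le_trans ?_ (sum_freq_four_le e t hu₀ hu₁ hz.1 hz.2 hR₁ hR₂)
    have h := average_card_filter (N := N) (ℓ := ℓ) (F := F)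
      (R z.1 ×ˢ (R z.2 ×ˢ (R z.1 ×ˢ R z.2))) (fun A x =>
      (((BaseEvent u₀ e t z.1 z.2 A ∧ firstPos u₁ (Matrix.vecMul x.1 A) = 0) ∧
        firstPos u₁ (Matrix.vecMul x.2.1 A) = 0) ∧ firstPos u₁ (Matrix.vecMul x.2.2.1 A) = 0) ∧
        firstPos u₁ (Matrix.vecMul x.2.2.2 A) = 0)
    simp only [Finset.sum_product] at h
    rw [← h]
    gcongr with A
    rw [sq, ← Nat.cast_mul, ← Finset.card_product, Nat.cast_le]
    refine Finset.card_le_card_of_injOn (fun x => (x.1.1, x.1.2, x.2.1, x.2.2)) ?_ ?_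
    · intro x hx
      obtain ⟨h1, h2⟩ := Finset.mem_product.1 hx
      simp only [foundReprs, Finset.mem_filter, Finset.mem_product] at h1 h2
      simp only [Finset.coe_filter, Set.mem_ofPred_eq, Finset.mem_product]
      exact ⟨⟨h1.1.1.1, h1.1.1.2, h2.1.1.1, h2.1.1.2⟩, ⟨h1.2, h2.2.1.2⟩, h2.2.2⟩
    · rintro ⟨⟨a, b⟩, c, d⟩ - ⟨⟨a', b'⟩, c', d'⟩ - h
      simp only [Prod.mk.injEq] at h
      obtain ⟨rfl, rfl, rfl, rfl⟩ := h
      rfl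
  · have h0 : ∀ A : Matrix (Fin N) (Fin ℓ) F, foundReprs u₀ u₁ e t R A z = ∅ := by
      intro A
      refine Finset.eq_empty_of_forall_notMem fun x hx => hz ?_
      have hg := (Finset.mem_filter.1 (Finset.mem_filter.1 hx).1).2
      refine ⟨hg.1, fun hs => hg.2 (Submodule.span_mono ?_ hs)⟩
      rintro _ rfl
      exact ⟨0, rfl⟩
    simp only [h0, Finset.card_empty, Nat.cast_zero, ne_eq, OfNat.ofNat_ne_zero,
      not_false_eq_true, zero_pow, Finset.sum_const_zero, zero_div]
    unfold momentConst
    positivity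

/-- The second moment method, summed over all pairs `(z₁, z₂)`. -/
theorem sq_genericCount_le (hu₀ : u₀ ≤ ℓ) (hu₁ : u₁ ≤ ℓ) (S : Finset (Fin N → F))
    (hR : ∀ z ∈ S, (R z).card ≤ Fintype.card F ^ (u₁ + 1)) :
    (genericCount e R S / (Fintype.card F : ℝ) ^ (u₀ + ℓ + 2 * u₁)) ^ 2 ≤
      (∑ z ∈ S ×ˢ S, freq (FinalEvent (ℓ := ℓ) u₀ u₁ e t R z)) *
        ((S.card : ℝ) ^ 2 *
          (momentConst (Fintype.card F) * (1 / (Fintype.card F : ℝ) ^ (u₀ + ℓ)))) := by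
  classical
  have hM := card_matrix_pos (F := F) (N := N) (ℓ := ℓ)
  set M : ℝ := (Fintype.card (Matrix (Fin N) (Fin ℓ) F) : ℝ) with hMdef
  set X : ((Fin N → F) × (Fin N → F)) × Matrix (Fin N) (Fin ℓ) F → ℝ :=
    fun r => ((foundReprs u₀ u₁ e t R r.2 r.1).card : ℝ) with hX
  set I := ((S ×ˢ S) ×ˢ (Finset.univ : Finset (Matrix (Fin N) (Fin ℓ) F))) with hI
  -- Cauchy–Schwarz over the pairs and matrices with something found
  have h1 : (∑ r ∈ I, X r) ^ 2 ≤ ((I.filter fun r => X r ≠ 0).card : ℝ) * ∑ r ∈ I, X r ^ 2 := by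
    have hs : ∑ r ∈ I, X r = ∑ r ∈ I with X r ≠ 0, X r :=
      (Finset.sum_filter_ne_zero I).symm
    rw [hs]
    refine (sq_sum_le_card_mul_sum_sq (s := I.filter fun r => X r ≠ 0) (f := X)).trans ?_
    exact mul_le_mul_of_nonneg_left (Finset.sum_le_sum_of_subset_of_nonneg
      (Finset.filter_subset _ _) fun r _ _ => sq_nonneg (X r)) (Nat.cast_nonneg _)
  have h2 : ((I.filter fun r => X r ≠ 0).card : ℝ) ≤
      M * ∑ z ∈ S ×ˢ S, freq (FinalEvent (ℓ := ℓ) u₀ u₁ e t R z) := by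
    have : M * ∑ z ∈ S ×ˢ S, freq (FinalEvent (ℓ := ℓ) u₀ u₁ e t R z) =
        ((I.filter fun r => FinalEvent u₀ u₁ e t R r.1 r.2).card : ℝ) := by
      conv_rhs => rw [Finset.card_filter, hI, Finset.sum_product, Nat.cast_sum]
      rw [Finset.mul_sum]
      refine Finset.sum_congr rfl fun z _ => ?_
      rw [freq, ← hMdef, mul_div_cancel₀ _ hM.ne', Finset.card_filter]
    rw [this, Nat.cast_le]
    refine Finset.card_le_card (Finset.monotone_filter_right _ fun r _ hr => ?_)
    have hne : (foundReprs u₀ u₁ e t R r.2 r.1).Nonempty := by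
      rw [← Finset.card_ne_zero]
      exact fun h0 => hr (by simp [hX, h0])
    obtain ⟨x, hx⟩ := hne
    obtain ⟨hx1, ⟨hb, hx2⟩, hx3⟩ := Finset.mem_filter.1 hx
    obtain ⟨hr1, hr2⟩ := Finset.mem_product.1 (Finset.mem_filter.1 hx1).1
    exact ⟨hb, ⟨_, hr1, hx2⟩, ⟨_, hr2, hx3⟩⟩
  have h3 : ∑ r ∈ I, X r ^ 2 ≤ M * ((S.card : ℝ) ^ 2 *
      (momentConst (Fintype.card F) * (1 / (Fintype.card F : ℝ) ^ (u₀ + ℓ)))) := by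
    have hc : ((S.card : ℝ) ^ 2 *
        (momentConst (Fintype.card F) * (1 / (Fintype.card F : ℝ) ^ (u₀ + ℓ)))) =
        ∑ _z ∈ S ×ˢ S, (momentConst (Fintype.card F) * (1 / (Fintype.card F : ℝ) ^ (u₀ + ℓ))) := by
      rw [Finset.sum_const, Finset.card_product, nsmul_eq_mul, sq, Nat.cast_mul]
    rw [hc, hI, Finset.sum_product, Finset.mul_sum]
    refine Finset.sum_le_sum fun z hz => ?_
    rw [← div_le_iff₀' hM]
    obtain ⟨hz1, hz2⟩ := Finset.mem_product.1 hz
    exact average_card_foundReprs_sq_le e t R hu₀ hu₁ z (hR _ hz1) (hR _ hz2)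
  have h4 : M * (genericCount e R S / (Fintype.card F : ℝ) ^ (u₀ + ℓ + 2 * u₁)) ≤
      ∑ r ∈ I, X r := by
    rw [hI, Finset.sum_product, ← le_div_iff₀' hM, Finset.sum_div]
    exact le_average_card_foundReprs e t R hu₀ hu₁ S
  have hf : 0 ≤ ∑ z ∈ S ×ˢ S, freq (FinalEvent (ℓ := ℓ) u₀ u₁ e t R z) :=
    Finset.sum_nonneg fun z _ => freq_nonneg _
  have h5 : (M * (genericCount e R S / (Fintype.card F : ℝ) ^ (u₀ + ℓ + 2 * u₁))) ^ 2 ≤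
      (M * ∑ z ∈ S ×ˢ S, freq (FinalEvent (ℓ := ℓ) u₀ u₁ e t R z)) *
        (M * ((S.card : ℝ) ^ 2 *
          (momentConst (Fintype.card F) * (1 / (Fintype.card F : ℝ) ^ (u₀ + ℓ))))) := by
    refine (pow_le_pow_left₀ (by positivity) h4 2).trans (h1.trans ?_)
    exact mul_le_mul h2 h3 (Finset.sum_nonneg fun r _ => sq_nonneg _) (by positivity)
  rw [mul_pow, mul_mul_mul_comm, ← sq] at h5
  exact le_of_mul_le_mul_left h5 (by positivity)

open Classical in
/-- All but few quadruples are generic: apart from `z₁ = 0`, a quadruple that is not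
generic is determined by its first half, by `x₂`, and by three coefficients. -/
theorem le_genericCount (S X : Finset (Fin N → F)) (hRX : ∀ z ∈ S, R z ⊆ X) :
    (∑ z ∈ S, (R z).card) ^ 2 ≤ genericCount e R S +
      (∑ z ∈ S, (R z).card) * (X.card * (Fintype.card F ^ 3 + 1)) := by
  set T := S.sigma R with hT
  have hTc : T.card = ∑ z ∈ S, (R z).card := Finset.card_sigma _ _
  have hG : genericCount e R S =
      ((T ×ˢ T).filter fun r => Generic e r.1.1 r.2.1 r.1.2 r.2.2).card := by
    rw [genericCount, ← Finset.card_sigma]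
    refine Finset.card_bij' (fun a _ => (⟨a.1.1, a.2.1⟩, ⟨a.1.2, a.2.2⟩))
      (fun r _ => ⟨(r.1.1, r.2.1), (r.1.2, r.2.2)⟩) ?_ ?_ ?_ ?_
    · rintro ⟨⟨a, b⟩, c, d⟩ h
      simp only [hT, Finset.mem_sigma, Finset.mem_product, Finset.mem_filter] at h ⊢
      tauto
    · rintro ⟨⟨a, b⟩, c, d⟩ h
      simp only [hT, Finset.mem_sigma, Finset.mem_product, Finset.mem_filter] at h ⊢
      tauto
    · intros; rfl
    · intros; rfl
  have hsplit := Finset.card_filter_add_card_filter_not (s := T ×ˢ T)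
    (fun r => Generic e r.1.1 r.2.1 r.1.2 r.2.2)
  rw [← hG, Finset.card_product, hTc, ← sq] at hsplit
  rw [← hsplit]
  gcongr
  have hcover : (T ×ˢ T).filter (fun r => ¬ Generic e r.1.1 r.2.1 r.1.2 r.2.2) ⊆
      ((T ×ˢ T).filter fun r => r.1.1 = 0) ∪ (T ×ˢ T).filter fun r =>
        r.1.1 + r.2.1 - e ∈ Submodule.span F (Set.range ![r.1.1, r.1.2, r.2.2]) := by
    intro r hr
    obtain ⟨h1, h2⟩ := Finset.mem_filter.1 hr
    rw [Finset.mem_union, Finset.mem_filter, Finset.mem_filter]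
    unfold Generic at h2
    by_cases h0 : r.1.1 = 0
    · exact Or.inl ⟨h1, h0⟩
    · exact Or.inr ⟨h1, by_contra fun h => h2 ⟨h0, h⟩⟩
  refine (Finset.card_le_card hcover).trans ((Finset.card_union_le _ _).trans ?_)
  have hmem : ∀ r ∈ T, r.2 ∈ X := fun r hr =>
    hRX _ (Finset.mem_sigma.1 hr).1 (Finset.mem_sigma.1 hr).2
  have c1 : ((T ×ˢ T).filter fun r => r.1.1 = 0).card ≤ T.card * X.card := by
    rw [← Finset.card_product]
    refine Finset.card_le_card_of_injOn (fun r => (r.2, r.1.2)) ?_ ?_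
    · intro r hr
      obtain ⟨h1, -⟩ := Finset.mem_filter.1 hr
      obtain ⟨h1, h2⟩ := Finset.mem_product.1 h1
      exact Finset.mem_product.2 ⟨h2, hmem _ h1⟩
    · rintro ⟨⟨a, b⟩, r⟩ hr ⟨⟨a', b'⟩, r'⟩ hr' h
      have ha : a = 0 := (Finset.mem_filter.1 hr).2
      have ha' : a' = 0 := (Finset.mem_filter.1 hr').2
      simp only [Prod.mk.injEq] at h
      obtain ⟨rfl, rfl⟩ := h
      rw [ha, ha']
  have c2 : ((T ×ˢ T).filter fun r =>
      r.1.1 + r.2.1 - e ∈ Submodule.span F (Set.range ![r.1.1, r.1.2, r.2.2])).card ≤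
      T.card * (X.card * Fintype.card F ^ 3) := by
    have hq : Fintype.card F ^ 3 = (Finset.univ : Finset (Fin 3 → F)).card := by simp
    rw [hq, ← Finset.card_product, ← Finset.card_product]
    refine Finset.card_le_card_of_surjOn (fun a : (Σ _ : Fin N → F, Fin N → F) ×
      ((Fin N → F) × (Fin 3 → F)) => (a.1,
        ⟨a.2.2 0 • a.1.1 + a.2.2 1 • a.1.2 + a.2.2 2 • a.2.1 + e - a.1.1, a.2.1⟩)) ?_
    rintro ⟨r, r'⟩ hr
    obtain ⟨h1, h2⟩ := Finset.mem_filter.1 hr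
    obtain ⟨h1, h3⟩ := Finset.mem_product.1 h1
    obtain ⟨c, hc⟩ := (Submodule.mem_span_range_iff_exists_fun F).1 h2
    refine ⟨(r, (r'.2, c)), ?_, ?_⟩
    · simpa using ⟨h1, hmem _ h3⟩
    · simp only [Fin.sum_univ_three, Matrix.cons_val_zero, Matrix.cons_val_one,
        Matrix.cons_val] at hc
      simp only [hc]
      congr 2
      abel
  rw [← hTc]
  calc _ ≤ T.card * X.card + T.card * (X.card * Fintype.card F ^ 3) := add_le_add c1 c2
    _ = _ := by ring

end Combine

/-! ### Evenly distributed representations -/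

section Splitting

/-- A central binomial coefficient is the largest of the `k + 1` in its row. -/
theorem two_pow_le_choose_mul {k n : ℕ} (hn : n = k / 2 ∨ n = (k + 1) / 2) :
    2 ^ k ≤ k.choose n * (k + 1) := by
  have hc : k.choose n = k.choose (k / 2) := by
    rcases hn with rfl | rfl
    · rfl
    · exact Nat.choose_symm_of_eq_add (by omega)
  rw [hc, ← Nat.sum_range_choose k]
  calc _ ≤ ∑ _m ∈ Finset.range (k + 1), k.choose (k / 2) :=
        Finset.sum_le_sum fun m _ => Nat.choose_le_middle m k
    _ = _ := by rw [Finset.sum_const, Finset.card_range, smul_eq_mul, mul_comm]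

/-- Many subsets `H` meet every fibre of `f` in a prescribed number of elements, as long as these
numbers are the halves of the sizes of the fibres, rounded up or down. -/
theorem two_pow_le_card_balanced {ι κ : Type*} [Fintype ι] [DecidableEq ι] [Fintype κ]
    [DecidableEq κ] (f : ι → κ) (n : κ → ℕ)
    (hn : ∀ q, n q = (Finset.univ.filter fun j => f j = q).card / 2 ∨
      n q = ((Finset.univ.filter fun j => f j = q).card + 1) / 2) :
    2 ^ Fintype.card ι ≤ (Finset.univ.filter fun H : Finset ι =>
      ∀ q, (H.filter fun j => f j = q).card = n q).card *
        (Fintype.card ι + 1) ^ Fintype.card κ := by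
  set K : κ → Finset ι := fun q => Finset.univ.filter fun j => f j = q with hK
  have h1 : (Fintype.piFinset fun q => (K q).powersetCard (n q)).card ≤
      (Finset.univ.filter fun H : Finset ι =>
        ∀ q, (H.filter fun j => f j = q).card = n q).card := by
    have hback : ∀ g ∈ Fintype.piFinset fun q => (K q).powersetCard (n q), ∀ q,
        ((Finset.univ.filter fun j => j ∈ g (f j)).filter fun j => f j = q) = g q := by
      intro g hg q
      have hg' := (Finset.mem_powersetCard.1 (Fintype.mem_piFinset.1 hg q)).1
      ext j
      simp only [Finset.mem_filter, Finset.mem_univ, true_and]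
      constructor
      · rintro ⟨h, rfl⟩; exact h
      · intro h
        have : f j = q := (Finset.mem_filter.1 (hg' h)).2
        exact ⟨this.symm ▸ h, this⟩
    refine Finset.card_le_card_of_injOn (fun g => Finset.univ.filter fun j => j ∈ g (f j)) ?_ ?_
    · intro g hg
      refine Finset.mem_filter.2 ⟨Finset.mem_univ _, fun q => ?_⟩
      rw [hback g hg q]
      exact (Finset.mem_powersetCard.1 (Fintype.mem_piFinset.1 hg q)).2
    · intro g hg g' hg' h
      funext q
      rw [← hback g hg q, ← hback g' hg' q]
      exact congrArg (fun H : Finset ι => H.filter fun j => f j = q) h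
  rw [Fintype.card_piFinset] at h1
  have h2 : Fintype.card ι = ∑ q, (K q).card := by
    rw [← Finset.card_univ]
    exact Finset.card_eq_sum_card_fiberwise fun j _ => Finset.mem_coe.2 (Finset.mem_univ _)
  calc 2 ^ Fintype.card ι = ∏ q, 2 ^ (K q).card := by
        rw [Finset.prod_pow_eq_pow_sum, ← h2]
    _ ≤ ∏ q, ((K q).card.choose (n q) * (Fintype.card ι + 1)) := by
        refine Finset.prod_le_prod' fun q _ => (two_pow_le_choose_mul (hn q)).trans ?_
        gcongr
        exact Finset.card_le_univ _
    _ = (∏ q, ((K q).powersetCard (n q)).card) * (Fintype.card ι + 1) ^ Fintype.card κ := by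
        rw [Finset.prod_mul_distrib, Finset.prod_const, Finset.card_univ]
        simp only [Finset.card_powersetCard]
    _ ≤ _ := by gcongr

/-- The classes of a representation can be halved simultaneously, up to rounding, such that both
summands and the set of all coordinates are split exactly. -/
theorem exists_rounding {a b g c ε o : ℕ} (h1 : Even (a + b + c + ε)) (h2 : Even (b + g))
    (h3 : Even (c + ε + o)) :
    ∃ nA nA' nB nB' nC nG nG' nD nO : ℕ,
      ((nA = a / 2 ∨ nA = (a + 1) / 2) ∧ (nA' = a / 2 ∨ nA' = (a + 1) / 2) ∧
      (nB = b / 2 ∨ nB = (b + 1) / 2) ∧ (nB' = b / 2 ∨ nB' = (b + 1) / 2) ∧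
      (nC = c / 2 ∨ nC = (c + 1) / 2) ∧ (nG = g / 2 ∨ nG = (g + 1) / 2) ∧
      (nG' = g / 2 ∨ nG' = (g + 1) / 2) ∧ (nD = ε / 2 ∨ nD = (ε + 1) / 2) ∧
      (nO = o / 2 ∨ nO = (o + 1) / 2)) ∧
      2 * (nA + nB + nC + nD) = a + b + c + ε ∧ 2 * (nA' + nB' + nC + nD) = a + b + c + ε ∧
      2 * (nB' + nG) = b + g ∧ 2 * (nB + nG') = b + g ∧
      2 * (nA + nA' + nB + nB' + nC + nG + nG' + nD + nO) =
        2 * a + 2 * b + 2 * g + c + ε + o := by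
  obtain ⟨k1, h1⟩ := h1
  obtain ⟨k2, h2⟩ := h2
  obtain ⟨k3, h3⟩ := h3
  rcases Nat.mod_two_eq_zero_or_one a with ha | ha <;>
    rcases Nat.mod_two_eq_zero_or_one b with hb | hb
  · exact ⟨a / 2, a / 2, b / 2, b / 2, (c + 1) / 2, g / 2, g / 2, ε / 2, o / 2, by omega⟩
  · exact ⟨a / 2, a / 2, b / 2, b / 2, (c + 1) / 2, (g + 1) / 2, (g + 1) / 2, (ε + 1) / 2, o / 2,
      by omega⟩
  · exact ⟨a / 2, a / 2, b / 2, b / 2, (c + 1) / 2, g / 2, g / 2, (ε + 1) / 2, (o + 1) / 2,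
      by omega⟩
  · exact ⟨(a + 1) / 2, a / 2, b / 2, (b + 1) / 2, (c + 1) / 2, g / 2, (g + 1) / 2, ε / 2, o / 2,
      by omega⟩

end Splitting

section Symmetry

/-- Any two sets of the same size are related by a permutation. -/
theorem exists_perm_mem_iff {ι : Type*} [Fintype ι] [DecidableEq ι] {H H' : Finset ι}
    (h : H.card = H'.card) : ∃ π : Equiv.Perm ι, ∀ j, π j ∈ H' ↔ j ∈ H := by
  have e : {j // j ∈ H} ≃ {j // j ∈ H'} := Finset.equivOfCardEq h
  refine ⟨e.extendSubtype, fun j => ⟨fun hj => ?_, fun hj => e.extendSubtype_mem j hj⟩⟩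
  by_contra hj'
  exact e.extendSubtype_not_mem j hj' hj

theorem card_filter_perm {ι : Type*} [DecidableEq ι] {H H' : Finset ι} (π : Equiv.Perm ι)
    (h : ∀ j, π j ∈ H' ↔ j ∈ H) (P : ι → Prop) [DecidablePred P] :
    (H.filter fun j => P (π j)).card = (H'.filter P).card := by
  refine Finset.card_equiv π fun j => ?_
  simp only [Finset.mem_filter, h]

variable {F : Type*} [Field F] [Fintype F] [DecidableEq F]

theorem mem_wellFormedOn_comp_perm (h2 : (2 : F) ≠ 0) (h3 : (3 : F) ≠ 0) {N v m : ℕ}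
    (π : Equiv.Perm (Fin N)) {x : Fin N → F} (hx : x ∈ wellFormedOn Finset.univ v m) :
    x ∘ π ∈ wellFormedOn Finset.univ v m := by
  rw [mem_wellFormedOn_iff h2 h3] at hx ⊢
  refine ⟨fun j => hx.1 (π j), by simp, ?_, ?_⟩
  · rw [← hx.2.2.1]
    exact card_filter_perm π (by simp) fun j => typ (x j) = 1
  · rw [← hx.2.2.2]
    exact card_filter_perm π (by simp) fun j => typ (x j) = 2

theorem mem_reprs_comp_perm (h2 : (2 : F) ≠ 0) (h3 : (3 : F) ≠ 0) {N v m b c ε : ℕ}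
    (π : Equiv.Perm (Fin N)) {e x : Fin N → F} (hx : x ∈ reprs v m b c ε e) :
    x ∘ π ∈ reprs v m b c ε (e ∘ π) := by
  have h := (Finset.mem_filter.1 hx).2
  refine Finset.mem_filter.2 ⟨Finset.mem_univ _, ?_⟩
  rw [isRepr_iff h2 h3] at h ⊢
  refine ⟨by simp, fun q hq => ?_⟩
  rw [← h.2 q hq]
  exact card_filter_perm π (by simp) fun j => pattern e x (e - x) j = q

end Symmetry

section EvenSplits

variable {F : Type*} [Field F] [Fintype F] [DecidableEq F]

/-- Half of the entries `±1` and half of the entries `±2` of `x` lie in `H`. -/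
def EvenSplit {N : ℕ} (v m : ℕ) (H : Finset (Fin N)) (x : Fin N → F) : Prop :=
  (H.filter fun j => typ (x j) = 1).card = v / 2 ∧ (H.filter fun j => typ (x j) = 2).card = m / 2

instance {N : ℕ} (v m : ℕ) (H : Finset (Fin N)) (x : Fin N → F) :
    Decidable (EvenSplit v m H x) := by
  unfold EvenSplit; infer_instance

/-- The number of triples of types, the degree of the polynomial losses. It exceeds the number of
patterns, which does no harm. -/
def typeCount : ℕ := Fintype.card (Fin 4 × Fin 4 × Fin 4)

/-- The set `H` consists of half of the coordinates and splits both summands evenly. -/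
def BalancedSplit {N : ℕ} (v m : ℕ) (x y : Fin N → F) (H : Finset (Fin N)) : Prop :=
  H.card = N / 2 ∧ EvenSplit v m H x ∧ EvenSplit v m H y

instance {N : ℕ} (v m : ℕ) (x y : Fin N → F) : DecidablePred (BalancedSplit v m x y) := by
  unfold BalancedSplit; infer_instance

/-- A polynomial fraction of all sets of coordinates splits both summands of a
representation evenly. -/
theorem two_pow_le_card_evenSplit (h2 : (2 : F) ≠ 0) (h3 : (3 : F) ≠ 0) {N v m b c ε : ℕ}
    (hv : Even v) (hb : b ≤ v / 2) (hc : c ≤ m) (hmc : Even (m - c)) (hN : v + m + ε ≤ N)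
    (hNe : Even N) (hv' : Even (v / 2 + ε + c)) (hm' : Even ((m - c) / 2 + b))
    {e x y : Fin N → F} (h : IsRepr v m b c ε e x y) :
    2 ^ N ≤ (Finset.univ.filter (BalancedSplit (v / 2 + ε + c) ((m - c) / 2 + b) x y)).card *
      (N + 1) ^ typeCount := by
  have hp := pattern_mem h2 h3 hv hb hc hmc hN h
  have hcount := ((isRepr_iff h2 h3 v m b c ε e x y).1 h).2
  obtain ⟨a, ha⟩ : ∃ a, v / 2 - b = a := ⟨_, rfl⟩
  obtain ⟨g, hg⟩ : ∃ g, (m - c) / 2 = g := ⟨_, rfl⟩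
  obtain ⟨o, ho⟩ : ∃ o, N - v - m - ε = o := ⟨_, rfl⟩
  have hv2 : v = 2 * a + 2 * b := by obtain ⟨k, rfl⟩ := hv; omega
  have hm2 : m = c + 2 * g := by obtain ⟨k, hk⟩ := hmc; omega
  have hvv : v / 2 + ε + c = a + b + c + ε := by omega
  rw [hvv] at hv' ⊢
  rw [hg, add_comm] at hm'
  rw [hg, add_comm g b]
  obtain ⟨nA, nA', nB, nB', nC, nG, nG', nD, nO, ⟨rA, rA', rB, rB', rC, rG, rG', rD, rO⟩, s1, s2,
    s3, s4, s5⟩ := exists_rounding (a := a) (b := b) (g := g) (c := c) (ε := ε) (o := o) hv' hm'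
      (by obtain ⟨k, hk⟩ := hNe; exact ⟨k - a - b - g, by omega⟩)
  let n : Fin 4 × Fin 4 × Fin 4 → ℕ := fun q =>
    if q = (1, 1, 0) then nA else if q = (1, 0, 1) then nA'
    else if q = (1, 1, 2) then nB else if q = (1, 2, 1) then nB'
    else if q = (2, 1, 1) then nC else if q = (2, 2, 0) then nG
    else if q = (2, 0, 2) then nG' else if q = (0, 1, 1) then nD
    else if q = (0, 0, 0) then nO else 0
  have hn : ∀ q, n q = (Finset.univ.filter fun j => pattern e x y j = q).card / 2 ∨
      n q = ((Finset.univ.filter fun j => pattern e x y j = q).card + 1) / 2 := by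
    intro q
    by_cases hq : q ∈ patterns
    · rw [hcount q hq]
      simp only [patterns, Finset.mem_insert, Finset.mem_singleton] at hq
      rcases hq with rfl | rfl | rfl | rfl | rfl | rfl | rfl | rfl | rfl <;>
        simp [n, patternCount, ha, hg, ho] <;> assumption
    · -- triples of types that are not patterns do not occur, and zero is half of zero
      have h0 : (Finset.univ.filter fun j => pattern e x y j = q) = ∅ := by
        rw [Finset.filter_eq_empty_iff]
        rintro j - rfl
        exact hq (hp j)
      left
      rw [h0]
      simp only [patterns, Finset.mem_insert, Finset.mem_singleton, not_or] at hq
      simp [n, hq]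
  have key := two_pow_le_card_balanced (pattern e x y) n hn
  rw [Fintype.card_fin] at key
  rw [← typeCount] at key
  refine key.trans (Nat.mul_le_mul_right _ (Finset.card_le_card ?_))
  refine Finset.monotone_filter_right _ fun H _ hH => ?_
  have hsum : ∀ (P : Fin 4 × Fin 4 × Fin 4 → Prop) [DecidablePred P],
      (H.filter fun j => P (pattern e x y j)).card = ∑ q ∈ patterns.filter P, n q := by
    intro P _
    rw [card_filter_pattern hp]
    exact Finset.sum_congr rfl fun q _ => hH q
  have k1 := hsum fun q => q.2.1 = 1
  have k2 := hsum fun q => q.2.1 = 2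
  have k3 := hsum fun q => q.2.2 = 1
  have k4 := hsum fun q => q.2.2 = 2
  have k5 := hsum fun _ => True
  obtain ⟨e1, e2, e3, e4⟩ := filter_patterns
  rw [e1] at k1; rw [e2] at k2; rw [e3] at k3; rw [e4] at k4
  rw [Finset.filter_true, Finset.filter_true] at k5
  simp [n, pattern] at k1 k2 k3 k4
  simp [n, patterns] at k5
  clear rA rA' rB rB' rC rG rG' rD rO
  refine ⟨?_, ⟨k1.trans ?_, k2.trans ?_⟩, k3.trans ?_, k4.trans ?_⟩ <;> omega

variable (p : Params)

/-- The representations of a level-1 vector whose summands both occur in the concatenation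
merges. -/
def balancedReprs (z : Fin p.len → F) : Finset (Fin p.len → F) :=
  (p.levelReprs 1 z).filter fun x => x ∈ concatSet p F ∧ z - x ∈ concatSet p F

/-- Up to a polynomial factor, all representations of level-1 vectors can be found by the
concatenation merges. -/
theorem card_level_mul_reprFormula_le (h2 : (2 : F) ≠ 0) (h3 : (3 : F) ≠ 0) (hp : p.Admissible) :
    (p.level F 1).card * p.reprFormula 1 ≤
      (∑ z ∈ p.level F 1, (balancedReprs p z).card) * (p.len + 1) ^ typeCount := by
  set T : Finset (Σ _ : Fin p.len → F, Fin p.len → F) :=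
    (p.level F 1).sigma fun z => p.levelReprs 1 z with hT
  let Bal : (Σ _ : Fin p.len → F, Fin p.len → F) → Finset (Fin p.len) → Prop := fun r =>
    BalancedSplit (p.vAt 2) (p.mAt 2) r.2 (r.1 - r.2)
  have hTc : T.card = (p.level F 1).card * p.reprFormula 1 := by
    rw [hT, Finset.card_sigma, Finset.sum_congr rfl fun z hz =>
      hp.card_levelReprs h2 h3 (by norm_num) hz, Finset.sum_const, smul_eq_mul]
  have hone : ∀ r ∈ T, 2 ^ p.len ≤
      (Finset.univ.filter (Bal r)).card * (p.len + 1) ^ typeCount := by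
    intro r hr
    have hx := (Finset.mem_filter.1 (Finset.mem_sigma.1 hr).2).2
    exact two_pow_le_card_evenSplit h2 h3 (hp.even_v 1 (by norm_num)) (hp.b_le 1 (by norm_num))
      (hp.c_le 1 (by norm_num)) (hp.even_sub 1 (by norm_num)) (hp.eps_le 1 (by norm_num))
      hp.even_len (hp.even_v 2 le_rfl) hp.even_m hx
  have hfirst : (T.filter fun r => Bal r (firstHalf p.len)).card ≤
      ∑ z ∈ p.level F 1, (balancedReprs p z).card := by
    rw [← Finset.card_sigma]
    refine Finset.card_le_card fun r hr => ?_
    obtain ⟨hr, -, hb1, hb2⟩ := Finset.mem_filter.1 hr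
    obtain ⟨hz, hx⟩ := Finset.mem_sigma.1 hr
    obtain ⟨hl1, hl2⟩ := hp.summands_mem_level h2 h3 (by norm_num) hx
    exact Finset.mem_sigma.2 ⟨hz, Finset.mem_filter.2 ⟨hx,
      mem_concatSet p h2 h3 hp hl1 hb1.1 hb1.2, mem_concatSet p h2 h3 hp hl2 hb2.1 hb2.2⟩⟩
  -- a permutation of the coordinates moves `H` to the first half
  have hall : ∀ H, (T.filter fun r => Bal r H).card ≤
      ∑ z ∈ p.level F 1, (balancedReprs p z).card := by
    intro H
    by_cases hH : H.card = p.len / 2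
    · refine le_trans ?_ hfirst
      obtain ⟨π, hπ⟩ := exists_perm_mem_iff ((card_firstHalf p.len).trans hH.symm)
      have hcomp : ∀ x : Fin p.len → F, EvenSplit (p.vAt 2) (p.mAt 2) H x →
          EvenSplit (p.vAt 2) (p.mAt 2) (firstHalf p.len) (x ∘ π) := by
        intro x hx
        refine ⟨Eq.trans ?_ hx.1, Eq.trans ?_ hx.2⟩
        · exact card_filter_perm π hπ fun j => typ (x j) = 1
        · exact card_filter_perm π hπ fun j => typ (x j) = 2
      refine Finset.card_le_card_of_injOn (fun r => ⟨r.1 ∘ π, r.2 ∘ π⟩) ?_ ?_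
      · intro r hr
        obtain ⟨hr, -, hb1, hb2⟩ := Finset.mem_filter.1 hr
        obtain ⟨hz, hx⟩ := Finset.mem_sigma.1 hr
        exact Finset.mem_filter.2 ⟨Finset.mem_sigma.2
          ⟨mem_wellFormedOn_comp_perm h2 h3 π hz, mem_reprs_comp_perm h2 h3 π hx⟩,
          card_firstHalf _, hcomp _ hb1, hcomp _ hb2⟩
      · rintro ⟨z, x⟩ - ⟨z', x'⟩ - h
        simp only [Sigma.mk.injEq, heq_eq_eq] at h
        rw [π.surjective.injective_comp_right h.1, π.surjective.injective_comp_right h.2]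
    · rw [Finset.filter_false_of_mem fun r _ h => hH h.1]
      exact Nat.zero_le _
  -- double counting of the pairs of a representation and a set that splits it
  rw [← hTc]
  refine Nat.le_of_mul_le_mul_left (c := 2 ^ p.len) ?_ (by positivity)
  calc 2 ^ p.len * T.card = ∑ _r ∈ T, 2 ^ p.len := by
        rw [Finset.sum_const, smul_eq_mul, mul_comm]
    _ ≤ ∑ r ∈ T, (Finset.univ.filter (Bal r)).card * (p.len + 1) ^ typeCount :=
        Finset.sum_le_sum hone
    _ = (∑ H, (T.filter fun r => Bal r H).card) * (p.len + 1) ^ typeCount := by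
        rw [← Finset.sum_mul]
        simp only [Finset.card_filter]
        rw [Finset.sum_comm]
    _ ≤ (∑ _H : Finset (Fin p.len), ∑ z ∈ p.level F 1, (balancedReprs p z).card) *
          (p.len + 1) ^ typeCount := by
        gcongr with H
        exact hall H
    _ = _ := by
        rw [Finset.sum_const, Finset.card_univ, Fintype.card_finset, Fintype.card_fin,
          smul_eq_mul, mul_assoc]

end EvenSplits

/-! ### The last merge -/

section FinalMerge

variable {F : Type*} [Field F] [Fintype F] [DecidableEq F]
  (p : Params) (e : Fin p.len → F) (t : Fin p.ℓ → F)

/-- A balanced representation whose first summand has a vanishing partial syndrome is found by the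
second level of merges. -/
theorem mem_reprMerge_of_balanced (A : Matrix (Fin p.len) (Fin p.ℓ) F) {u₀ u₁ : ℕ}
    (hu : u₁ ≤ u₀) {s : Fin p.ℓ → F} {z x : Fin p.len → F} (hz : z ∈ p.level F 1)
    (hzs : firstPos u₀ (Matrix.vecMul z A) = firstPos u₀ s)
    (hx : x ∈ balancedReprs p z) (hxA : firstPos u₁ (Matrix.vecMul x A) = 0) :
    z ∈ (reprMerge p A 1 u₀ s (concatMerge p A u₁ 0).val (concatMerge p A u₁ s).val).val := by
  obtain ⟨-, hx1, hx2⟩ := Finset.mem_filter.1 hx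
  rw [mem_reprMerge]
  refine ⟨hz, x, ?_, z - x, ?_, ?_, by abel⟩
  · rw [mem_concatMerge, firstPos_zero]
    exact ⟨hx1, hxA⟩
  · rw [mem_concatMerge, Matrix.sub_vecMul, firstPos_sub, hxA, sub_zero]
    exact ⟨hx2, firstPos_mono hu hzs⟩
  · rwa [add_sub_cancel]

/-- The pairs for which `FinalEvent` holds are among those written out by the last merge. -/
theorem sum_freq_finalEvent_le_expectedCost (hu : p.mergePos F 1 ≤ p.mergePos F 0)
    (hu' : p.mergePos F 0 ≤ p.ℓ) :
    ∑ z ∈ p.level F 1 ×ˢ p.level F 1,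
      freq (FinalEvent (ℓ := p.ℓ) (p.mergePos F 0) (p.mergePos F 1) e t (balancedReprs p) z) ≤
      expectedCost p e t := by
  rw [← average_card_filter]
  refine average_mono p fun A => ?_
  rw [Nat.cast_le]
  set s := Matrix.vecMul e A + t with hs
  have hsub : (p.level F 1 ×ˢ p.level F 1).filter (fun z =>
      FinalEvent (p.mergePos F 0) (p.mergePos F 1) e t (balancedReprs p) z A) ⊆
      collisions p A p.ℓ s
        (reprMerge p A 1 (p.mergePos F 0) 0 (concatMerge p A (p.mergePos F 1) 0).val
          (concatMerge p A (p.mergePos F 1) 0).val).val.toFinset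
        (reprMerge p A 1 (p.mergePos F 0) s (concatMerge p A (p.mergePos F 1) 0).val
          (concatMerge p A (p.mergePos F 1) s).val).val.toFinset := by
    rintro ⟨z₁, z₂⟩ hz
    obtain ⟨hz, ⟨hb1, hb2⟩, ⟨x₁, hx₁, hx₁A⟩, x₂, hx₂, hx₂A⟩ := Finset.mem_filter.1 hz
    obtain ⟨hz₁, hz₂⟩ := Finset.mem_product.1 hz
    simp only at hb1 hb2 hx₁ hx₂ hz₁ hz₂
    rw [← firstPos_shift, ← hs] at hb2
    have hb3 := firstPos_mono hu' hb2
    rw [Matrix.add_vecMul, firstPos_add, hb1, zero_add] at hb3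
    refine Finset.mem_filter.2 ⟨Finset.mem_product.2 ⟨List.mem_toFinset.2 ?_,
      List.mem_toFinset.2 ?_⟩, hb2⟩
    · exact mem_reprMerge_of_balanced p A hu hz₁ (hb1.trans (firstPos_zero _).symm) hx₁ hx₁A
    · exact mem_reprMerge_of_balanced p A hu hz₂ hb3 hx₂ hx₂A
  refine (Finset.card_le_card hsub).trans ?_
  simp only [bjmmPlus, Timed.steps_bind]
  rw [steps_reprMerge p A p.ℓ s 0 _ _ (nodup_reprMerge ..) (nodup_reprMerge ..)]
  omega

/-- The number of balanced representations of level-1 vectors. -/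
def balancedCount (p : Params) (F : Type*) [Field F] [Fintype F] [DecidableEq F] : ℕ :=
  ∑ z ∈ p.level F 1, (balancedReprs p z).card

/-- The lower bound from the pairs that collide in the last merge. The hypothesis `hT` makes at
least half of all quadruples of balanced representations generic. -/
theorem final_le_expectedCost (h2 : (2 : F) ≠ 0) (h3 : (3 : F) ≠ 0) (hp : p.Admissible)
    (hu : p.mergePos F 1 ≤ p.mergePos F 0) (hu' : p.mergePos F 0 ≤ p.ℓ)
    (hT : 2 * ((p.level F 2).card * (Fintype.card F ^ 3 + 1)) ≤ balancedCount p F) :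
    (balancedCount p F : ℝ) ^ 4 / (4 * momentConst (Fintype.card F) *
      ((p.level F 1).card : ℝ) ^ 2 *
        (Fintype.card F : ℝ) ^ (p.mergePos F 0 + p.ℓ + 4 * p.mergePos F 1)) ≤
      expectedCost p e t := by
  have hu₁ := hu.trans hu'
  have hR : ∀ z ∈ p.level F 1, (balancedReprs p z).card ≤
      Fintype.card F ^ (p.mergePos F 1 + 1) := by
    intro z hz
    refine (Finset.card_le_card (Finset.filter_subset _ _)).trans ?_
    rw [hp.card_levelReprs h2 h3 (by norm_num) hz, ← hp.reprCount_eq h2 h3 (by norm_num)]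
    exact (Nat.lt_pow_succ_log_self Fintype.one_lt_card _).le
  have hm := sq_genericCount_le e t (balancedReprs p) hu' hu₁ (p.level F 1) hR
  have hg := le_genericCount e (balancedReprs p) (p.level F 1) (p.level F 2) (fun z _ x hx =>
    (hp.summands_mem_level h2 h3 (by norm_num) (Finset.mem_filter.1 hx).1).1)
  rw [← balancedCount] at hg
  have hG : balancedCount p F ^ 2 ≤ 2 * genericCount e (balancedReprs p) (p.level F 1) := by
    nlinarith
  have hG' : (balancedCount p F : ℝ) ^ 2 / 2 ≤
      genericCount e (balancedReprs p) (p.level F 1) := by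
    rw [div_le_iff₀ (by norm_num), mul_comm]
    exact_mod_cast hG
  have hK : 0 < momentConst (Fintype.card F) := by unfold momentConst; positivity
  have hS : (0 : ℝ) < (p.level F 1).card := by
    exact_mod_cast hp.card_level_pos h2 h3 (by norm_num : 1 ≤ 2)
  have hB : 0 < ((p.level F 1).card : ℝ) ^ 2 * (momentConst (Fintype.card F) *
      (1 / (Fintype.card F : ℝ) ^ (p.mergePos F 0 + p.ℓ))) := by positivity
  have h1 := (div_le_iff₀ hB).2 hm
  refine le_trans ?_ (h1.trans (sum_freq_finalEvent_le_expectedCost p e t hu hu'))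
  calc _ = ((balancedCount p F : ℝ) ^ 2 / 2 /
        (Fintype.card F : ℝ) ^ (p.mergePos F 0 + p.ℓ + 2 * p.mergePos F 1)) ^ 2 /
        (((p.level F 1).card : ℝ) ^ 2 * (momentConst (Fintype.card F) *
          (1 / (Fintype.card F : ℝ) ^ (p.mergePos F 0 + p.ℓ)))) := by
        have e1 : (Fintype.card F : ℝ) ^ (p.mergePos F 0 + p.ℓ + 4 * p.mergePos F 1) =
            ((Fintype.card F : ℝ) ^ (p.mergePos F 0 + p.ℓ + 2 * p.mergePos F 1)) ^ 2 /
              (Fintype.card F : ℝ) ^ (p.mergePos F 0 + p.ℓ) := by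
          rw [eq_div_iff (by positivity)]
          ring
        rw [e1]
        field_simp
        norm_num
    _ ≤ _ := by gcongr

end FinalMerge

/-! ### Exponential growth rates -/

section Rates

/-- The sequence `f` is eventually positive and grows like `2 ^ (a n + o(n))`. -/
def HasRate (f : ℕ → ℝ) (a : ℝ) : Prop :=
  (∀ᶠ n in atTop, 0 < f n) ∧ Tendsto (fun n => Real.logb 2 (f n) / n) atTop (𝓝 a)

variable {f g T : ℕ → ℝ} {a b c : ℝ}

theorem HasRate.congr (hf : HasRate f a) (h : ∀ᶠ n in atTop, f n = g n) : HasRate g a := by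
  refine ⟨?_, hf.2.congr' ?_⟩
  · filter_upwards [hf.1, h] with n h1 h2
    rwa [← h2]
  · filter_upwards [h] with n h2
    rw [h2]

theorem HasRate.mul (hf : HasRate f a) (hg : HasRate g b) :
    HasRate (fun n => f n * g n) (a + b) := by
  refine ⟨?_, (hf.2.add hg.2).congr' ?_⟩
  · filter_upwards [hf.1, hg.1] with n h1 h2
    positivity
  · filter_upwards [hf.1, hg.1] with n h1 h2
    rw [Real.logb_mul h1.ne' h2.ne', add_div]

theorem HasRate.div (hf : HasRate f a) (hg : HasRate g b) :
    HasRate (fun n => f n / g n) (a - b) := by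
  refine ⟨?_, (hf.2.sub hg.2).congr' ?_⟩
  · filter_upwards [hf.1, hg.1] with n h1 h2
    positivity
  · filter_upwards [hf.1, hg.1] with n h1 h2
    rw [Real.logb_div h1.ne' h2.ne', sub_div]

theorem HasRate.pow (hf : HasRate f a) (k : ℕ) : HasRate (fun n => f n ^ k) (k * a) := by
  refine ⟨?_, (hf.2.const_mul (k : ℝ)).congr' ?_⟩
  · filter_upwards [hf.1] with n h1
    positivity
  · filter_upwards [hf.1] with n h1
    rw [Real.logb_pow, mul_div_assoc]

theorem hasRate_const (hc : 0 < c) : HasRate (fun _ => c) 0 :=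
  ⟨Eventually.of_forall fun _ => hc, tendsto_const_div_atTop_nhds_zero_nat _⟩

theorem HasRate.const_mul (hf : HasRate f a) (hc : 0 < c) : HasRate (fun n => c * f n) a := by
  simpa using (hasRate_const hc).mul hf

/-- A sum grows like its largest term. -/
theorem HasRate.add (hf : HasRate f a) (hg : HasRate g b) :
    HasRate (fun n => f n + g n) (max a b) := by
  refine ⟨?_, ?_⟩
  · filter_upwards [hf.1, hg.1] with n h1 h2
    positivity
  · have hup : Tendsto (fun n : ℕ => 1 / (n : ℝ) +
        max (Real.logb 2 (f n) / n) (Real.logb 2 (g n) / n)) atTop (𝓝 (0 + max a b)) :=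
      (tendsto_const_div_atTop_nhds_zero_nat 1).add (hf.2.max hg.2)
    rw [zero_add] at hup
    refine tendsto_of_tendsto_of_tendsto_of_le_of_le' (hf.2.max hg.2) hup ?_ ?_
    · filter_upwards [hf.1, hg.1, eventually_gt_atTop 0] with n h1 h2 hn
      have hn' : (0 : ℝ) < n := by exact_mod_cast hn
      exact max_le
        (div_le_div_of_nonneg_right
          (Real.logb_le_logb_of_le one_lt_two h1 (by linarith)) hn'.le)
        (div_le_div_of_nonneg_right
          (Real.logb_le_logb_of_le one_lt_two h2 (by linarith)) hn'.le)
    · filter_upwards [hf.1, hg.1, eventually_gt_atTop 0] with n h1 h2 hn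
      have hn' : (0 : ℝ) < n := by exact_mod_cast hn
      rw [max_div_div_right hn'.le, ← add_div]
      gcongr
      have hm : Real.logb 2 (f n + g n) ≤ Real.logb 2 (2 * max (f n) (g n)) := by
        refine Real.logb_le_logb_of_le (by norm_num) (by positivity) ?_
        linarith [le_max_left (f n) (g n), le_max_right (f n) (g n)]
      refine hm.trans ?_
      rw [Real.logb_mul (by norm_num) (lt_max_of_lt_left h1).ne',
        Real.logb_self_eq_one (by norm_num)]
      gcongr
      rcases le_total (f n) (g n) with h | h
      · rw [max_eq_right h]; exact le_max_right _ _
      · rw [max_eq_left h]; exact le_max_left _ _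

theorem HasRate.le (hf : HasRate f a) (hg : HasRate g b) (h : ∀ᶠ n in atTop, f n ≤ g n) :
    a ≤ b := by
  refine le_of_tendsto_of_tendsto hf.2 hg.2 ?_
  filter_upwards [hf.1, h] with n h1 h2
  gcongr
  norm_num

/-- A sequence between two others has their rate; the converse inequality of the rates is
automatic. -/
theorem HasRate.squeeze (hf : HasRate f a) (hg : HasRate g b) (hba : b ≤ a)
    (hfT : ∀ᶠ n in atTop, f n ≤ T n) (hTg : ∀ᶠ n in atTop, T n ≤ g n) : HasRate T a := by
  obtain rfl : b = a := le_antisymm hba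
    (hf.le hg (by filter_upwards [hfT, hTg] with n h1 h2 using h1.trans h2))
  have hT : ∀ᶠ n in atTop, 0 < T n := by
    filter_upwards [hf.1, hfT] with n h1 h2 using h1.trans_le h2
  refine ⟨hT, tendsto_of_tendsto_of_tendsto_of_le_of_le' hf.2 hg.2 ?_ ?_⟩
  · filter_upwards [hf.1, hfT] with n h1 h2
    gcongr
    norm_num
  · filter_upwards [hT, hTg] with n h1 h2
    gcongr
    norm_num

theorem HasRate.eventually_le (hf : HasRate f a) (hg : HasRate g b) (hab : a < b) :
    ∀ᶠ n in atTop, f n ≤ g n := by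
  filter_upwards [hf.2.eventually_lt hg.2 hab, hf.1, hg.1, eventually_gt_atTop 0]
    with n h h1 h2 hn
  have hn' : (0 : ℝ) < n := by exact_mod_cast hn
  rw [div_lt_div_iff_of_pos_right hn'] at h
  exact ((Real.logb_lt_logb_iff (by norm_num) h1 h2).1 h).le

theorem HasRate.nonneg (hf : HasRate f a) (h : ∀ᶠ n in atTop, 1 ≤ f n) : 0 ≤ a :=
  (hasRate_const one_pos).le hf h

theorem hasRate_pow_nat {q : ℝ} (hq : 0 < q) {u : ℕ → ℕ}
    (h : Tendsto (fun n => Real.logb 2 q * ((u n : ℝ) / n)) atTop (𝓝 a)) :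
    HasRate (fun n => q ^ u n) a := by
  refine ⟨Eventually.of_forall fun n => by positivity, h.congr fun n => ?_⟩
  rw [Real.logb_pow]
  ring

/-- The function `x log₂ x`, in terms of which all entropy exponents are expressed; it vanishes at
`0`, as `Real.logb 2 0 = 0`. -/
noncomputable def xlog (x : ℝ) : ℝ := x * Real.logb 2 x

theorem xlog_zero : xlog 0 = 0 := by simp [xlog]

theorem xlog_two_mul {x : ℝ} : xlog (2 * x) = 2 * x + 2 * xlog x := by
  rcases eq_or_ne x 0 with rfl | hx
  · simp [xlog]
  · rw [xlog, xlog, Real.logb_mul (by norm_num) hx, Real.logb_self_eq_one (by norm_num)]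
    ring

theorem mul_logb_div {x P : ℝ} (hP : P ≠ 0) :
    x * Real.logb 2 (x / P) = xlog x - x * Real.logb 2 P := by
  rcases eq_or_ne x 0 with rfl | hx
  · simp [xlog]
  · rw [Real.logb_div hx hP, xlog]
    ring

theorem mul_gTri {P x y : ℝ} (hx : 0 ≤ x) (hy : 0 ≤ y) (hxy : x + y ≤ P) :
    P * gTri (x / P) (y / P) = xlog P - xlog x - xlog y - xlog (P - x - y) := by
  rcases eq_or_ne P 0 with rfl | hP
  · obtain rfl : x = 0 := by linarith
    obtain rfl : y = 0 := by linarith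
    simp [xlog]
  · have h : 1 - x / P - y / P = (P - x - y) / P := by field_simp
    rw [gTri, h]
    have e1 := mul_logb_div (x := x) hP
    have e2 := mul_logb_div (x := y) hP
    have e3 := mul_logb_div (x := P - x - y) hP
    calc _ = -(x * Real.logb 2 (x / P)) - y * Real.logb 2 (y / P) -
          (P - x - y) * Real.logb 2 ((P - x - y) / P) := by field_simp
      _ = _ := by
          rw [e1, e2, e3]
          simp only [xlog]
          ring

theorem mul_hBin {P x : ℝ} (hx : 0 ≤ x) (hxP : x ≤ P) :
    P * hBin (x / P) = xlog P - xlog x - xlog (P - x) := by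
  have h := mul_gTri hx le_rfl (by linarith : x + 0 ≤ P)
  have e : hBin (x / P) = gTri (x / P) (0 / P) := by simp [hBin, gTri]
  rw [e, h, xlog_zero, sub_zero, sub_zero]

end Rates

section Factorials

/-- Weak bounds of Stirling type, by induction from `log (1 + x) ≤ x`. -/
theorem log_factorial_bounds (k : ℕ) :
    (k : ℝ) * Real.log k - k ≤ Real.log (k.factorial : ℝ) ∧
      Real.log (k.factorial : ℝ) ≤ (k + 1) * Real.log (k + 1) - k := by
  induction k with
  | zero => simp
  | succ k ih =>
    have hk : (0 : ℝ) < (k : ℝ) + 1 := by positivity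
    have hf : Real.log ((k + 1).factorial : ℝ) =
        Real.log ((k : ℝ) + 1) + Real.log (k.factorial : ℝ) := by
      rw [Nat.factorial_succ, Nat.cast_mul, Real.log_mul (by positivity) (by positivity)]
      push_cast
      rfl
    rw [hf]
    push_cast
    constructor
    · rcases Nat.eq_zero_or_pos k with rfl | hk0
      · simp
      · have hk' : (0 : ℝ) < k := by exact_mod_cast hk0
        have h := Real.log_le_sub_one_of_pos (div_pos hk hk')
        rw [Real.log_div hk.ne' hk'.ne', add_div, div_self hk'.ne', add_sub_cancel_left,
          le_div_iff₀ hk'] at h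
        nlinarith [ih.1]
    · have hk2 : (0 : ℝ) < (k : ℝ) + 1 + 1 := by positivity
      have h := Real.log_le_sub_one_of_pos (div_pos hk hk2)
      rw [Real.log_div hk.ne' hk2.ne', div_sub_one hk2.ne', le_div_iff₀ hk2] at h
      nlinarith [ih.2]

variable {a k : ℕ → ℕ} {α κ : ℝ}

theorem tendsto_log_succ_div (ha : Tendsto (fun n => (a n : ℝ) / n) atTop (𝓝 α)) :
    Tendsto (fun n => Real.log ((a n : ℝ) + 1) / n) atTop (𝓝 0) := by
  have h1 : Tendsto (fun n : ℕ => 1 / (n : ℝ)) atTop (𝓝 0) :=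
    tendsto_const_div_atTop_nhds_zero_nat 1
  have h2 : Tendsto (fun n : ℕ => 2 * Real.sqrt (((a n : ℝ) / n + 1 / n) * (1 / n))) atTop
      (𝓝 (2 * Real.sqrt ((α + 0) * 0))) :=
    (((ha.add h1).mul h1).sqrt).const_mul 2
  rw [mul_zero, Real.sqrt_zero, mul_zero] at h2
  refine squeeze_zero' (Eventually.of_forall fun n => ?_) ?_ h2
  · exact div_nonneg (Real.log_nonneg (by linarith [Nat.cast_nonneg (α := ℝ) (a n)]))
      (Nat.cast_nonneg n)
  · filter_upwards [eventually_gt_atTop 0] with n hn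
    have hn' : (0 : ℝ) < n := by exact_mod_cast hn
    have hx : (0 : ℝ) < (a n : ℝ) + 1 := by positivity
    have e1 : ((a n : ℝ) / n + 1 / n) * (1 / n) = ((a n : ℝ) + 1) / (n : ℝ) ^ 2 := by
      field_simp
    have hs : Real.log ((a n : ℝ) + 1) ≤ 2 * Real.sqrt ((a n : ℝ) + 1) := by
      have := Real.log_le_sub_one_of_pos (Real.sqrt_pos.2 hx)
      rw [Real.log_sqrt hx.le] at this
      linarith
    rw [e1, Real.sqrt_div hx.le, Real.sqrt_sq hn'.le, ← mul_div_assoc]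
    gcongr

/-- Stirling's formula on the logarithmic scale. -/
theorem tendsto_log_factorial (ha : Tendsto (fun n => (a n : ℝ) / n) atTop (𝓝 α)) :
    Tendsto (fun n => (Real.log ((a n).factorial : ℝ) - a n * Real.log n) / n) atTop
      (𝓝 (α * Real.log α - α)) := by
  have h0 : Tendsto (fun n => (a n : ℝ) / n * Real.log ((a n : ℝ) / n) - (a n : ℝ) / n) atTop
      (𝓝 (α * Real.log α - α)) :=
    ((Real.continuous_mul_log.tendsto α).comp ha).sub ha
  have h1 : Tendsto (fun n : ℕ => 1 / (n : ℝ)) atTop (𝓝 0) :=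
    tendsto_const_div_atTop_nhds_zero_nat 1
  have hup := (h0.add (tendsto_log_succ_div ha)).add h1
  rw [add_zero, add_zero] at hup
  have e : ∀ n : ℕ, 0 < n → (a n : ℝ) / n * Real.log ((a n : ℝ) / n) - (a n : ℝ) / n =
      ((a n : ℝ) * Real.log (a n) - a n - a n * Real.log n) / n := by
    intro n hn
    have hn' : (n : ℝ) ≠ 0 := by exact_mod_cast hn.ne'
    rcases Nat.eq_zero_or_pos (a n) with h | h
    · simp [h]
    · have ha' : (a n : ℝ) ≠ 0 := by exact_mod_cast h.ne'
      rw [Real.log_div ha' hn']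
      field_simp
      ring
  refine tendsto_of_tendsto_of_tendsto_of_le_of_le' h0 hup ?_ ?_
  · filter_upwards [eventually_gt_atTop 0] with n hn
    rw [e n hn]
    gcongr
    exact (log_factorial_bounds (a n)).1
  · filter_upwards [eventually_gt_atTop 0] with n hn
    rw [e n hn, ← add_div, ← add_div]
    gcongr
    have h2 := (log_factorial_bounds (a n)).2
    have h3 : (a n : ℝ) * Real.log ((a n : ℝ) + 1) ≤ (a n : ℝ) * Real.log (a n) + 1 := by
      rcases Nat.eq_zero_or_pos (a n) with h | h
      · simp [h]
      · have ha' : (0 : ℝ) < a n := by exact_mod_cast h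
        have h4 := Real.log_le_sub_one_of_pos (div_pos (by linarith : (0 : ℝ) < a n + 1) ha')
        rw [Real.log_div (by linarith : (a n : ℝ) + 1 ≠ 0) ha'.ne', add_div, div_self ha'.ne',
          add_sub_cancel_left, le_div_iff₀ ha'] at h4
        linarith
    linarith

theorem hasRate_choose (ha : Tendsto (fun n => (a n : ℝ) / n) atTop (𝓝 α))
    (hk : Tendsto (fun n => (k n : ℝ) / n) atTop (𝓝 κ)) (hka : ∀ᶠ n in atTop, k n ≤ a n) :
    HasRate (fun n => ((a n).choose (k n) : ℝ)) (xlog α - xlog κ - xlog (α - κ)) := by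
  have hd : Tendsto (fun n => ((a n - k n : ℕ) : ℝ) / n) atTop (𝓝 (α - κ)) := by
    refine (ha.sub hk).congr' ?_
    filter_upwards [hka] with n h
    rw [Nat.cast_sub h, sub_div]
  have h := (((tendsto_log_factorial ha).sub (tendsto_log_factorial hk)).sub
    (tendsto_log_factorial hd)).div_const (Real.log 2)
  refine ⟨?_, ?_⟩
  · filter_upwards [hka] with n h
    exact_mod_cast Nat.choose_pos h
  · have e : xlog α - xlog κ - xlog (α - κ) = (α * Real.log α - α - (κ * Real.log κ - κ) -
        ((α - κ) * Real.log (α - κ) - (α - κ))) / Real.log 2 := by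
      simp only [xlog, Real.logb]
      ring
    rw [e]
    refine h.congr' ?_
    filter_upwards [hka] with n hn
    have hc : Real.log ((a n).choose (k n) : ℝ) = Real.log ((a n).factorial : ℝ) -
        Real.log ((k n).factorial : ℝ) - Real.log ((a n - k n).factorial : ℝ) := by
      rw [← Nat.choose_mul_factorial_mul_factorial hn]
      have := Nat.choose_pos hn
      push_cast
      rw [Real.log_mul (by positivity) (by positivity), Real.log_mul (by positivity)
        (by positivity)]
      ring
    rw [Real.logb, hc, Nat.cast_sub hn]
    ring

theorem hasRate_trinomial {k' : ℕ → ℕ} {κ' : ℝ}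
    (ha : Tendsto (fun n => (a n : ℝ) / n) atTop (𝓝 α))
    (hk : Tendsto (fun n => (k n : ℝ) / n) atTop (𝓝 κ))
    (hk' : Tendsto (fun n => (k' n : ℝ) / n) atTop (𝓝 κ')) (hka : ∀ᶠ n in atTop, k n + k' n ≤ a n) :
    HasRate (fun n => (trinomial (a n) (k n) (k' n) : ℝ))
      (xlog α - xlog κ - xlog κ' - xlog (α - κ - κ')) := by
  have hs : Tendsto (fun n => ((k n + k' n : ℕ) : ℝ) / n) atTop (𝓝 (κ + κ')) := by
    refine (hk.add hk').congr fun n => ?_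
    push_cast
    ring
  have h := (hasRate_choose ha hs hka).mul
    (hasRate_choose hs hk (Eventually.of_forall fun n => Nat.le_add_right _ _))
  have e : xlog α - xlog κ - xlog κ' - xlog (α - κ - κ') = xlog α - xlog (κ + κ') -
      xlog (α - (κ + κ')) + (xlog (κ + κ') - xlog κ - xlog (κ + κ' - κ)) := by
    rw [add_sub_cancel_left, sub_sub α]
    ring
  rw [e]
  refine h.congr (Eventually.of_forall fun n => ?_)
  rw [trinomial, Nat.cast_mul]

theorem hasRate_succ (ha : Tendsto (fun n => (a n : ℝ) / n) atTop (𝓝 α)) :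
    HasRate (fun n => (a n : ℝ) + 1) 0 := by
  refine ⟨Eventually.of_forall fun n => by positivity, ?_⟩
  have := (tendsto_log_succ_div ha).div_const (Real.log 2)
  rw [zero_div] at this
  refine this.congr fun n => ?_
  rw [Real.logb]
  ring

theorem hasRate_two_pow (ha : Tendsto (fun n => (a n : ℝ) / n) atTop (𝓝 α)) :
    HasRate (fun n => (2 : ℝ) ^ a n) α := by
  refine hasRate_pow_nat two_pos ?_
  simpa using ha

end Factorials

/-! ### Growth rates of the parameters -/

section Regime

/-- Sequences of admissible parameters with converging ratios to `n`. -/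
structure Regime (p : ℕ → Params) (R L : ℝ) (V M E B C : ℕ → ℝ) : Prop where
  adm : ∀ᶠ n in atTop, (p n).Admissible
  lim_k : Tendsto (fun n => ((p n).k : ℝ) / n) atTop (𝓝 R)
  lim_ℓ : Tendsto (fun n => ((p n).ℓ : ℝ) / n) atTop (𝓝 L)
  lim_v : Tendsto (fun n => ((p n).v : ℝ) / n) atTop (𝓝 (V 0))
  M_zero : M 0 = 0
  lim_eps : ∀ i < 2, Tendsto (fun n => ((p n).eps (i + 1) : ℝ) / n) atTop (𝓝 (E (i + 1)))
  lim_b : ∀ i < 2, Tendsto (fun n => ((p n).b (i + 1) : ℝ) / n) atTop (𝓝 (B (i + 1)))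
  lim_c : ∀ i < 2, Tendsto (fun n => ((p n).c (i + 1) : ℝ) / n) atTop (𝓝 (C (i + 1)))
  V_succ : ∀ i < 2, V (i + 1) = V i / 2 + E (i + 1) + C (i + 1)
  M_succ : ∀ i < 2, M (i + 1) = (M i - C (i + 1)) / 2 + B (i + 1)

theorem cast_half_of_even {n : ℕ} (h : Even n) : ((n / 2 : ℕ) : ℝ) = (n : ℝ) / 2 := by
  obtain ⟨k, rfl⟩ := h
  have : (k + k) / 2 = k := by omega
  rw [this]
  push_cast
  ring

variable {p : ℕ → Params} {R L : ℝ} {V M E B C : ℕ → ℝ}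

namespace Regime

theorem lim_len (h : Regime p R L V M E B C) :
    Tendsto (fun n => ((p n).len : ℝ) / n) atTop (𝓝 (R + L)) := by
  refine (h.lim_k.add h.lim_ℓ).congr fun n => ?_
  rw [Params.len, Nat.cast_add, add_div]

theorem lim_weights (h : Regime p R L V M E B C) {i : ℕ} (hi : i ≤ 2) :
    Tendsto (fun n => ((p n).vAt i : ℝ) / n) atTop (𝓝 (V i)) ∧
      Tendsto (fun n => ((p n).mAt i : ℝ) / n) atTop (𝓝 (M i)) := by
  induction i with
  | zero =>
    refine ⟨h.lim_v, ?_⟩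
    rw [h.M_zero]
    refine tendsto_const_nhds.congr fun n => ?_
    simp [Params.mAt, Params.weights]
  | succ i ih =>
    obtain ⟨ihv, ihm⟩ := ih (by omega)
    have hi' : i < 2 := by omega
    rw [h.V_succ i hi', h.M_succ i hi']
    refine ⟨(((ihv.div_const 2).add (h.lim_eps i hi')).add (h.lim_c i hi')).congr' ?_,
      (((ihm.sub (h.lim_c i hi')).div_const 2).add (h.lim_b i hi')).congr' ?_⟩
    · filter_upwards [h.adm] with n hn
      rw [Params.vAt_succ, Nat.cast_add, Nat.cast_add, cast_half_of_even (hn.even_v i hi'.le)]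
      ring
    · filter_upwards [h.adm] with n hn
      rw [Params.mAt_succ, Nat.cast_add, cast_half_of_even (hn.even_sub i hi'),
        Nat.cast_sub (hn.c_le i hi')]
      ring

theorem lim_le {f g : ℕ → ℕ} {a b : ℝ} (hf : Tendsto (fun n => (f n : ℝ) / n) atTop (𝓝 a))
    (hg : Tendsto (fun n => (g n : ℝ) / n) atTop (𝓝 b)) (hfg : ∀ᶠ n in atTop, f n ≤ g n) :
    a ≤ b := by
  refine le_of_tendsto_of_tendsto hf hg ?_
  filter_upwards [hfg] with n hn
  gcongr

theorem lim_nonneg {f : ℕ → ℕ} {a : ℝ} (hf : Tendsto (fun n => (f n : ℝ) / n) atTop (𝓝 a)) :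
    0 ≤ a :=
  ge_of_tendsto hf (Eventually.of_forall fun n => by positivity)

theorem weights_nonneg (h : Regime p R L V M E B C) {i : ℕ} (hi : i ≤ 2) :
    0 ≤ V i ∧ 0 ≤ M i ∧ V i + M i ≤ R + L := by
  obtain ⟨hv, hm⟩ := h.lim_weights hi
  refine ⟨lim_nonneg hv, lim_nonneg hm, ?_⟩
  have hs : Tendsto (fun n => (((p n).vAt i + (p n).mAt i : ℕ) : ℝ) / n) atTop
      (𝓝 (V i + M i)) := by
    refine (hv.add hm).congr fun n => ?_
    rw [Nat.cast_add, add_div]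
  exact lim_le hs h.lim_len (h.adm.mono fun n hn => hn.weights_le hi)

theorem searchExp_eq (h : Regime p R L V M E B C) {i : ℕ} (hi : i ≤ 2) :
    searchExp R L (V i) (M i) = xlog (R + L) - xlog (V i) - xlog (M i) -
      xlog (R + L - V i - M i) + (V i + M i) := by
  obtain ⟨h1, h2, h3⟩ := h.weights_nonneg hi
  rw [searchExp, mul_gTri h1 h2 h3, Z, Real.logb_self_eq_one (by norm_num), one_mul]

theorem hasRate_level {F : Type*} [Field F] [Fintype F] [DecidableEq F] (h2 : (2 : F) ≠ 0)
    (h3 : (3 : F) ≠ 0) (h : Regime p R L V M E B C) {i : ℕ} (hi : i ≤ 2) :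
    HasRate (fun n => (((p n).level F i).card : ℝ)) (searchExp R L (V i) (M i)) := by
  obtain ⟨hv, hm⟩ := h.lim_weights hi
  have hs : Tendsto (fun n => (((p n).vAt i + (p n).mAt i : ℕ) : ℝ) / n) atTop
      (𝓝 (V i + M i)) := by
    refine (hv.add hm).congr fun n => ?_
    rw [Nat.cast_add, add_div]
  rw [h.searchExp_eq hi]
  refine ((hasRate_trinomial h.lim_len hv hm (h.adm.mono fun n hn => hn.weights_le hi)).mul
    (hasRate_two_pow hs)).congr (Eventually.of_forall fun n => ?_)
  rw [Params.card_level h2 h3]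
  push_cast
  rfl

theorem hasRate_halfCount (h : Regime p R L V M E B C) :
    HasRate (fun n => (halfCount (p n) : ℝ)) (searchExp R L (V 2) (M 2) / 2) := by
  obtain ⟨hv, hm⟩ := h.lim_weights le_rfl
  have half : ∀ {f : ℕ → ℕ} {a : ℝ}, Tendsto (fun n => (f n : ℝ) / n) atTop (𝓝 a) →
      (∀ᶠ n in atTop, Even (f n)) →
      Tendsto (fun n => ((f n / 2 : ℕ) : ℝ) / n) atTop (𝓝 (a / 2)) := by
    intro f a hf he
    refine (hf.div_const 2).congr' ?_
    filter_upwards [he] with n hn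
    rw [cast_half_of_even hn]
    ring
  have hv' := half hv (h.adm.mono fun n hn => hn.even_v 2 le_rfl)
  have hm' := half hm (h.adm.mono fun n hn => hn.even_m)
  have hl' := half h.lim_len (h.adm.mono fun n hn => hn.even_len)
  have hs : Tendsto (fun n => (((p n).vAt 2 / 2 + (p n).mAt 2 / 2 : ℕ) : ℝ) / n) atTop
      (𝓝 (V 2 / 2 + M 2 / 2)) := by
    refine (hv'.add hm').congr fun n => ?_
    rw [Nat.cast_add, add_div]
  have key := (hasRate_trinomial hl' hv' hm' (h.adm.mono fun n hn => by
    have := hn.weights_le (i := 2) le_rfl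
    omega)).mul (hasRate_two_pow hs)
  have e : ∀ x : ℝ, xlog x = x + 2 * xlog (x / 2) := by
    intro x
    have := xlog_two_mul (x := x / 2)
    rwa [mul_div_cancel₀ x two_ne_zero] at this
  have hexp : searchExp R L (V 2) (M 2) / 2 = xlog ((R + L) / 2) - xlog (V 2 / 2) -
      xlog (M 2 / 2) - xlog ((R + L) / 2 - V 2 / 2 - M 2 / 2) + (V 2 / 2 + M 2 / 2) := by
    rw [h.searchExp_eq le_rfl, e (R + L), e (V 2), e (M 2), e (R + L - V 2 - M 2)]
    have : (R + L - V 2 - M 2) / 2 = (R + L) / 2 - V 2 / 2 - M 2 / 2 := by ring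
    rw [this]
    ring
  rw [hexp]
  refine key.congr (Eventually.of_forall fun n => ?_)
  rw [halfCount]
  push_cast
  rfl

theorem hasRate_reprFormula (h : Regime p R L V M E B C) {i : ℕ} (hi : i < 2) :
    HasRate (fun n => ((p n).reprFormula i : ℝ))
      (reprExp R L (V i) (M i) (E (i + 1)) (B (i + 1)) (C (i + 1))) := by
  obtain ⟨hv, hm⟩ := h.lim_weights hi.le
  obtain ⟨nv, nm, nvm⟩ := h.weights_nonneg hi.le
  have hb := h.lim_b i hi
  have hc := h.lim_c i hi
  have he := h.lim_eps i hi
  have nb := lim_nonneg hb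
  have nc := lim_nonneg hc
  have ne := lim_nonneg he
  have hv' : Tendsto (fun n => (((p n).vAt i / 2 : ℕ) : ℝ) / n) atTop (𝓝 (V i / 2)) := by
    refine (hv.div_const 2).congr' ?_
    filter_upwards [h.adm] with n hn
    rw [cast_half_of_even (hn.even_v i hi.le)]
    ring
  have hg : Tendsto (fun n => ((((p n).mAt i - (p n).c (i + 1)) / 2 : ℕ) : ℝ) / n) atTop
      (𝓝 ((M i - C (i + 1)) / 2)) := by
    refine ((hm.sub hc).div_const 2).congr' ?_
    filter_upwards [h.adm] with n hn
    rw [cast_half_of_even (hn.even_sub i hi), Nat.cast_sub (hn.c_le i hi)]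
    ring
  have ho : Tendsto (fun n => (((p n).len - (p n).vAt i - (p n).mAt i : ℕ) : ℝ) / n) atTop
      (𝓝 (R + L - V i - M i)) := by
    refine ((h.lim_len.sub hv).sub hm).congr' ?_
    filter_upwards [h.adm] with n hn
    have := hn.weights_le hi.le
    rw [Nat.cast_sub (by omega), Nat.cast_sub (by omega)]
    ring
  have bv : B (i + 1) ≤ V i / 2 := lim_le hb hv' (h.adm.mono fun n hn => hn.b_le i hi)
  have cm : C (i + 1) ≤ M i := lim_le hc hm (h.adm.mono fun n hn => hn.c_le i hi)
  have eo : E (i + 1) ≤ R + L - V i - M i := lim_le he ho (h.adm.mono fun n hn => by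
    have := hn.eps_le i hi
    omega)
  have k1 := hasRate_choose hv hv' (Eventually.of_forall fun n => Nat.div_le_self _ _)
  have k2 := (hasRate_choose hv' hb (h.adm.mono fun n hn => hn.b_le i hi)).pow 2
  have k3 := hasRate_trinomial hm hg hc (h.adm.mono fun n hn => by
    have := hn.c_le i hi
    omega)
  have k4 := (hasRate_choose ho he (h.adm.mono fun n hn => by
    have := hn.eps_le i hi
    omega)).mul (hasRate_two_pow he)
  have key := ((k1.mul k2).mul k3).mul k4
  have hexp : reprExp R L (V i) (M i) (E (i + 1)) (B (i + 1)) (C (i + 1)) =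
      xlog (V i) - xlog (V i / 2) - xlog (V i - V i / 2) +
        ((2 : ℕ) : ℝ) * (xlog (V i / 2) - xlog (B (i + 1)) - xlog (V i / 2 - B (i + 1))) +
      (xlog (M i) - xlog ((M i - C (i + 1)) / 2) - xlog (C (i + 1)) -
        xlog (M i - (M i - C (i + 1)) / 2 - C (i + 1))) +
      (xlog (R + L - V i - M i) - xlog (E (i + 1)) - xlog (R + L - V i - M i - E (i + 1)) +
        E (i + 1)) := by
    have r1 : V i * hBin (2 * B (i + 1) / V i) = xlog (V i) - xlog (2 * B (i + 1)) -
        xlog (V i - 2 * B (i + 1)) := mul_hBin (by linarith) (by linarith)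
    have r2 : M i * gTri (C (i + 1) / M i) ((M i - C (i + 1)) / (2 * M i)) = xlog (M i) -
        xlog (C (i + 1)) - xlog ((M i - C (i + 1)) / 2) -
          xlog (M i - C (i + 1) - (M i - C (i + 1)) / 2) := by
      rw [← mul_gTri nc (by linarith) (by linarith), div_div]
    have r3 := mul_hBin (P := R + L - V i - M i) ne eo
    have t1 := xlog_two_mul (x := B (i + 1))
    have t2 := xlog_two_mul (x := V i / 2 - B (i + 1))
    have t3 : 2 * (V i / 2 - B (i + 1)) = V i - 2 * B (i + 1) := by ring
    have t4 : V i - V i / 2 = V i / 2 := by ring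
    have t5 : M i - (M i - C (i + 1)) / 2 - C (i + 1) =
        M i - C (i + 1) - (M i - C (i + 1)) / 2 := by ring
    rw [t3] at t2
    rw [reprExp, mul_add, mul_one, r1, r2, r3, Z, Real.logb_self_eq_one (by norm_num), one_mul,
      t1, t2, t4, t5]
    push_cast
    ring
  rw [hexp]
  refine key.congr (Eventually.of_forall fun n => ?_)
  rw [Params.reprFormula]
  push_cast
  ring

variable {F : Type*} [Field F] [Fintype F] [DecidableEq F]

theorem hasRate_reprCount (h2 : (2 : F) ≠ 0) (h3 : (3 : F) ≠ 0) (h : Regime p R L V M E B C)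
    {i : ℕ} (hi : i < 2) :
    HasRate (fun n => ((p n).reprCount F i : ℝ))
      (reprExp R L (V i) (M i) (E (i + 1)) (B (i + 1)) (C (i + 1))) := by
  refine (h.hasRate_reprFormula hi).congr ?_
  filter_upwards [h.adm] with n hn
  rw [hn.reprCount_eq h2 h3 hi]

/-- Rounding `log_q r_i` down changes it by at most one. -/
theorem lim_mergePos (h2 : (2 : F) ≠ 0) (h3 : (3 : F) ≠ 0) (h : Regime p R L V M E B C)
    {i : ℕ} (hi : i < 2) :
    Tendsto (fun n => Real.logb 2 (Fintype.card F) * (((p n).mergePos F i : ℝ) / n)) atTop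
      (𝓝 (reprExp R L (V i) (M i) (E (i + 1)) (B (i + 1)) (C (i + 1)))) := by
  have hr := h.hasRate_reprCount h2 h3 hi
  have hq1 : (1 : ℕ) < Fintype.card F := Fintype.one_lt_card
  have hlow := hr.2.sub (tendsto_const_div_atTop_nhds_zero_nat (Real.logb 2 (Fintype.card F)))
  rw [sub_zero] at hlow
  refine tendsto_of_tendsto_of_tendsto_of_le_of_le' hlow hr.2 ?_ ?_
  · filter_upwards [hr.1] with n hn
    rw [← sub_div, ← mul_div_assoc]
    gcongr
    have h1 : ((p n).reprCount F i : ℝ) ≤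
        (Fintype.card F : ℝ) ^ ((p n).mergePos F i + 1) := by
      exact_mod_cast (Nat.lt_pow_succ_log_self hq1 _).le
    have h4 := Real.logb_le_logb_of_le one_lt_two hn h1
    rw [Real.logb_pow] at h4
    push_cast at h4
    linarith
  · filter_upwards [hr.1] with n hn
    rw [← mul_div_assoc]
    gcongr
    have h1 : (Fintype.card F : ℝ) ^ ((p n).mergePos F i) ≤ ((p n).reprCount F i : ℝ) := by
      exact_mod_cast Nat.pow_log_le_self (Fintype.card F)
        (by rintro h0; rw [h0] at hn; simp at hn)
    have h4 := Real.logb_le_logb_of_le one_lt_two (by positivity) h1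
    rw [Real.logb_pow] at h4
    linarith

theorem hasRate_pow_mergePos (h2 : (2 : F) ≠ 0) (h3 : (3 : F) ≠ 0)
    (h : Regime p R L V M E B C) {i : ℕ} (hi : i < 2) :
    HasRate (fun n => (Fintype.card F : ℝ) ^ (p n).mergePos F i)
      (reprExp R L (V i) (M i) (E (i + 1)) (B (i + 1)) (C (i + 1))) :=
  hasRate_pow_nat card_field_pos (h.lim_mergePos h2 h3 hi)

theorem hasRate_pow_ℓ (h : Regime p R L V M E B C) :
    HasRate (fun n => (Fintype.card F : ℝ) ^ (p n).ℓ) (Real.logb 2 (Fintype.card F) * L) :=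
  hasRate_pow_nat card_field_pos (h.lim_ℓ.const_mul _)

theorem hasRate_concatSet (h2 : (2 : F) ≠ 0) (h3 : (3 : F) ≠ 0) (h : Regime p R L V M E B C) :
    HasRate (fun n => ((concatSet (p n) F).card : ℝ)) (searchExp R L (V 2) (M 2)) := by
  have := h.hasRate_halfCount.pow 2
  have e : ((2 : ℕ) : ℝ) * (searchExp R L (V 2) (M 2) / 2) = searchExp R L (V 2) (M 2) := by
    push_cast
    ring
  rw [e] at this
  refine this.congr ?_
  filter_upwards [h.adm] with n hn
  rw [card_concatSet _ h2 h3 hn, Nat.cast_pow]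

/-- Restricting to balanced representations costs a polynomial factor only. -/
theorem hasRate_balancedCount (h2 : (2 : F) ≠ 0) (h3 : (3 : F) ≠ 0)
    (h : Regime p R L V M E B C) :
    HasRate (fun n => (balancedCount (p n) F : ℝ)) (searchExp R L (V 1) (M 1) +
      reprExp R L (V 1) (M 1) (E 2) (B 2) (C 2)) := by
  have hup := (h.hasRate_level (F := F) h2 h3 (i := 1) (by norm_num)).mul
    (h.hasRate_reprFormula (i := 1) (by norm_num))
  have hlow := hup.div ((hasRate_succ h.lim_len).pow typeCount)
  rw [mul_zero, sub_zero] at hlow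
  refine hlow.squeeze hup le_rfl ?_ ?_
  · filter_upwards [h.adm] with n hn
    have h1 := (Nat.cast_le (α := ℝ)).2 (card_level_mul_reprFormula_le (p n) h2 h3 hn)
    rw [← balancedCount, Nat.cast_mul, Nat.cast_mul, Nat.cast_pow, Nat.cast_add,
      Nat.cast_one] at h1
    rwa [div_le_iff₀ (pow_pos (by positivity) _)]
  · filter_upwards [h.adm] with n hn
    have h1 : balancedCount (p n) F ≤ ((p n).level F 1).card * (p n).reprFormula 1 := by
      rw [balancedCount, ← smul_eq_mul]
      refine Finset.sum_le_card_nsmul _ _ _ fun z hz => ?_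
      rw [← hn.card_levelReprs h2 h3 (by norm_num) hz]
      exact Finset.card_le_card (Finset.filter_subset _ _)
    exact_mod_cast h1

end Regime
end Regime

/-! ### The exponent of the expected cost -/

section Cost

variable {F : Type*} [Field F] [Fintype F] [DecidableEq F]
  {p : ℕ → Params} {R L : ℝ} {V M E B C : ℕ → ℝ}

/-- The exponent of the expected cost. The upper bound holds throughout. For the lower bound there
are two cases, depending on whether the last term of the maximum exceeds the others. -/
theorem Regime.hasRate_expectedCost (h2 : (2 : F) ≠ 0) (h3 : (3 : F) ≠ 0)
    (h : Regime p R L V M E B C)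
    (hu : ∀ᶠ n in atTop, (p n).mergePos F 1 ≤ (p n).mergePos F 0 ∧ (p n).mergePos F 0 ≤ (p n).ℓ)
    (e : ∀ n, Fin (p n).len → F) (t : ∀ n, Fin (p n).ℓ → F) :
    HasRate (fun n => expectedCost (p n) (e n) (t n))
      (enumCost (Real.logb 2 (Fintype.card F)) L
        (searchExp R L (V 1) (M 1)) (searchExp R L (V 2) (M 2))
        (reprExp R L (V 0) (M 0) (E 1) (B 1) (C 1))
        (reprExp R L (V 1) (M 1) (E 2) (B 2) (C 2))) := by
  have rh := h.hasRate_halfCount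
  have rC := h.hasRate_concatSet (F := F) h2 h3
  have rS1 := h.hasRate_level (F := F) h2 h3 (i := 1) (by norm_num)
  have rS2 := h.hasRate_level (F := F) h2 h3 (i := 2) le_rfl
  have ru1 : HasRate (fun n => (Fintype.card F : ℝ) ^ (p n).mergePos F 1)
    (reprExp R L (V 1) (M 1) (E 2) (B 2) (C 2)) := h.hasRate_pow_mergePos h2 h3 (by norm_num)
  have ru0 : HasRate (fun n => (Fintype.card F : ℝ) ^ (p n).mergePos F 0)
    (reprExp R L (V 0) (M 0) (E 1) (B 1) (C 1)) := h.hasRate_pow_mergePos h2 h3 (by norm_num)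
  have rr1 : HasRate (fun n => ((p n).reprFormula 1 : ℝ))
    (reprExp R L (V 1) (M 1) (E 2) (B 2) (C 2)) := h.hasRate_reprFormula (by norm_num)
  have rl := h.hasRate_pow_ℓ (F := F)
  have rT := h.hasRate_balancedCount (F := F) h2 h3
  have hS2 : 0 ≤ searchExp R L (V 2) (M 2) / 2 := by
    refine rh.nonneg ?_
    filter_upwards [rh.1] with n hn
    exact_mod_cast hn
  have hU1 : 0 ≤ reprExp R L (V 1) (M 1) (E 2) (B 2) (C 2) :=
    ru1.nonneg (Eventually.of_forall fun n =>
      one_le_pow₀ (by exact_mod_cast (Fintype.card_pos (α := F))))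
  have hL : 0 ≤ Real.logb 2 (Fintype.card F) * L :=
    rl.nonneg (Eventually.of_forall fun n =>
      one_le_pow₀ (by exact_mod_cast (Fintype.card_pos (α := F))))
  -- distinct representations are distinct pairs of level-2 vectors
  have hS1U1 : searchExp R L (V 1) (M 1) + reprExp R L (V 1) (M 1) (E 2) (B 2) (C 2) ≤
      ((2 : ℕ) : ℝ) * searchExp R L (V 2) (M 2) := by
    refine (rS1.mul rr1).le (rS2.pow 2) ?_
    filter_upwards [h.adm] with n hn
    exact_mod_cast hn.card_level_mul_le h2 h3 (by norm_num : 1 < 2)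
  generalize searchExp R L (V 1) (M 1) = S₁ at *
  generalize searchExp R L (V 2) (M 2) = S₂ at *
  generalize reprExp R L (V 1) (M 1) (E 2) (B 2) (C 2) = U₁ at *
  generalize reprExp R L (V 0) (M 0) (E 1) (B 1) (C 1) = U₀ at *
  rw [enumCost]
  generalize Real.logb 2 (Fintype.card F) * L = QL at *
  push_cast at hS1U1
  have rx := rC.div ru1
  have ry := (rC.pow 2).div (ru1.mul ru0)
  have rk := (rS1.pow 2).div (ru0.mul rl)
  have rz := rS1.div ru0
  push_cast at ry rk
  have hq1 : (0 : ℝ) < Fintype.card F + 1 := by positivity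
  have hup := (((rh.const_mul (c := 16) (by norm_num)).add
    ((rx.add (hasRate_const one_pos)).const_mul (c := 8) (by norm_num))).add
    (((ry.add (rx.const_mul hq1)).add (hasRate_const one_pos)).const_mul (c := 6)
      (by norm_num))).add
    (((rk.add (rz.const_mul hq1)).add (hasRate_const one_pos)).const_mul (c := 2) (by norm_num))
  have hTup := fun n (hn : (p n).Admissible) hu₁ hu₀ =>
    expectedCost_le (p n) (e n) (t n) h2 h3 hn hu₁ hu₀
  simp only [pow_add] at hTup
  have hlow3 : ∀ᶠ n in atTop, (halfCount (p n) : ℝ) ≤ expectedCost (p n) (e n) (t n) ∧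
      ((concatSet (p n) F).card : ℝ) / (Fintype.card F : ℝ) ^ (p n).mergePos F 1 ≤
        expectedCost (p n) (e n) (t n) ∧
      ((concatSet (p n) F).card : ℝ) ^ 2 / ((Fintype.card F : ℝ) ^ (p n).mergePos F 1 *
        (Fintype.card F : ℝ) ^ (p n).mergePos F 0) ≤ expectedCost (p n) (e n) (t n) := by
    filter_upwards [h.adm, hu] with n hn hun
    refine ⟨halfCount_le_expectedCost _ _ _ h2 h3 hn,
      concatSet_le_expectedCost _ _ _ h2 h3 hn (hun.1.trans hun.2), ?_⟩
    rw [← pow_add]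
    exact pairs_le_expectedCost _ _ _ hun.1 hun.2
  have r3 := (rh.add rx).add ry
  have hupT := hu.mp (h.adm.mono fun n hn hun => hTup n hn hun.1 hun.2)
  by_cases hcase : 2 * S₁ - U₀ - QL ≤ max (max (S₂ / 2) (S₂ - U₁)) (2 * S₂ - U₁ - U₀)
  · -- the last merge is not dominant, and the sizes of the lists before it are enough
    have hrate : max (max (S₂ / 2) (S₂ - U₁)) (max (2 * S₂ - U₁ - U₀) (2 * S₁ - U₀ - QL)) =
        max (max (S₂ / 2) (S₂ - U₁)) (2 * S₂ - (U₁ + U₀)) := by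
      rw [← max_assoc, max_eq_left hcase, sub_sub]
    rw [hrate]
    rw [sub_sub (2 * S₂)] at hcase
    have hx : S₂ - U₁ ≤ max (max (S₂ / 2) (S₂ - U₁)) (2 * S₂ - (U₁ + U₀)) :=
      (le_max_right _ _).trans (le_max_left _ _)
    have h0 : 0 ≤ max (max (S₂ / 2) (S₂ - U₁)) (2 * S₂ - (U₁ + U₀)) :=
      hS2.trans ((le_max_left _ _).trans (le_max_left _ _))
    have hz : S₁ - U₀ ≤ max (max (S₂ / 2) (S₂ - U₁)) (2 * S₂ - (U₁ + U₀)) :=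
      le_max_of_le_right (by linarith)
    refine (r3.const_mul (c := 1 / 3) (by norm_num)).squeeze hup ?_ ?_ hupT
    · rw [← sub_sub (2 * S₁)]
      exact max_le (max_le (max_le ((le_max_left _ _).trans (le_max_left _ _)) (max_le hx h0))
        (max_le (max_le (le_max_right _ _) hx) h0)) (max_le (max_le hcase hz) h0)
    · filter_upwards [hlow3] with n hn
      linarith [hn.1, hn.2.1, hn.2.2]
  · -- the last merge is dominant, which leaves room for the second moment bound
    rw [not_le, max_lt_iff, max_lt_iff] at hcase
    obtain ⟨⟨hc1, hc2⟩, hc3⟩ := hcase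
    have hrate : max (max (S₂ / 2) (S₂ - U₁)) (max (2 * S₂ - U₁ - U₀) (2 * S₁ - U₀ - QL)) =
        4 * (S₁ + U₁) - (2 * S₁ + (U₀ + QL + 4 * U₁)) := by
      rw [max_eq_right hc3.le, max_eq_right (max_le hc1.le hc2.le)]
      ring
    -- the excess over the third term, together with `QL, U₁ ≥ 0`
    have hroom : S₂ < S₁ + U₁ := by linarith
    have hbal : ∀ᶠ n in atTop,
        2 * (((p n).level F 2).card * (Fintype.card F ^ 3 + 1)) ≤ balancedCount (p n) F := by
      filter_upwards [(rS2.const_mul (c := 2 * ((Fintype.card F : ℝ) ^ 3 + 1))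
        (by positivity)).eventually_le rT hroom] with n hn
      rw [← Nat.cast_le (α := ℝ)]
      push_cast
      linarith
    have hm : 0 < 4 * momentConst (Fintype.card F : ℝ) := by
      unfold momentConst
      positivity
    have rlow := (rT.pow 4).div (((rS1.pow 2).const_mul hm).mul ((ru0.mul rl).mul (ru1.pow 4)))
    push_cast at rlow
    rw [hrate]
    refine rlow.squeeze hup ?_ ?_ hupT
    · refine max_le (max_le (max_le ?_ (max_le ?_ ?_)) (max_le (max_le ?_ ?_) ?_))
        (max_le (max_le ?_ ?_) ?_) <;> linarith
    · filter_upwards [h.adm, hu, hbal] with n hn hun hb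
      refine le_trans (le_of_eq ?_)
        (final_le_expectedCost (p n) (e n) (t n) h2 h3 hn hun.1 hun.2 hb)
      rw [pow_add, pow_add, mul_comm 4 ((p n).mergePos F 1), pow_mul]

end Cost

end RSDP

open RSDP

theorem mainTheorem1 {F : Type*} [Field F] [Fintype F] [DecidableEq F]
    (h2 : (2 : F) ≠ 0) (h3 : (3 : F) ≠ 0) :
    -- exact counts on every level, for all admissible parameters
    (∀ p : Params, p.Admissible →
      (∀ i ≤ 2, (p.level F i).card =
        trinomial p.len (p.vAt i) (p.mAt i) * 2 ^ (p.vAt i + p.mAt i)) ∧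
      (∀ i < 2,
        (p.reprCount F i = (p.vAt i).choose (p.vAt i / 2)
          * ((p.vAt i / 2).choose (p.b (i + 1))) ^ 2
          * trinomial (p.mAt i) ((p.mAt i - p.c (i + 1)) / 2) (p.c (i + 1))
          * ((p.len - p.vAt i - p.mAt i).choose (p.eps (i + 1)) * 2 ^ p.eps (i + 1))) ∧
        (∀ e ∈ p.level F i, (p.levelReprs i e).card = p.reprCount F i ∧
          ∀ x ∈ p.levelReprs i e, x ∈ p.level F (i + 1) ∧ e - x ∈ p.level F (i + 1))) ∧
      -- everything that the algorithm returns solves the smaller instance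
      (∀ (A : Matrix (Fin p.len) (Fin p.ℓ) F) (s : Fin p.ℓ → F),
        ∀ x ∈ (bjmmPlus p A s).val, x ∈ p.level F 0 ∧ Matrix.vecMul x A = s)) ∧
    -- asymptotics
    (∀ (p : ℕ → Params) (R L : ℝ) (V M E B C : ℕ → ℝ),
      (∀ᶠ n in atTop, (p n).Admissible ∧
        (p n).mergePos F 1 ≤ (p n).mergePos F 0 ∧ (p n).mergePos F 0 ≤ (p n).ℓ) →
      Tendsto (fun n => ((p n).k : ℝ) / n) atTop (𝓝 R) →
      Tendsto (fun n => ((p n).ℓ : ℝ) / n) atTop (𝓝 L) →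
      Tendsto (fun n => ((p n).v : ℝ) / n) atTop (𝓝 (V 0)) →
      M 0 = 0 →
      (∀ i, 1 ≤ i → i ≤ 2 →
        Tendsto (fun n => ((p n).eps i : ℝ) / n) atTop (𝓝 (E i)) ∧
        Tendsto (fun n => ((p n).b i : ℝ) / n) atTop (𝓝 (B i)) ∧
        Tendsto (fun n => ((p n).c i : ℝ) / n) atTop (𝓝 (C i)) ∧
        V i = V (i - 1) / 2 + E i + C i ∧
        M i = (M (i - 1) - C i) / 2 + B i) →
      -- weights and search spaces
      (∀ i ≤ 2,
        Tendsto (fun n => ((p n).vAt i : ℝ) / n) atTop (𝓝 (V i)) ∧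
        Tendsto (fun n => ((p n).mAt i : ℝ) / n) atTop (𝓝 (M i)) ∧
        Tendsto (fun n => Real.logb 2 ((p n).level F i).card / n) atTop
          (𝓝 (searchExp R L (V i) (M i)))) ∧
      -- numbers of representations, and of merged positions
      (∀ i < 2,
        Tendsto (fun n => Real.logb 2 ((p n).reprCount F i) / n) atTop
          (𝓝 (reprExp R L (V i) (M i) (E (i + 1)) (B (i + 1)) (C (i + 1)))) ∧
        Tendsto (fun n => Real.logb 2 (Fintype.card F) * (((p n).mergePos F i : ℝ) / n)) atTop
          (𝓝 (reprExp R L (V i) (M i) (E (i + 1)) (B (i + 1)) (C (i + 1))))) ∧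
      -- the enumeration cost
      (∀ (e : ∀ n, Fin (p n).len → F) (t : ∀ n, Fin (p n).ℓ → F),
        Tendsto (fun n => Real.logb 2 (expectedCost (p n) (e n) (t n)) / n) atTop
          (𝓝 (enumCost (Real.logb 2 (Fintype.card F)) L
            (searchExp R L (V 1) (M 1)) (searchExp R L (V 2) (M 2))
            (reprExp R L (V 0) (M 0) (E 1) (B 1) (C 1))
            (reprExp R L (V 1) (M 1) (E 2) (B 2) (C 2)))))) := by
  refine ⟨fun p hp => ⟨fun i hi => p.card_level h2 h3 i, fun i hi => ⟨hp.reprCount_eq h2 h3 hi,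
      fun e he => ⟨?_, fun x hx => hp.summands_mem_level h2 h3 hi hx⟩⟩,
    fun A s x hx => of_mem_bjmmPlus p A s hx⟩, fun p R L V M E B C hadm hk hl hv hM hi => ?_⟩
  · rw [hp.card_levelReprs h2 h3 hi he, hp.reprCount_eq h2 h3 hi]
  · have h : Regime p R L V M E B C :=
      { adm := hadm.mono fun n hn => hn.1
        lim_k := hk
        lim_ℓ := hl
        lim_v := hv
        M_zero := hM
        lim_eps := fun i h => (hi (i + 1) (by omega) (by omega)).1
        lim_b := fun i h => (hi (i + 1) (by omega) (by omega)).2.1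
        lim_c := fun i h => (hi (i + 1) (by omega) (by omega)).2.2.1
        V_succ := fun i h => (hi (i + 1) (by omega) (by omega)).2.2.2.1
        M_succ := fun i h => (hi (i + 1) (by omega) (by omega)).2.2.2.2 }
    exact ⟨fun i hi => ⟨(h.lim_weights hi).1, (h.lim_weights hi).2, (h.hasRate_level h2 h3 hi).2⟩,
      fun i hi => ⟨(h.hasRate_reprCount h2 h3 hi).2, h.lim_mergePos h2 h3 hi⟩,
      fun e t => (h.hasRate_expectedCost h2 h3 (hadm.mono fun n hn => hn.2) e t).2⟩
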